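/- Fix integers $d\ge 1$ and $k\ge 2$. Let $\|\cdot\|$ be a norm on $\mathbb R^d$ and $h:[0,\infty)\to[0,\infty)$ a strictly increasing function such that $h(\|x\|)\in\mathbb Q$ for all $x\in\mathbb Q^d$. An instance $\mathcal I=(F^{(1)},\dots,F^{(t)})$ consists of $t$ sets $F^{(\tau)}=\{g^{(\tau)}_1,\dots,g^{(\tau)}_n\}\subset\mathbb Q^d$ of $n$ (distinct, numbered) points each. For $1\le\tau_1<\dots<\tau_k\le t$, a $k$-sample for $(\tau_1,\dots,\tau_k)$ is a tuple $C=(g^{(\tau_1)},\dots,g^{(\tau_k)})$ with $g^{(\tau_l)}\in F^{(\tau_l)}$ for all $l$. Suppose that for each instance a family $\mathcal R_k(\mathcal I)$ of curves $r:[0,t]\cap\mathbb Q\to\mathbb Q^d$ is given such that for each $k$-sample $C$ there is exactly one $r_C\in\mathcal R_k(\mathcal I)$ (the sample fit) with $r_C(\tau_l)=g^{(\tau_l)}$ for all $l$. Path Fitting takes as input $\mathcal I$ and moments $\tau_1<\dots<\tau_k$ in $\{1,\dots,t\}$ and proceeds as follows. For $i,j\in\{1,\dots,n\}$ put $$\gamma_{i,j}=\min_{C}\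 \max_{1\le\tau\le t}\ \min_{g\in F^{(\tau)}} h(\|r_C(\tau)-g\|),$$ where $C$ ranges over the $k$-samples for $(\tau_1,\dots,\tau_k)$ that start in $g^{(\tau_1)}_i$ and end in $g^{(\tau_k)}_j$. It determines a permutation $\sigma$ of $\{1,\dots,n\}$ that minimizes $\sum_i\gamma_{i,\sigma(i)}$ (a minimum weight perfect bipartite matching) and, for each $i$, a sample $C_i$ attaining $\gamma_{i,\sigma(i)}$. Path $i$ passes at the moments $\tau_1,\dots,\tau_k$ through the points of $C_i$, and at every other moment $\tau$ through the nearest neighbor in $F^{(\tau)}$ of $r_{C_i}(\tau)$ with respect to $\|\cdot\|$, ties being broken by the lexicographical order of $\mathbb Q^d$. Here either (a) every point of $F^{(\tau)}$ is available to every path, or (b) the paths are served in the order $i=1,\dots,n$ and points of $F^{(\tau)}$ already received by an earlier path are not available. The output consists of the $n$ paths, given by the numbers of their points. The model of computation is the binary Turing machine model, in the form of programs that operate on finitely many stacks of symbols with unit cost per elementary stack operation, all numbers being encoded in binary; calls of subroutines are charged with their full running time and the transfer of their input and output. Then, for each of the variants (a) and (b): 1. There is a program that solves the minimum weight perfect bipartite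 matching problem with rational weights in polynomial time. 2. There are a program $P$ with two subroutines (evaluation and matching) and a constant $c$, depending only on $d$, $k$ and the variant, such that the following holds for all $\|\cdot\|$, $h$, $\mathcal R_k$ as above. Whenever the evaluation subroutine computes $h(\|r_C(\tau)-g\|)$ for all $\mathcal I$, $C$, all $\tau\in\{1,\dots,t\}\setminus\{\tau_1,\dots,\tau_k\}$ and all $g\in F^{(\tau)}$ in time polynomial in the binary size of $(\mathcal I,C,\tau,g)$, and the matching subroutine is any program as in 1, then $P$ performs Path Fitting: for every input it outputs a result of Path Fitting, its total running time, including that of the subroutines, is bounded by a polynomial in the binary size of the input, it performs at most $c\,n^{k+1}t$ evaluations, and it calls the matching subroutine exactly once. -/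

import Mathlib

open scoped NNReal BigOperators

namespace PathFitting

/-! ## The machine model

Binary Turing machines in the form of multi-stack machines (two stacks are one tape) with a
structured finite control and with subroutine calls.  A program refers to finitely many stacks; one
elementary step looks at, writes or removes a single symbol on top of a single stack, and costs
one unit of time. -/

/-- The tape alphabet: the two binary digits and a separator. -/
inductive Sym where
  | zero
  | one
  | sep
  deriving DecidableEq

/-- Programs whose subroutines are named by the elements of `ι`.  `Prog Empty` is the type of
self-contained programs (no calls). -/
inductive Prog (ι : Type) where
  /-- do nothing -/
  | skip : Prog ι
  /-- push a symbol onto stack `r` -/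
  | push (r : ℕ) (a : Sym) : Prog ι
  /-- remove the top symbol of stack `r` (no effect on an empty stack) -/
  | pop (r : ℕ) : Prog ι
  /-- run one program after the other -/
  | seq (p q : Prog ι) : Prog ι
  /-- run `p` if the top of stack `r` is `s` (`none` stands for the empty stack), else `q` -/
  | ite (r : ℕ) (s : Option Sym) (p q : Prog ι) : Prog ι
  /-- repeat `p` until the top of stack `r` is `s` (`none` stands for the empty stack) -/
  | loop (r : ℕ) (s : Option Sym) (p : Prog ι) : Prog ι
  /-- replace the content of stack `r` by the answer of subroutine `j` to it -/
  | call (j : ι) (r : ℕ) : Prog ι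

/-- The contents of the stacks, top symbol first. -/
abbrev Store := ℕ → List Sym

/-- The store that holds `x` on stack `0` and nothing else. -/
def initStore (x : List Sym) : Store := Function.update (fun _ => []) 0 x

/-- `Run env p σ σ' T c`: started in `σ`, the program `p` halts in `σ'` after `T` units of time, in
the course of which it calls the subroutine `j` exactly `c j` times.  Here `env j x y T` says that
subroutine `j` answers `x` by `y` in time `T`.  A call is charged with the running
time of the subroutine and with the transfer of its input and its output. -/
inductive Run {ι : Type} [DecidableEq ι] (env : ι → List Sym → List Sym → ℕ → Prop) :
    Prog ι → Store → Store → ℕ → (ι → ℕ) → Prop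
  | skip (σ : Store) : Run env .skip σ σ 1 0
  | push (σ : Store) (r : ℕ) (a : Sym) :
      Run env (.push r a) σ (Function.update σ r (a :: σ r)) 1 0
  | pop (σ : Store) (r : ℕ) : Run env (.pop r) σ (Function.update σ r (σ r).tail) 1 0
  | seq {p q : Prog ι} {σ ρ σ' : Store} {T₁ T₂ : ℕ} {c₁ c₂ : ι → ℕ} :
      Run env p σ ρ T₁ c₁ → Run env q ρ σ' T₂ c₂ →
      Run env (.seq p q) σ σ' (T₁ + T₂) (c₁ + c₂)
  | ite_pos {r : ℕ} {s : Option Sym} {p q : Prog ι} {σ σ' : Store} {T : ℕ} {c : ι → ℕ} :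
      (σ r).head? = s → Run env p σ σ' T c → Run env (.ite r s p q) σ σ' (T + 1) c
  | ite_neg {r : ℕ} {s : Option Sym} {p q : Prog ι} {σ σ' : Store} {T : ℕ} {c : ι → ℕ} :
      (σ r).head? ≠ s → Run env q σ σ' T c → Run env (.ite r s p q) σ σ' (T + 1) c
  | loop_done {r : ℕ} {s : Option Sym} {p : Prog ι} {σ : Store} :
      (σ r).head? = s → Run env (.loop r s p) σ σ 1 0
  | loop_step {r : ℕ} {s : Option Sym} {p : Prog ι} {σ ρ σ' : Store} {T₁ T₂ : ℕ}
      {c₁ c₂ : ι → ℕ} :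
      (σ r).head? ≠ s → Run env p σ ρ T₁ c₁ → Run env (.loop r s p) ρ σ' T₂ c₂ →
      Run env (.loop r s p) σ σ' (T₁ + T₂ + 1) (c₁ + c₂)
  | call {j : ι} {r : ℕ} {σ : Store} {y : List Sym} {T : ℕ} :
      env j (σ r) y T →
      Run env (.call j r) σ (Function.update σ r y) (T + (σ r).length + y.length + 1)
        (Pi.single j 1)

/-- The self-contained program `p` turns the input `x` into the output `y` in time `T`.  Input and
output are on stack `0`. -/
def Exec (p : Prog Empty) (x y : List Sym) (T : ℕ) : Prop :=
  ∃ (σ' : Store) (c : Empty → ℕ),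
    Run (fun j : Empty => j.elim) p (initStore x) σ' T c ∧ σ' 0 = y

/-- The program `p`, with its subroutines realized by the self-contained programs `sub`, turns `x`
into `y` in total time `T` (the time spent in the subroutines included), and calls the subroutine
`j` exactly `c j` times. -/
def ExecWith {ι : Type} [DecidableEq ι] (sub : ι → Prog Empty) (p : Prog ι)
    (x y : List Sym) (T : ℕ) (c : ι → ℕ) : Prop :=
  ∃ σ' : Store, Run (fun j => Exec (sub j)) p (initStore x) σ' T c ∧ σ' 0 = y

/-! ## Binary encoding -/

/-- A natural number in binary (least significant digit first), closed by the separator. -/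
def encodeNat (m : ℕ) : List Sym :=
  m.bits.map (fun b => if b then Sym.one else Sym.zero) ++ [Sym.sep]

/-- A list of natural numbers, each in binary. -/
def encode (l : List ℕ) : List Sym := l.flatMap encodeNat

/-- A rational number as sign, absolute value of the numerator, denominator. -/
def ratCode (q : ℚ) : List ℕ := [if q < 0 then 1 else 0, q.num.natAbs, q.den]

/-- A list of numbers for a finite sequence of objects: concatenate the codes. -/
def seqCode {m : ℕ} (f : Fin m → List ℕ) : List ℕ := (List.ofFn f).flatten

/-! ## Minimum weight perfect bipartite matching -/

/-- The perfect matching `i ↦ σ i` of the complete bipartite graph with `n + n` vertices has minimum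
weight among all perfect matchings. -/
def IsMinMatching {n : ℕ} (w : Fin n → Fin n → ℝ) (σ : Equiv.Perm (Fin n)) : Prop :=
  ∀ σ' : Equiv.Perm (Fin n), ∑ i, w i (σ i) ≤ ∑ i, w i (σ' i)

/-- The code of a matrix of rational weights. -/
def weightCode {n : ℕ} (w : Fin n → Fin n → ℚ) : List ℕ :=
  n :: seqCode fun i => seqCode fun j => ratCode (w i j)

/-- The code of a matching. -/
def matchingCode {n : ℕ} (σ : Equiv.Perm (Fin n)) : List ℕ := List.ofFn fun i => (σ i : ℕ)

/-- The program `M` solves the minimum weight perfect bipartite matching problem with rational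
weights in polynomial time. -/
def SolvesMatching (M : Prog Empty) : Prop :=
  ∃ p : Polynomial ℕ, ∀ (n : ℕ) (w : Fin n → Fin n → ℚ),
    ∃ (σ : Equiv.Perm (Fin n)) (T : ℕ),
      IsMinMatching (fun i j => (w i j : ℝ)) σ ∧
      Exec M (encode (weightCode w)) (encode (matchingCode σ)) T ∧
      T ≤ p.eval (encode (weightCode w)).length

/-! ## Instances, distances, sample fits -/

/-- A positionally determined instance: `n` distinct (numbered) points of `ℚ^d` at each of `t`
moments.  The moments `1, …, t` are indexed by `Fin t`, that is, by `0, …, t - 1`. -/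
structure Instance (d : ℕ) where
  t : ℕ
  n : ℕ
  pt : Fin t → Fin n → (Fin d → ℚ)
  pt_injective : ∀ τ, Function.Injective (pt τ)

/-- A norm on `ℝ^d` and a strictly increasing function `h` on `[0, ∞)` such that `h ‖x‖` is rational
for rational `x`. -/
structure Gauge (d : ℕ) where
  norm : Seminorm ℝ (Fin d → ℝ)
  norm_definite : ∀ x, norm x = 0 → x = 0
  h : ℝ≥0 → ℝ≥0
  h_strictMono : StrictMono h
  h_rational : ∀ x : Fin d → ℚ,
    ∃ q : ℚ, (q : ℝ) = h ⟨norm fun a => (x a : ℝ), apply_nonneg norm _⟩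

/-- The norm of a rational vector. -/
def Gauge.length {d : ℕ} (N : Gauge d) (x : Fin d → ℚ) : ℝ≥0 :=
  ⟨N.norm fun a => (x a : ℝ), apply_nonneg N.norm _⟩

/-- The rational number `h ‖x‖`. -/
noncomputable def Gauge.dev {d : ℕ} (N : Gauge d) (x : Fin d → ℚ) : ℚ :=
  (N.h_rational x).choose

variable {d k : ℕ}

/-- The moments `τ₁ < … < τ_k` of a sample. -/
abbrev Instance.Moments (I : Instance d) (k : ℕ) := Fin k ↪o Fin I.t

/-- The points of a `k`-sample, given through their numbers. -/
abbrev Instance.Points (I : Instance d) (k : ℕ) := Fin k → Fin I.n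

/-- Curves `[0, t] → ℚ^d`, with rational time. -/
abbrev Instance.Curve (I : Instance d) := Set.Icc (0 : ℚ) I.t → (Fin d → ℚ)

/-- The index `τ : Fin t` as the moment `τ + 1` in `[0, t]`. -/
def Instance.moment (I : Instance d) (τ : Fin I.t) : Set.Icc (0 : ℚ) I.t :=
  ⟨(τ : ℚ) + 1, by positivity, by exact_mod_cast τ.isLt⟩

/-- Sample fits: for each instance a family of curves such that every `k`-sample is interpolated by
exactly one curve of the family. -/
structure SampleFits (d k : ℕ) where
  family : (I : Instance d) → Set I.Curve
  existsUnique_fit : ∀ (I : Instance d) (τs : I.Moments k) (c : I.Points k),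
    ∃! r : I.Curve, r ∈ family I ∧ ∀ l, r (I.moment (τs l)) = I.pt (τs l) (c l)

/-- The curve `r_C` of the sample `C = (τs, c)`. -/
noncomputable def SampleFits.fit (R : SampleFits d k) (I : Instance d) (τs : I.Moments k)
    (c : I.Points k) : I.Curve :=
  (R.existsUnique_fit I τs c).choose

/-- The number `h ‖r_C(τ) - g‖` for the `j`-th point `g` at moment `τ`. -/
noncomputable def deviation (N : Gauge d) (R : SampleFits d k) (I : Instance d)
    (τs : I.Moments k) (c : I.Points k) (τ : Fin I.t) (j : Fin I.n) : ℚ :=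
  N.dev (R.fit I τs c (I.moment τ) - I.pt τ j)

/-! ## Path Fitting -/

/-- The value `max_τ min_g h ‖r_C(τ) - g‖` of the sample `C = (τs, c)`. -/
noncomputable def score (N : Gauge d) (R : SampleFits d k) (I : Instance d)
    (τs : I.Moments k) (c : I.Points k) : ℝ :=
  ⨆ τ : Fin I.t, ⨅ j : Fin I.n, (deviation N R I τs c τ j : ℝ)

/-- The sample starts in the point number `i` and ends in the point number `j`. -/
def Joins (I : Instance d) [NeZero k] (c : I.Points k) (i j : Fin I.n) : Prop :=
  c 0 = i ∧ c (Fin.rev 0) = j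

/-- The weight `γ i j`: the minimum of the scores of the samples that join `i` to `j`. -/
noncomputable def weight (N : Gauge d) (R : SampleFits d k) [NeZero k] (I : Instance d)
    (τs : I.Moments k) (i j : Fin I.n) : ℝ :=
  ⨅ c : {c : I.Points k // Joins I c i j}, score N R I τs c.1

/-- Two readings of the nearest neighbor rule.  `free`: every point may be
assigned to every curve.  `oneToOne`: the curves are served in order, and a point
that an earlier curve has received at that moment is no longer available. -/
inductive Rule where
  | free
  | oneToOne

/-- The points available to curve `i` at moment `τ`. -/
def available (rule : Rule) (I : Instance d) (track : Fin I.n → Fin I.t → Fin I.n)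
    (i : Fin I.n) (τ : Fin I.t) : Set (Fin I.n) :=
  match rule with
  | .free => Set.univ
  | .oneToOne => {j | ∀ i' < i, track i' τ ≠ j}

/-- Among the points of `A`, the point number `j` at moment `τ` is the nearest one to `x`; ties are
broken by the lexicographical order of `ℚ^d`. -/
def IsNearest (N : Gauge d) (I : Instance d) (τ : Fin I.t) (x : Fin d → ℚ)
    (A : Set (Fin I.n)) (j : Fin I.n) : Prop :=
  j ∈ A ∧ ∀ j' ∈ A,
    N.length (x - I.pt τ j) < N.length (x - I.pt τ j') ∨
    (N.length (x - I.pt τ j) = N.length (x - I.pt τ j') ∧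
      toLex (I.pt τ j) ≤ toLex (I.pt τ j'))

/-- `track` is a result of Path Fitting for the moments `τs`; `track i τ` is the number of the point
of path `i` at moment `τ`.  There are a minimum weight perfect matching `σ` and, for each of its
edges, a sample `c i` that attains the weight of the edge; path `i` runs through the points of its
sample, and at all other moments through the nearest neighbors of its fit. -/
def IsResult (N : Gauge d) (R : SampleFits d k) [NeZero k] (rule : Rule) (I : Instance d)
    (τs : I.Moments k) (track : Fin I.n → Fin I.t → Fin I.n) : Prop :=
  ∃ (σ : Equiv.Perm (Fin I.n)) (c : Fin I.n → I.Points k),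
    IsMinMatching (weight N R I τs) σ ∧
    (∀ i, Joins I (c i) i (σ i) ∧ score N R I τs (c i) = weight N R I τs i (σ i)) ∧
    (∀ i l, track i (τs l) = c i l) ∧
    (∀ i τ, τ ∉ Set.range τs →
      IsNearest N I τ (R.fit I τs (c i) (I.moment τ)) (available rule I track i τ) (track i τ))

/-! ## Input and output of the algorithm and of its subroutines -/

/-- The input of Path Fitting: `t`, `n`, the moments `τ₁, …, τ_k`, the coordinates of all points. -/
def inputCode (I : Instance d) (τs : I.Moments k) : List ℕ :=
  I.t :: I.n :: ((List.ofFn fun l => (τs l : ℕ)) ++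
    seqCode fun τ => seqCode fun i => seqCode fun a => ratCode (I.pt τ i a))

/-- The output of Path Fitting: the numbers of the points of all paths. -/
def outputCode (I : Instance d) (track : Fin I.n → Fin I.t → Fin I.n) : List ℕ :=
  seqCode fun i => List.ofFn fun τ => (track i τ : ℕ)

/-- The input of an evaluation: the instance, the sample, the moment and the number of the point. -/
def queryCode (I : Instance d) (τs : I.Moments k) (c : I.Points k) (τ : Fin I.t)
    (j : Fin I.n) : List ℕ :=
  inputCode I τs ++ (List.ofFn fun l => (c l : ℕ)) ++ [(τ : ℕ), (j : ℕ)]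

/-- The program `E` computes, in polynomial time, the numbers `h ‖r_C(τ) - g‖` for all instances,
all samples, all moments `τ` outside the sample and all points `g` at moment `τ`. -/
def Evaluates (N : Gauge d) (R : SampleFits d k) (E : Prog Empty) : Prop :=
  ∃ p : Polynomial ℕ, ∀ (I : Instance d) (τs : I.Moments k) (c : I.Points k) (τ : Fin I.t)
    (j : Fin I.n), τ ∉ Set.range τs →
    ∃ T : ℕ,
      Exec E (encode (queryCode I τs c τ j)) (encode (ratCode (deviation N R I τs c τ j))) T ∧
      T ≤ p.eval (encode (queryCode I τs c τ j)).length

/-- The two subroutines of Path Fitting. -/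
inductive Sub where
  | evaluation
  | matching
  deriving DecidableEq

/-- The subroutines, realized by the programs `E` and `M`. -/
def subroutines (E M : Prog Empty) : Sub → Prog Empty
  | .evaluation => E
  | .matching => M

end PathFitting

open PathFitting

/-! The proof separates programming from mathematics. Data of every type are coded as binary trees
in prefix notation on stack `0`. Such a code shows where it ends, so a program can work on the
topmost tree and leave everything below it untouched. `PT f` says that a call-free program replaces
the code of `x` by that of `f x` in time polynomial in its length. This class is closed under
composition, pairing, case distinction and, most importantly, iteration over a list
(`PT.foldl_of_bdd`), provided that the intermediate results stay polynomially small. Arithmetic is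
serial binary arithmetic. An algorithm written as a function on lists is therefore in `PT` as soon
as the sizes in its iterations are under control.

Matching: multiplying rational weights by a common denominator and adding a constant turns them into
natural numbers without changing the minimizers. The Hungarian method maintains slacks `w i j - u i
- v j ≥ 0` and a permutation whose first `m` rows use entries of slack zero. A phase grows an
alternating tree from row `m`. Each step shifts the potentials until a new tight edge leaves the
tree; this edge either brings a new row into the tree or completes an augmenting path. There are
only `m + 1` possible tree rows, so `n` steps suffice. After `n` phases all matched entries are
tight, and the potentials certify optimality (`hungarian_spec`): every permutation has the same dual
sum, which bounds its weight from below. Each step adds at most one binary digit to an entry, so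
numbers stay short.

Path Fitting: for fixed `k` there are `n ^ k` samples, hence at most `n ^ (k + 1) * t` deviations.
The program asks for all of them in advance, stores them in a table, calls the matching subroutine
once, and looks up everything else (`exists_callProgram`). Evaluations at the sample moments are not
needed: there the fit meets a point, and the minimum is `h 0`, the least possible value. If no other
moment exists, every score is `h 0`, which the program cannot know; it uses `0` instead. All weights
are then off by one common constant, which does not affect minimum matchings (`exists_scoreReply`,
`isMinMatching_of_add`). Since `h` is strictly increasing, the deviations order the points by
distance, so the nearest neighbors can be read off the table as well (`nearer_iff`,
`pathOutput_spec`).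

The program sees `h`, the norm and the fits only through the table. It therefore depends on `d`, `k`
and the variant alone, whereas the polynomial bound also depends on the subroutines. -/

namespace PathFitting

/-! ## Running times of basic programs -/

section Machine

variable {ι : Type} [DecidableEq ι] {env : ι → List Sym → List Sym → ℕ → Prop}

/-- `p` leads from `σ` to `σ'` within `B` units of time, with the calls counted by `c`. -/
def Steps (env : ι → List Sym → List Sym → ℕ → Prop) (p : Prog ι) (σ σ' : Store) (B : ℕ)
    (c : ι → ℕ) : Prop :=
  ∃ T ≤ B, Run env p σ σ' T c

theorem Steps.mono {p : Prog ι} {σ σ' : Store} {B B' : ℕ} {c : ι → ℕ}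
    (h : Steps env p σ σ' B c) (hB : B ≤ B') : Steps env p σ σ' B' c := by
  obtain ⟨T, hT, h⟩ := h
  exact ⟨T, hT.trans hB, h⟩

theorem Steps.skip (σ : Store) : Steps env .skip σ σ 1 0 := ⟨1, le_rfl, .skip σ⟩

theorem Steps.push (σ : Store) (r : ℕ) (a : Sym) :
    Steps env (.push r a) σ (Function.update σ r (a :: σ r)) 1 0 := ⟨1, le_rfl, .push σ r a⟩

theorem Steps.pop (σ : Store) (r : ℕ) :
    Steps env (.pop r) σ (Function.update σ r (σ r).tail) 1 0 := ⟨1, le_rfl, .pop σ r⟩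

theorem Steps.seq {p q : Prog ι} {σ ρ σ' : Store} {B₁ B₂ : ℕ} {c₁ c₂ : ι → ℕ}
    (h₁ : Steps env p σ ρ B₁ c₁) (h₂ : Steps env q ρ σ' B₂ c₂) :
    Steps env (.seq p q) σ σ' (B₁ + B₂) (c₁ + c₂) := by
  obtain ⟨T₁, hT₁, h₁⟩ := h₁
  obtain ⟨T₂, hT₂, h₂⟩ := h₂
  exact ⟨_, add_le_add hT₁ hT₂, .seq h₁ h₂⟩

theorem Steps.seq₀ {p q : Prog ι} {σ ρ σ' : Store} {B₁ B₂ : ℕ}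
    (h₁ : Steps env p σ ρ B₁ 0) (h₂ : Steps env q ρ σ' B₂ 0) :
    Steps env (.seq p q) σ σ' (B₁ + B₂) 0 := by
  simpa using h₁.seq h₂

theorem Steps.ite_pos {r : ℕ} {s : Option Sym} {p q : Prog ι} {σ σ' : Store} {B : ℕ} {c : ι → ℕ}
    (hs : (σ r).head? = s) (h : Steps env p σ σ' B c) :
    Steps env (.ite r s p q) σ σ' (B + 1) c := by
  obtain ⟨T, hT, h⟩ := h
  exact ⟨_, Nat.succ_le_succ hT, .ite_pos hs h⟩

theorem Steps.ite_neg {r : ℕ} {s : Option Sym} {p q : Prog ι} {σ σ' : Store} {B : ℕ} {c : ι → ℕ}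
    (hs : (σ r).head? ≠ s) (h : Steps env q σ σ' B c) :
    Steps env (.ite r s p q) σ σ' (B + 1) c := by
  obtain ⟨T, hT, h⟩ := h
  exact ⟨_, Nat.succ_le_succ hT, .ite_neg hs h⟩

theorem Steps.loop_done {r : ℕ} {s : Option Sym} {p : Prog ι} {σ : Store}
    (hs : (σ r).head? = s) : Steps env (.loop r s p) σ σ 1 0 := ⟨1, le_rfl, .loop_done hs⟩

theorem Steps.loop_step {r : ℕ} {s : Option Sym} {p : Prog ι} {σ ρ σ' : Store} {B₁ B₂ : ℕ}
    {c₁ c₂ : ι → ℕ} (hs : (σ r).head? ≠ s) (h₁ : Steps env p σ ρ B₁ c₁)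
    (h₂ : Steps env (.loop r s p) ρ σ' B₂ c₂) :
    Steps env (.loop r s p) σ σ' (B₁ + B₂ + 1) (c₁ + c₂) := by
  obtain ⟨T₁, hT₁, h₁⟩ := h₁
  obtain ⟨T₂, hT₂, h₂⟩ := h₂
  exact ⟨_, by omega, .loop_step hs h₁ h₂⟩

theorem Steps.loop_step₀ {r : ℕ} {s : Option Sym} {p : Prog ι} {σ ρ σ' : Store} {B₁ B₂ : ℕ}
    (hs : (σ r).head? ≠ s) (h₁ : Steps env p σ ρ B₁ 0)
    (h₂ : Steps env (.loop r s p) ρ σ' B₂ 0) :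
    Steps env (.loop r s p) σ σ' (B₁ + B₂ + 1) 0 := by
  simpa using h₁.loop_step hs h₂

/-- A run without calls lengthens each stack by at most its duration. -/
theorem Run.length_le {env : Empty → List Sym → List Sym → ℕ → Prop} {p : Prog Empty}
    {σ σ' : Store} {T : ℕ} {c : Empty → ℕ} (h : Run env p σ σ' T c) (r : ℕ) :
    (σ' r).length ≤ (σ r).length + T := by
  induction h with
  | skip σ => omega
  | push σ s a =>
    by_cases hr : r = s
    · subst hr; simp
    · simp [Function.update_of_ne hr]
  | pop σ s =>
    by_cases hr : r = s
    · subst hr; simp; omega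
    · simp [Function.update_of_ne hr]
  | seq _ _ h₁ h₂ => omega
  | ite_pos _ _ h => omega
  | ite_neg _ _ h => omega
  | loop_done _ => omega
  | loop_step _ _ _ h₁ h₂ => omega
  | @call j => exact j.elim

/-! ### Stores with four stacks and the transport of symbols -/

/-- The store with the given contents of the stacks `0`, `1`, `2`, `3`. -/
def quad (a b c d : List Sym) : Store := fun r =>
  match r with
  | 0 => a
  | 1 => b
  | 2 => c
  | 3 => d
  | _ => []

section
variable (a b c d x : List Sym)

@[simp] theorem quad_zero : quad a b c d 0 = a := rfl
@[simp] theorem quad_one : quad a b c d 1 = b := rfl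
@[simp] theorem quad_two : quad a b c d 2 = c := rfl
@[simp] theorem quad_three : quad a b c d 3 = d := rfl

@[simp] theorem update_quad_zero :
    Function.update (quad a b c d) 0 x = quad x b c d := by
  funext r; rcases r with _ | _ | _ | _ | r <;> simp [Function.update, quad]
@[simp] theorem update_quad_one :
    Function.update (quad a b c d) 1 x = quad a x c d := by
  funext r; rcases r with _ | _ | _ | _ | r <;> simp [Function.update, quad]
@[simp] theorem update_quad_two :
    Function.update (quad a b c d) 2 x = quad a b x d := by
  funext r; rcases r with _ | _ | _ | _ | r <;> simp [Function.update, quad]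
@[simp] theorem update_quad_three :
    Function.update (quad a b c d) 3 x = quad a b c x := by
  funext r; rcases r with _ | _ | _ | _ | r <;> simp [Function.update, quad]

theorem initStore_eq : initStore x = quad x [] [] [] := by
  funext r; rcases r with _ | _ | _ | _ | r <;> simp [initStore, Function.update, quad]

end

/-- Push the top symbol of stack `r` onto stack `s`. -/
def copySym (r s : ℕ) : Prog ι :=
  .ite r (some .zero) (.push s .zero) (.ite r (some .one) (.push s .one) (.push s .sep))

theorem steps_copySym {r s : ℕ} {σ : Store} {a : Sym} {l : List Sym} (h : σ r = a :: l) :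
    Steps env (copySym r s) σ (Function.update σ s (a :: σ s)) 3 0 := by
  cases a
  · exact (Steps.ite_pos (by simp [h]) (Steps.push _ _ _)).mono (by simp)
  · exact (Steps.ite_neg (by simp [h]) (Steps.ite_pos (by simp [h]) (Steps.push _ _ _))).mono
      (by simp)
  · exact (Steps.ite_neg (by simp [h]) (Steps.ite_neg (by simp [h]) (Steps.push _ _ _))).mono
      (by simp)

/-- Move the top symbol of stack `r` to stack `s`. -/
def moveSym (r s : ℕ) : Prog ι := .seq (copySym r s) (.pop r)

theorem steps_moveSym {r s : ℕ} (hrs : r ≠ s) {σ : Store} {a : Sym} {l : List Sym}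
    (h : σ r = a :: l) :
    Steps env (moveSym r s) σ (Function.update (Function.update σ s (a :: σ s)) r l) 4 0 := by
  have := (steps_copySym (env := env) (s := s) h).seq₀ (Steps.pop _ r)
  simpa [moveSym, Function.update_of_ne hrs, h] using this

/-- Move stack `r` symbol by symbol to stack `s`. -/
def moveAll (r s : ℕ) : Prog ι := .loop r none (moveSym r s)

theorem steps_moveAll {r s : ℕ} (hrs : r ≠ s) (l : List Sym) : ∀ {σ : Store}, σ r = l →
    Steps env (moveAll r s) σ
      (Function.update (Function.update σ s (l.reverse ++ σ s)) r []) (5 * l.length + 1) 0 := by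
  induction l with
  | nil =>
    intro σ h
    have h1 : Function.update σ s (σ s) = σ := Function.update_eq_self _ _
    have h2 : Function.update σ r [] = σ := by rw [← h]; exact Function.update_eq_self _ _
    simpa [moveAll, h1, h2] using Steps.loop_done (env := env) (p := moveSym r s)
      (show (σ r).head? = none by simp [h])
  | cons a l ih =>
    intro σ h
    have h1 := steps_moveSym (env := env) hrs h
    have h2 := ih (σ := Function.update (Function.update σ s (a :: σ s)) r l) (by simp)
    have h3 := Steps.loop_step₀ (by simp [h]) h1 h2
    refine (?_ : Steps _ _ _ _ _ _).mono (show 4 + (5 * l.length + 1) + 1 ≤ _ by simp; omega)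
    rw [show Function.update (Function.update σ s ((a :: l).reverse ++ σ s)) r [] = _ from ?_]
    · exact h3
    funext x
    by_cases hr : x = r
    · subst hr; simp
    · by_cases hs : x = s
      · subst hs; simp [hr]
      · simp [hr, hs]

/-! ## Trees -/

end Machine

/-- Binary trees, the universal data type. -/
inductive Tree where
  | nil : Tree
  | node (a b : Tree) : Tree

/-- The prefix code of a tree. -/
def Tree.str : Tree → List Sym
  | .nil => [.zero]
  | .node a b => .one :: (a.str ++ b.str)

section Machine

variable {ι : Type} [DecidableEq ι] {env : ι → List Sym → List Sym → ℕ → Prop}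

/-- The loop of `moveTree`; stack `3` counts the trees to be moved. -/
def moveTreeLoop : Prog ι :=
  .loop 3 none (.seq (.ite 0 (some .one) (.push 3 .one) (.pop 3)) (moveSym 0 1))

/-- Move the tree on top of stack `0` symbol by symbol to stack `1`. -/
def moveTree : Prog ι := .seq (.push 3 .one) moveTreeLoop

/-- The statement is in continuation form: it prepends the transport of one pending tree to an
arbitrary further run of the loop. The counter on stack `3` goes up at a node, where one pending
tree gives way to two, and down at a leaf; in continuation form the two subtrees simply chain. -/
theorem steps_moveTreeLoop_of (t : Tree) : ∀ {rest u w c : List Sym} {σ' : Store} {B : ℕ},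
    Steps env moveTreeLoop (quad rest (t.str.reverse ++ u) w c) σ' B 0 →
    Steps env moveTreeLoop (quad (t.str ++ rest) u w (.one :: c)) σ'
      (B + 8 * t.str.length) 0 := by
  induction t with
  | nil =>
    intro rest u w c σ' B h
    have h1 : Steps env (.ite 0 (some .one) (.push 3 .one) (.pop 3))
        (quad (Tree.nil.str ++ rest) u w (.one :: c)) (quad (.zero :: rest) u w c) 2 0 := by
      refine Steps.ite_neg (by simp [Tree.str]) ?_
      simpa [Tree.str] using
        Steps.pop (env := env) (quad (Tree.nil.str ++ rest) u w (.one :: c)) 3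
    have h2 : Steps env (moveSym 0 1) (quad (.zero :: rest) u w c)
        (quad rest (.zero :: u) w c) 4 0 := by
      simpa using steps_moveSym (env := env) (r := 0) (s := 1) (by simp)
        (σ := quad (.zero :: rest) u w c) rfl
    exact (Steps.loop_step₀ (by simp) (h1.seq₀ h2) h).mono (by simp [Tree.str]; omega)
  | node a b iha ihb =>
    intro rest u w c σ' B h
    have h1 : Steps env (.ite 0 (some .one) (.push 3 .one) (.pop 3))
        (quad ((Tree.node a b).str ++ rest) u w (.one :: c))
        (quad (.one :: (a.str ++ (b.str ++ rest))) u w (.one :: .one :: c)) 2 0 := by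
      refine Steps.ite_pos (by simp [Tree.str]) ?_
      simpa [Tree.str] using
        Steps.push (env := env) (quad ((Tree.node a b).str ++ rest) u w (.one :: c)) 3 .one
    have h2 : Steps env (moveSym 0 1)
        (quad (.one :: (a.str ++ (b.str ++ rest))) u w (.one :: .one :: c))
        (quad (a.str ++ (b.str ++ rest)) (.one :: u) w (.one :: .one :: c)) 4 0 := by
      simpa using steps_moveSym (env := env) (r := 0) (s := 1) (by simp)
        (σ := quad (.one :: (a.str ++ (b.str ++ rest))) u w (.one :: .one :: c)) rfl
    have h3 : Steps env moveTreeLoop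
        (quad rest (b.str.reverse ++ (a.str.reverse ++ (.one :: u))) w c) σ' B 0 := by
      simpa [Tree.str] using h
    exact (Steps.loop_step₀ (by simp) (h1.seq₀ h2) (iha (ihb h3))).mono
      (by simp [Tree.str]; omega)

theorem steps_moveTree (t : Tree) (rest u w : List Sym) :
    Steps env moveTree (quad (t.str ++ rest) u w []) (quad rest (t.str.reverse ++ u) w [])
      (8 * t.str.length + 2) 0 := by
  have h1 : Steps env (.push 3 .one) (quad (t.str ++ rest) u w [])
      (quad (t.str ++ rest) u w [.one]) 1 0 := by
    simpa using Steps.push (env := env) (quad (t.str ++ rest) u w []) 3 .one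
  have h2 : Steps env moveTreeLoop (quad rest (t.str.reverse ++ u) w [])
      (quad rest (t.str.reverse ++ u) w []) 1 0 := Steps.loop_done rfl
  exact (h1.seq₀ (steps_moveTreeLoop_of t h2)).mono (by omega)

theorem steps_move_one_zero (a b c d : List Sym) :
    Steps env (moveAll 1 0) (quad a b c d) (quad (b.reverse ++ a) [] c d)
      (5 * b.length + 1) 0 := by
  simpa using steps_moveAll (env := env) (r := 1) (s := 0) (by simp) b
    (σ := quad a b c d) rfl

theorem steps_move_one_two (a b c d : List Sym) :
    Steps env (moveAll 1 2) (quad a b c d) (quad a [] (b.reverse ++ c) d)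
      (5 * b.length + 1) 0 := by
  simpa using steps_moveAll (env := env) (r := 1) (s := 2) (by simp) b
    (σ := quad a b c d) rfl

theorem steps_move_two_one (a b c d : List Sym) :
    Steps env (moveAll 2 1) (quad a b c d) (quad a (c.reverse ++ b) [] d)
      (5 * c.length + 1) 0 := by
  simpa using steps_moveAll (env := env) (r := 2) (s := 1) (by simp) c
    (σ := quad a b c d) rfl

theorem steps_move_two_zero (a b c d : List Sym) :
    Steps env (moveAll 2 0) (quad a b c d) (quad (c.reverse ++ a) b [] d)
      (5 * c.length + 1) 0 := by
  simpa using steps_moveAll (env := env) (r := 2) (s := 0) (by simp) c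
    (σ := quad a b c d) rfl

theorem steps_move_zero_two (a b c d : List Sym) :
    Steps env (moveAll 0 2) (quad a b c d) (quad [] b (a.reverse ++ c) d)
      (5 * a.length + 1) 0 := by
  simpa using steps_moveAll (env := env) (r := 0) (s := 2) (by simp) a
    (σ := quad a b c d) rfl

theorem steps_move_two_three (a b c d : List Sym) :
    Steps env (moveAll 2 3) (quad a b c d) (quad a b [] (c.reverse ++ d))
      (5 * c.length + 1) 0 := by
  simpa using steps_moveAll (env := env) (r := 2) (s := 3) (by simp) c
    (σ := quad a b c d) rfl

theorem steps_move_three_zero (a b c d : List Sym) :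
    Steps env (moveAll 3 0) (quad a b c d) (quad (d.reverse ++ a) b c [])
      (5 * d.length + 1) 0 := by
  simpa using steps_moveAll (env := env) (r := 3) (s := 0) (by simp) d
    (σ := quad a b c d) rfl

theorem steps_push_zero (a b c d : List Sym) (x : Sym) :
    Steps env (.push 0 x) (quad a b c d) (quad (x :: a) b c d) 1 0 := by
  simpa using Steps.push (env := env) (quad a b c d) 0 x

theorem steps_push_two (a b c d : List Sym) (x : Sym) :
    Steps env (.push 2 x) (quad a b c d) (quad a b (x :: c) d) 1 0 := by
  simpa using Steps.push (env := env) (quad a b c d) 2 x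

theorem steps_pop_zero (a b c d : List Sym) (x : Sym) :
    Steps env (.pop 0) (quad (x :: a) b c d) (quad a b c d) 1 0 := by
  simpa using Steps.pop (env := env) (quad (x :: a) b c d) 0

theorem steps_pop_two (a b c d : List Sym) (x : Sym) :
    Steps env (.pop 2) (quad a b (x :: c) d) (quad a b c d) 1 0 := by
  simpa using Steps.pop (env := env) (quad a b (x :: c) d) 2

/-- Push a word onto stack `0`. -/
def pushWord : List Sym → Prog ι
  | [] => .skip
  | a :: l => .seq (pushWord l) (.push 0 a)

theorem steps_pushWord (l a b c d : List Sym) :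
    Steps env (pushWord l) (quad a b c d) (quad (l ++ a) b c d) (l.length + 1) 0 := by
  induction l with
  | nil => exact Steps.skip _
  | cons x l ih => exact (ih.seq₀ (steps_push_zero _ _ _ _ _)).mono (by simp)

/-- Drop the tree on top of stack `0`. -/
def dropTree : Prog ι := .seq moveTree (.loop 1 none (.pop 1))

theorem steps_dropTree (t : Tree) (rest : List Sym) :
    Steps env dropTree (quad (t.str ++ rest) [] [] []) (quad rest [] [] [])
      (10 * t.str.length + 3) 0 := by
  have h : ∀ l : List Sym, Steps env (.loop 1 none (.pop 1)) (quad rest l [] [])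
      (quad rest [] [] []) (2 * l.length + 1) 0 := by
    intro l
    induction l with
    | nil => exact Steps.loop_done rfl
    | cons a l ih =>
      have h1 : Steps env (.pop 1) (quad rest (a :: l) [] []) (quad rest l [] []) 1 0 := by
        simpa using Steps.pop (env := env) (quad rest (a :: l) [] []) 1
      exact (Steps.loop_step₀ (by simp) h1 ih).mono (by simp; omega)
  exact ((steps_moveTree t rest [] []).seq₀ (h _)).mono (by simp; omega)

/-- Exchange the two trees on top of stack `0`. -/
def swapTrees : Prog ι :=
  .seq moveTree (.seq (moveAll 1 2) (.seq moveTree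
    (.seq (moveAll 2 3) (.seq (moveAll 3 0) (moveAll 1 0)))))

theorem steps_swapTrees (s t : Tree) (rest : List Sym) :
    Steps env swapTrees (quad (s.str ++ (t.str ++ rest)) [] [] [])
      (quad (t.str ++ (s.str ++ rest)) [] [] [])
      (30 * (s.str.length + t.str.length) + 10) 0 := by
  have h := (steps_moveTree (env := env) s (t.str ++ rest) [] []).seq₀
    ((steps_move_one_two _ _ _ _).seq₀ ((steps_moveTree t rest _ _).seq₀
      ((steps_move_two_three _ _ _ _).seq₀ ((steps_move_three_zero _ _ _ _).seq₀
        (steps_move_one_zero _ _ _ _)))))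
  simp only [List.append_nil, List.reverse_reverse] at h
  exact h.mono (by simp; omega)

/-- Duplicate the tree on top of stack `0`. -/
def dupTree : Prog ι :=
  .seq moveTree (.seq (.loop 1 none (.seq (copySym 1 2) (moveSym 1 0)))
    (.seq (moveAll 2 1) (moveAll 1 0)))

theorem steps_dupTree (t : Tree) (rest : List Sym) :
    Steps env dupTree (quad (t.str ++ rest) [] [] [])
      (quad (t.str ++ (t.str ++ rest)) [] [] []) (30 * t.str.length + 10) 0 := by
  have h : ∀ l a c : List Sym, Steps env (.loop 1 none (.seq (copySym 1 2) (moveSym 1 0)))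
      (quad a l c []) (quad (l.reverse ++ a) [] (l.reverse ++ c) [])
      (8 * l.length + 1) 0 := by
    intro l
    induction l with
    | nil => exact fun a c => Steps.loop_done rfl
    | cons x l ih =>
      intro a c
      have h1 : Steps env (copySym 1 2) (quad a (x :: l) c [])
          (quad a (x :: l) (x :: c) []) 3 0 := by
        simpa using steps_copySym (env := env) (r := 1) (s := 2)
          (σ := quad a (x :: l) c []) rfl
      have h2 : Steps env (moveSym 1 0) (quad a (x :: l) (x :: c) [])
          (quad (x :: a) l (x :: c) []) 4 0 := by
        simpa using steps_moveSym (env := env) (r := 1) (s := 0) (by simp)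
          (σ := quad a (x :: l) (x :: c) []) rfl
      have h3 := Steps.loop_step₀ (by simp) (h1.seq₀ h2) (ih (x :: a) (x :: c))
      simpa using h3.mono (show _ ≤ 8 * (x :: l).length + 1 by simp; omega)
  have h := (steps_moveTree (env := env) t rest [] []).seq₀
    ((h _ _ _).seq₀ ((steps_move_two_one _ _ _ _).seq₀ (steps_move_one_zero _ _ _ _)))
  simp only [List.append_nil, List.reverse_reverse] at h
  exact h.mono (by simp; omega)

end Machine

/-! ## Polynomial bounds -/

/-- `g` is bounded by a polynomial in `s`. -/
def PolyBdd {X : Type*} (s g : X → ℕ) : Prop := ∃ e : ℕ, ∀ x, g x ≤ (s x + 2) ^ e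

namespace PolyBdd

variable {X Y : Type*} {s f g : X → ℕ}

theorem mono (hg : PolyBdd s g) (h : ∀ x, f x ≤ g x) : PolyBdd s f := by
  obtain ⟨e, he⟩ := hg
  exact ⟨e, fun x => (h x).trans (he x)⟩

/-- The base `s x + 2` is at least `2`, so a single exponent absorbs constants, coefficients and
sums, even where `s x` is `0` or `1`. -/
theorem const (s : X → ℕ) (c : ℕ) : PolyBdd s fun _ => c :=
  ⟨c, fun x => (Nat.lt_two_pow_self (n := c)).le.trans (Nat.pow_le_pow_left (by omega) c)⟩

theorem self (s : X → ℕ) : PolyBdd s s := ⟨1, fun x => by simp⟩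

theorem mul (hf : PolyBdd s f) (hg : PolyBdd s g) : PolyBdd s fun x => f x * g x := by
  obtain ⟨a, ha⟩ := hf
  obtain ⟨b, hb⟩ := hg
  exact ⟨a + b, fun x => by rw [pow_add]; exact Nat.mul_le_mul (ha x) (hb x)⟩

theorem add (hf : PolyBdd s f) (hg : PolyBdd s g) : PolyBdd s fun x => f x + g x := by
  obtain ⟨a, ha⟩ := hf
  obtain ⟨b, hb⟩ := hg
  refine ⟨max a b + 1, fun x => ?_⟩
  have h1 : (s x + 2) ^ a ≤ (s x + 2) ^ max a b := Nat.pow_le_pow_right (by omega) (by simp)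
  have h2 : (s x + 2) ^ b ≤ (s x + 2) ^ max a b := Nat.pow_le_pow_right (by omega) (by simp)
  have h3 : (s x + 2) ^ max a b * 2 ≤ (s x + 2) ^ max a b * (s x + 2) :=
    Nat.mul_le_mul_left _ (by omega)
  rw [pow_succ]
  have := ha x
  have := hb x
  show f x + g x ≤ _
  nlinarith

theorem pow (hf : PolyBdd s f) (n : ℕ) : PolyBdd s fun x => f x ^ n := by
  obtain ⟨a, ha⟩ := hf
  exact ⟨a * n, fun x => by rw [pow_mul]; exact Nat.pow_le_pow_left (ha x) n⟩

/-- Polynomial in polynomial is polynomial: this turns bounds in the size of an intermediate result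
into bounds in the size of the input. -/
theorem trans (hg : PolyBdd f g) (hf : PolyBdd s f) : PolyBdd s g := by
  obtain ⟨e, he⟩ := hg
  exact ((hf.add (const s 2)).pow e).mono he

theorem comp (hg : PolyBdd s g) (φ : Y → X) : PolyBdd (fun y => s (φ y)) fun y => g (φ y) := by
  obtain ⟨e, he⟩ := hg
  exact ⟨e, fun y => he _⟩

theorem eval (p : Polynomial ℕ) (hf : PolyBdd s f) : PolyBdd s fun x => p.eval (f x) := by
  induction p using Polynomial.induction_on' with
  | add p q hp hq => simpa using hp.add hq
  | monomial n a => simpa using (const s a).mul (hf.pow n)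

end PolyBdd

/-! ## Data and polynomial time functions -/

/-- Types whose elements are represented by trees. -/
class Code (α : Type) where
  enc : α → Tree

/-- The word that represents `x`. -/
def str {α : Type} [Code α] (x : α) : List Sym := (Code.enc x).str

/-- The length of the representation of `x`. -/
def sz {α : Type} [Code α] (x : α) : ℕ := (str x).length

/-- Both truth values have codes of length five that differ in the second symbol. A program branches
on that symbol, and all binary digits contribute equally to sizes. -/
instance : Code Bool where
  enc b := if b then .node (.node .nil .nil) .nil else .node .nil (.node .nil .nil)

instance {α β : Type} [Code α] [Code β] : Code (α × β) where
  enc x := .node (Code.enc x.1) (Code.enc x.2)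

/-- The tree that represents a list. -/
def encList {α : Type} [Code α] : List α → Tree
  | [] => .nil
  | a :: l => .node (Code.enc a) (encList l)

instance {α : Type} [Code α] : Code (List α) := ⟨encList⟩

/-- A number is literally the list of its binary digits, least significant first. Passing between a
number and its digits costs nothing, and sizes are logarithmic. -/
instance : Code ℕ := ⟨fun n => Code.enc n.bits⟩

section Code

variable {α β γ δ : Type} [Code α] [Code β] [Code γ] [Code δ]

theorem str_mk (a : α) (b : β) : str (a, b) = .one :: (str a ++ str b) := rfl
theorem str_nil : str ([] : List α) = [.zero] := rfl
theorem str_cons (a : α) (l : List α) : str (a :: l) = .one :: (str a ++ str l) := rfl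
theorem str_false : str false = [.one, .zero, .one, .zero, .zero] := rfl
theorem str_true : str true = [.one, .one, .zero, .zero, .zero] := rfl
theorem str_nat (n : ℕ) : str n = str n.bits := rfl

theorem sz_mk (a : α) (b : β) : sz (a, b) = sz a + sz b + 1 := by simp [sz, str_mk]
theorem sz_nil : sz ([] : List α) = 1 := rfl
theorem sz_cons (a : α) (l : List α) : sz (a :: l) = sz a + sz l + 1 := by simp [sz, str_cons]
theorem sz_bool (b : Bool) : sz b = 5 := by cases b <;> rfl

theorem sz_pos (x : α) : 1 ≤ sz x := by
  have : ∀ t : Tree, 1 ≤ t.str.length := by intro t; cases t <;> simp [Tree.str]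
  exact this _

theorem length_lt_sz (l : List α) : l.length < sz l := by
  induction l with
  | nil => simp [sz_nil]
  | cons a l ih => simp [sz_cons]; omega

theorem sz_append (l l' : List α) : sz (l ++ l') + 1 = sz l + sz l' := by
  induction l with
  | nil => simp [sz_nil]; omega
  | cons a l ih => simp [sz_cons]; omega

theorem sz_le_of_mem {a : α} {l : List α} (h : a ∈ l) : sz a < sz l := by
  induction l with
  | nil => simp at h
  | cons b l ih =>
    rcases List.mem_cons.1 h with rfl | h
    · simp [sz_cons]
    · have := ih h; simp [sz_cons]; omega

theorem sz_le_of_forall {B : ℕ} {l : List α} (h : ∀ a ∈ l, sz a ≤ B) :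
    sz l ≤ l.length * (B + 1) + 1 := by
  induction l with
  | nil => simp [sz_nil]
  | cons a l ih =>
    have h1 := ih fun b hb => h b (by simp [hb])
    have h2 := h a (by simp)
    simp only [sz_cons, List.length_cons, add_mul, one_mul]; omega

theorem sz_nat (n : ℕ) : sz n = 6 * n.size + 1 := by
  have h : ∀ l : List Bool, sz l = 6 * l.length + 1 := by
    intro l
    induction l with
    | nil => rfl
    | cons a l ih => simp [sz_cons, sz_bool, ih]; omega
  rw [show sz n = sz n.bits from rfl, h, Nat.size_eq_bits_len]

theorem sz_nat_mono {m n : ℕ} (h : m ≤ n) : sz m ≤ sz n := by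
  rw [sz_nat, sz_nat]
  have := Nat.size_le_size h
  omega

/-- Functions that are computed in polynomial time by a program that works on top of stack `0`,
with stacks `1`, `2`, `3` as empty work space, and that does not call subroutines. -/
@[fun_prop]
def PT (f : α → β) : Prop :=
  ∃ (p : ∀ ι : Type, Prog ι) (T : α → ℕ), PolyBdd sz T ∧
    ∀ (ι : Type) [DecidableEq ι] (env : ι → List Sym → List Sym → ℕ → Prop) (x : α)
      (rest : List Sym),
      Steps env (p ι) (quad (str x ++ rest) [] [] []) (quad (str (f x) ++ rest) [] [] []) (T x) 0

theorem PolyBdd.const_mul_add {X : Type*} {s g : X → ℕ} (hg : PolyBdd s g) (a b : ℕ) :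
    PolyBdd s fun x => a * g x + b := ((PolyBdd.const s a).mul hg).add (.const s b)

namespace PT

/-- A program can push at most one symbol per unit of time, so the running time also bounds the size
of the output. Without this, running times could not be composed. -/
theorem sz_bdd {f : α → β} (hf : PT f) : PolyBdd sz fun x => sz (f x) := by
  obtain ⟨p, T, hT, h⟩ := hf
  refine ((PolyBdd.self sz).add hT).mono fun x => ?_
  -- The program exists for every type of subroutine names; for the empty type no call can lengthen
  -- a stack unexpectedly.
  obtain ⟨T', hT', h'⟩ := h Empty (fun j => j.elim) x []
  have := h'.length_le 0
  simp at this
  simp [sz]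
  omega

theorem bdd {f : α → β} (hf : PT f) {g : β → ℕ} (hg : PolyBdd sz g) :
    PolyBdd sz fun x => g (f x) := (hg.comp f).trans hf.sz_bdd

/-- Only the representations of the values matter. -/
theorem of_str {f : α → β} (hf : PT f) {g : α → γ} (h : ∀ x, str (f x) = str (g x)) : PT g := by
  obtain ⟨p, T, hT, hp⟩ := hf
  exact ⟨p, T, hT, fun ι _ env x rest => h x ▸ hp ι env x rest⟩

theorem of_eq {f g : α → β} (hf : PT f) (h : ∀ x, f x = g x) : PT g :=
  hf.of_str fun x => by rw [h]

@[fun_prop]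
theorem id' : PT fun x : α => x :=
  ⟨fun _ => .skip, fun _ => 1, .const _ 1, fun _ _ _ _ _ => Steps.skip _⟩

@[fun_prop]
theorem comp {f : β → γ} {g : α → β} (hf : PT f) (hg : PT g) : PT fun x => f (g x) := by
  have hg' := hg
  obtain ⟨p, T, hT, hp⟩ := hf
  obtain ⟨q, U, hU, hq⟩ := hg
  exact ⟨fun ι => .seq (q ι) (p ι), fun x => U x + T (g x), hU.add (hg'.bdd hT),
    fun ι _ env x rest => (hq ι env x rest).seq₀ (hp ι env (g x) rest)⟩

@[fun_prop]
theorem const (c : β) : PT fun _ : α => c :=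
  ⟨fun _ => .seq dropTree (pushWord (str c)), fun x => 10 * sz x + (3 + (sz c + 1)),
    (PolyBdd.self sz).const_mul_add _ _, fun ι _ env x rest =>
      ((steps_dropTree (Code.enc x) rest).seq₀ (steps_pushWord _ _ _ _ _)).mono
        (by simp only [sz, str]; omega)⟩

@[fun_prop]
theorem mk {f : α → β} {g : α → γ} (hf : PT f) (hg : PT g) : PT fun x => (f x, g x) := by
  have hg' := hg.sz_bdd
  obtain ⟨p, T, hT, hp⟩ := hf
  obtain ⟨q, U, hU, hq⟩ := hg
  refine ⟨fun ι => .seq dupTree (.seq (q ι) (.seq swapTrees (.seq (p ι) (.push 0 .one)))),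
    fun x => (30 * sz x + 10) + (U x + ((30 * (sz (g x) + sz x) + 10) + (T x + 1))),
    ((PolyBdd.self sz).const_mul_add _ _).add (hU.add (((hg'.add (.self sz)).const_mul_add _ _).add
      (hT.add (.const _ 1)))), fun ι _ env x rest => ?_⟩
  have h := (steps_dupTree (env := env) (Code.enc x) rest).seq₀ ((hq ι env x (str x ++ rest)).seq₀
    ((steps_swapTrees _ _ rest).seq₀ ((hp ι env x (str (g x) ++ rest)).seq₀
      (steps_push_zero _ _ _ _ .one))))
  have e : str (f x, g x) ++ rest = .one :: (str (f x) ++ (str (g x) ++ rest)) := by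
    simp [str_mk]
  show Steps env _ (quad ((Code.enc x).str ++ rest) [] [] [])
    (quad (str (f x, g x) ++ rest) [] [] []) _ 0
  rw [e]
  exact h

@[fun_prop]
theorem snd {f : α → β × γ} (hf : PT f) : PT fun x => (f x).2 := by
  have h : PT fun x : β × γ => x.2 := by
    refine ⟨fun _ => .seq (.pop 0) dropTree, fun x => 10 * sz x + 4,
      (PolyBdd.self sz).const_mul_add _ _, fun ι _ env x rest => ?_⟩
    have h := (steps_pop_zero (env := env) (str x.1 ++ (str x.2 ++ rest)) [] [] [] .one).seq₀
      (steps_dropTree (Code.enc x.1) (str x.2 ++ rest))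
    have e : str x ++ rest = .one :: (str x.1 ++ (str x.2 ++ rest)) := by
      rw [← List.append_assoc, ← List.cons_append, ← str_mk]
    rw [e]
    refine h.mono ?_
    have := sz_mk x.1 x.2
    simp only [sz, str] at this ⊢
    simp only [Prod.mk.eta] at this
    omega
  exact h.comp hf

@[fun_prop]
theorem fst {f : α → β × γ} (hf : PT f) : PT fun x => (f x).1 := by
  have h : PT fun x : β × γ => x.1 := by
    refine ⟨fun _ => .seq (.pop 0) (.seq swapTrees dropTree), fun x => 40 * sz x + 14,
      (PolyBdd.self sz).const_mul_add _ _, fun ι _ env x rest => ?_⟩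
    have h := (steps_pop_zero (env := env) (str x.1 ++ (str x.2 ++ rest)) [] [] [] .one).seq₀
      ((steps_swapTrees (Code.enc x.1) (Code.enc x.2) rest).seq₀
        (steps_dropTree (Code.enc x.2) (str x.1 ++ rest)))
    have e : str x ++ rest = .one :: (str x.1 ++ (str x.2 ++ rest)) := by
      rw [← List.append_assoc, ← List.cons_append, ← str_mk]
    rw [e]
    refine h.mono ?_
    have := sz_mk x.1 x.2
    simp only [sz, str] at this ⊢
    simp only [Prod.mk.eta] at this
    omega
  exact h.comp hf

@[fun_prop]
theorem cond {c : α → Bool} {f g : α → β} (hc : PT c) (hf : PT f) (hg : PT g) :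
    PT fun x => bif c x then f x else g x := by
  obtain ⟨r, V, hV, hr⟩ := hc
  obtain ⟨p, T, hT, hp⟩ := hf
  obtain ⟨q, U, hU, hq⟩ := hg
  -- The condition is evaluated on a copy of the input. Of its five symbols, the first is dropped,
  -- the second decides, and the last four are removed inside the chosen branch.
  refine ⟨fun ι => .seq dupTree (.seq (r ι) (.seq (.pop 0) (.ite 0 (some .one)
      (.seq (.pop 0) (.seq (.pop 0) (.seq (.pop 0) (.seq (.pop 0) (p ι)))))
      (.seq (.pop 0) (.seq (.pop 0) (.seq (.pop 0) (.seq (.pop 0) (q ι)))))))),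
    fun x => (30 * sz x + 10) + (V x + (T x + U x + 6)),
    ((PolyBdd.self sz).const_mul_add _ _).add (hV.add ((hT.add hU).add (.const _ 6))),
    fun ι _ env x rest => ?_⟩
  have h1 := steps_dupTree (env := env) (Code.enc x) rest
  have h2 := hr ι env x (str x ++ rest)
  refine h1.seq₀ (h2.seq₀ ?_)
  cases hcx : c x <;> simp only [str_false, str_true, List.cons_append, List.nil_append, hcx]
  · exact Steps.mono ((steps_pop_zero _ _ _ _ _).seq₀ (Steps.ite_neg (by simp) ((steps_pop_zero _ _ _ _ _).seq₀
      ((steps_pop_zero _ _ _ _ _).seq₀ ((steps_pop_zero _ _ _ _ _).seq₀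
        ((steps_pop_zero _ _ _ _ _).seq₀ (hq ι env x rest))))))) (by omega)
  · exact Steps.mono ((steps_pop_zero _ _ _ _ _).seq₀ (Steps.ite_pos (by simp) ((steps_pop_zero _ _ _ _ _).seq₀
      ((steps_pop_zero _ _ _ _ _).seq₀ ((steps_pop_zero _ _ _ _ _).seq₀
        ((steps_pop_zero _ _ _ _ _).seq₀ (hp ι env x rest))))))) (by omega)

@[fun_prop]
theorem cons {f : α → β} {l : α → List β} (hf : PT f) (hl : PT l) : PT fun x => f x :: l x :=
  (hf.mk hl).of_str fun _ => rfl

/-- A nonempty list has the same code as the pair of its head and its tail. Pushing one further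
`.one` in front of the list and the saved input thus produces the code of `((a, t), x)`, the
argument of the second branch. -/
theorem listCases {l : α → List β} {f : α → γ} {g : α → β → List β → γ} (hl : PT l) (hf : PT f)
    (hg : PT fun p : (β × List β) × α => g p.2 p.1.1 p.1.2) :
    PT fun x => match l x with
      | [] => f x
      | a :: t => g x a t := by
  have hl' := hl.sz_bdd
  obtain ⟨r, V, hV, hr⟩ := hl
  obtain ⟨p, T, hT, hp⟩ := hf
  obtain ⟨q, U, ⟨e, he⟩, hq⟩ := hg
  refine ⟨fun ι => .seq dupTree (.seq (r ι) (.ite 0 (some .one) (.seq (.push 0 .one) (q ι))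
      (.seq (.pop 0) (p ι)))),
    fun x => (30 * sz x + 10) + (V x + (T x + (sz (l x) + sz x + 1 + 2) ^ e + 2)),
    ((PolyBdd.self sz).const_mul_add _ _).add (hV.add ((hT.add
      ((((hl'.add (.self sz)).add (.const _ 1)).add (.const _ 2)).pow e)).add (.const _ 2))),
    fun ι _ env x rest => ?_⟩
  have h1 := steps_dupTree (env := env) (Code.enc x) rest
  have h2 := hr ι env x (str x ++ rest)
  refine h1.seq₀ (h2.seq₀ ?_)
  cases hlx : l x with
  | nil =>
    simp only [str_nil, List.cons_append, List.nil_append, hlx]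
    exact Steps.mono (Steps.ite_neg (by simp) ((steps_pop_zero _ _ _ _ _).seq₀
      (hp ι env x rest))) (by omega)
  | cons a t =>
    have h3 := hq ι env ((a, t), x) rest
    have h4 := he ((a, t), x)
    rw [sz_mk, sz_mk, ← sz_cons] at h4
    refine Steps.mono (Steps.ite_pos (by simp [str_cons]) ((steps_push_zero _ _ _ _ .one).seq₀
      (B₂ := U ((a, t), x)) ?_)) (by omega)
    simpa [str_mk, str_cons, hlx] using h3

/-- Iteration over a list, with a polynomial bound on the size of the intermediate results. -/
theorem foldl_of_bdd {step : γ → β → α → β} {init : γ → β} {l : γ → List α}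
    (hstep : PT fun p : γ × β × α => step p.1 p.2.1 p.2.2) (hinit : PT init) (hl : PT l)
    {G : γ → ℕ} (hG : PolyBdd sz G)
    (hb : ∀ x l₁, l₁ <+: l x → sz (l₁.foldl (step x) (init x)) ≤ G x) :
    PT fun x => (l x).foldl (step x) (init x) := by
  -- The state of the loop consists of the remaining list, the accumulator and the parameter, which
  -- has to be carried along because a step only sees the tree on top of the stack.
  have hbody : PT (α := List α × (β × γ)) (β := List α × (β × γ)) fun st => match st.1 with
      | [] => st
      | a :: t => (t, (step st.2.2 st.2.1 a, st.2.2)) := by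
    refine listCases (α := List α × (β × γ))
      (g := fun st a t => (t, (step st.2.2 st.2.1 a, st.2.2))) (by fun_prop) (by fun_prop) ?_
    exact (by fun_prop : PT fun p : (α × List α) × (List α × β × γ) => p.1.2).mk
      ((hstep.comp (by fun_prop : PT fun p : (α × List α) × (List α × β × γ) =>
        (p.2.2.2, p.2.2.1, p.1.1))).mk (by fun_prop))
  have hfst : PT fun p : β × γ => p.1 := by fun_prop
  obtain ⟨b, B, ⟨e, he⟩, hb'⟩ := hbody
  obtain ⟨o, O, ⟨e', he'⟩, ho⟩ := hfst
  have hls := hl.sz_bdd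
  obtain ⟨r, V, hV, hr⟩ := hl.mk (hinit.mk id')
  -- `S x` bounds the size of every state of the loop: the remaining list is a suffix of `l x`, and
  -- the accumulator is bounded by `G x`.
  let S : γ → ℕ := fun x => sz (l x) + (G x + sz x + 1) + 1
  have hS : PolyBdd sz S := (hls.add ((hG.add (.self _)).add (.const _ 1))).add (.const _ 1)
  refine ⟨fun ι => .seq (r ι) (.seq (.pop 0) (.seq
      (.loop 0 (some .zero) (.seq (.push 0 .one) (.seq (b ι) (.pop 0))))
      (.seq (.pop 0) (o ι)))),
    fun x => V x + (1 + ((sz (l x) * ((S x + 2) ^ e + 3) + 1) + (1 + (S x + 2) ^ e'))),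
    hV.add ((PolyBdd.const _ 1).add (((hls.mul (((hS.add (.const _ 2)).pow e).add
      (.const _ 3))).add (.const _ 1)).add ((PolyBdd.const _ 1).add
        ((hS.add (.const _ 2)).pow e')))), fun ι _ env x rest => ?_⟩
  -- Here `l₁` is the processed prefix and `l₂` the rest. Between rounds the leading `.one` of the
  -- state is missing, so the top symbol belongs to the remaining list and is `.zero` exactly when
  -- that list is empty.
  have hloop : ∀ l₂ l₁ : List α, l₁ ++ l₂ = l x →
      Steps env (.loop 0 (some .zero) (.seq (.push 0 .one) (.seq (b ι) (.pop 0))))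
        (quad (str l₂ ++ (str (l₁.foldl (step x) (init x), x) ++ rest)) [] [] [])
        (quad (.zero :: (str ((l x).foldl (step x) (init x), x) ++ rest)) [] [] [])
        (l₂.length * ((S x + 2) ^ e + 3) + 1) 0 := by
    intro l₂
    induction l₂ with
    | nil =>
      intro l₁ h
      rw [List.append_nil] at h
      rw [h]
      exact Steps.mono (Steps.loop_done rfl) (by simp)
    | cons a t ih =>
      intro l₁ h
      have h1 := ih (l₁ ++ [a]) (by simpa using h)
      have h2 := hb' ι env (a :: t, (l₁.foldl (step x) (init x), x)) rest
      simp only [str_mk, List.cons_append, List.append_assoc] at h2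
      have h3 : B (a :: t, (l₁.foldl (step x) (init x), x)) ≤ (S x + 2) ^ e := by
        refine (he _).trans (Nat.pow_le_pow_left ?_ _)
        have h4 := hb x l₁ ⟨_, h⟩
        have h5 := sz_append l₁ (a :: t)
        rw [h] at h5
        have h6 := sz_pos l₁
        simp only [sz_mk, S]
        omega
      have h4 := (steps_push_zero (env := env) _ [] [] [] .one).seq₀
        (h2.seq₀ (steps_pop_zero _ _ _ _ _))
      refine (Steps.loop_step₀ (by simp [str_cons]) ?_ h1).mono
        (B := 1 + ((S x + 2) ^ e + 1) + (t.length * ((S x + 2) ^ e + 3) + 1) + 1) ?_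
      · refine Steps.mono ?_ (show 1 + (B (a :: t, (l₁.foldl (step x) (init x), x)) + 1) ≤ _ by omega)
        simpa [str_mk] using h4
      · simp only [List.length_cons, add_mul, one_mul]; omega
  have h1 := hr ι env x rest
  simp only [str_mk, List.cons_append, List.append_assoc] at h1
  have h2 := (hloop (l x) [] rfl)
  have h3 := ho ι env ((l x).foldl (step x) (init x), x) rest
  have h4 : O ((l x).foldl (step x) (init x), x) ≤ (S x + 2) ^ e' := by
    refine (he' _).trans (Nat.pow_le_pow_left ?_ _)
    have h4 := hb x (l x) List.prefix_rfl
    simp only [sz_mk, S]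
    omega
  simp only [List.foldl_nil, str_mk, List.cons_append, List.append_assoc] at h2 h3
  refine (h1.seq₀ ((steps_pop_zero _ _ _ _ _).seq₀ (h2.seq₀ ((steps_pop_zero _ _ _ _ _).seq₀
    h3)))).mono ?_
  have h5 : (l x).length * ((S x + 2) ^ e + 3) ≤ sz (l x) * ((S x + 2) ^ e + 3) :=
    Nat.mul_le_mul_right _ (length_lt_sz _).le
  dsimp only
  omega

/-- Iteration over a list, where each step adds a bounded amount to the size of the result. -/
theorem foldl {step : γ → β → α → β} {init : γ → β} {l : γ → List α}
    (hstep : PT fun p : γ × β × α => step p.1 p.2.1 p.2.2) (hinit : PT init) (hl : PT l)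
    {G : γ × α → ℕ} (hG : PolyBdd sz G) (hb : ∀ x b a, sz (step x b a) ≤ sz b + G (x, a)) :
    PT fun x => (l x).foldl (step x) (init x) := by
  obtain ⟨e, he⟩ := hG
  refine foldl_of_bdd hstep hinit hl
    (G := fun x => sz (init x) + sz (l x) * (sz x + sz (l x) + 1 + 2) ^ e)
    (hinit.sz_bdd.add (hl.sz_bdd.mul (((((PolyBdd.self sz).add hl.sz_bdd).add (.const _ 1)).add
      (.const _ 2)).pow e))) fun x l₁ hl₁ => ?_
  -- Every element is smaller than the list that contains it, so one bound for the increment serves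
  -- all rounds, and there are fewer rounds than the size of the list.
  have h : ∀ l₁ : List α, (∀ a ∈ l₁, a ∈ l x) → ∀ b,
      sz (l₁.foldl (step x) b) ≤ sz b + l₁.length * (sz x + sz (l x) + 1 + 2) ^ e := by
    intro l₁
    induction l₁ with
    | nil => intro _ b; simp
    | cons a t ih =>
      intro h b
      have h1 := ih (fun a ha => h a (by simp [ha])) (step x b a)
      have h2 := hb x b a
      have h3 : G (x, a) ≤ (sz x + sz (l x) + 1 + 2) ^ e := by
        refine (he _).trans (Nat.pow_le_pow_left ?_ _)
        have := sz_le_of_mem (h a (by simp))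
        rw [sz_mk]; omega
      simp only [List.foldl_cons, List.length_cons, add_mul, one_mul]
      omega
  refine (h l₁ (fun a ha => hl₁.subset ha) _).trans ?_
  have h1 : l₁.length ≤ sz (l x) := hl₁.length_le.trans (length_lt_sz _).le
  exact Nat.add_le_add_left (Nat.mul_le_mul_right _ h1) _

end PT

namespace PT

/-! ## Lists and truth values -/

theorem bdd_sz : PolyBdd (X := α) sz sz := .self _

@[fun_prop]
theorem reverse {l : γ → List α} (hl : PT l) : PT fun x => (l x).reverse := by
  refine (foldl (step := fun (_ : γ) (acc : List α) a => a :: acc) (init := fun _ => [])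
    (by fun_prop) (by fun_prop) hl (bdd_sz.add (.const _ 1)) fun x b a => ?_).of_eq fun x => ?_
  · simp only [sz_cons, sz_mk]; omega
  · have : ∀ k acc : List α, k.foldl (fun acc a => a :: acc) acc = k.reverse ++ acc := by
      intro k
      induction k with
      | nil => simp
      | cons a k ih => simp [ih]
    simp [this]

@[fun_prop]
theorem append {l l' : γ → List α} (hl : PT l) (hl' : PT l') : PT fun x => l x ++ l' x := by
  refine (foldl (step := fun (_ : γ) (acc : List α) a => a :: acc) (init := l')
    (by fun_prop) (by fun_prop) hl.reverse (bdd_sz.add (.const _ 1)) fun x b a => ?_).of_eq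
      fun x => ?_
  · simp only [sz_cons, sz_mk]; omega
  · have : ∀ k acc : List α, k.foldl (fun acc a => a :: acc) acc = k.reverse ++ acc := by
      intro k
      induction k with
      | nil => simp
      | cons a k ih => simp [ih]
    simp [this]

@[fun_prop]
theorem map {f : γ → α → β} {l : γ → List α} (hf : PT fun p : γ × α => f p.1 p.2) (hl : PT l) :
    PT fun x => (l x).map fun a => f x a := by
  have h : PT fun x => (l x).foldl (fun acc a => f x a :: acc) [] := by
    refine foldl (step := fun x acc a => f x a :: acc) (init := fun _ => []) (γ := γ)
      ?_ (by fun_prop) hl (hf.sz_bdd.add (.const _ 1)) fun x b a => ?_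
    · exact cons (hf.comp (by fun_prop : PT fun p : γ × List β × α => (p.1, p.2.2))) (by fun_prop)
    · simp only [sz_cons]; omega
  refine h.reverse.of_eq fun x => ?_
  have : ∀ k acc, List.foldl (fun acc a => f x a :: acc) acc k = (k.map (f x)).reverse ++ acc := by
    intro k
    induction k with
    | nil => simp
    | cons a k ih => simp [ih]
  simp [this]

@[fun_prop]
theorem filter {f : γ → α → Bool} {l : γ → List α} (hf : PT fun p : γ × α => f p.1 p.2)
    (hl : PT l) : PT fun x => (l x).filter fun a => f x a := by
  have h : PT fun x => (l x).foldl (fun acc a => bif f x a then a :: acc else acc) [] := by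
    refine foldl (step := fun x acc a => bif f x a then a :: acc else acc)
      (init := fun _ => []) (γ := γ) ?_ (by fun_prop) hl (bdd_sz.add (.const _ 1)) fun x b a => ?_
    · exact cond (hf.comp (by fun_prop : PT fun p : γ × List α × α => (p.1, p.2.2)))
        (by fun_prop) (by fun_prop)
    · cases f x a <;> simp only [cond_true, cond_false, sz_cons, sz_mk] <;> omega
  refine h.reverse.of_eq fun x => ?_
  have : ∀ k acc, List.foldl (fun acc a => bif f x a then a :: acc else acc) acc k =
      (k.filter (f x)).reverse ++ acc := by
    intro k
    induction k with
    | nil => simp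
    | cons a k ih => intro acc; cases h : f x a <;> simp [ih, h]
  simp [this]

@[fun_prop]
theorem flatMap {f : γ → α → List β} {l : γ → List α} (hf : PT fun p : γ × α => f p.1 p.2)
    (hl : PT l) : PT fun x => (l x).flatMap fun a => f x a := by
  have h : PT fun x => (l x).foldl (fun acc a => acc ++ f x a) [] := by
    refine foldl (step := fun x acc a => acc ++ f x a) (init := fun _ => []) (γ := γ)
      ?_ (by fun_prop) hl hf.sz_bdd fun x b a => ?_
    · exact append (by fun_prop)
        (hf.comp (by fun_prop : PT fun p : γ × List β × α => (p.1, p.2.2)))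
    · have := sz_append b (f x a)
      dsimp only
      omega
  refine h.of_eq fun x => ?_
  have : ∀ k acc, List.foldl (fun acc a => acc ++ f x a) acc k = acc ++ k.flatMap (f x) := by
    intro k
    induction k with
    | nil => simp
    | cons a k ih => simp [ih]
  simp [this]

@[fun_prop]
theorem not {c : γ → Bool} (hc : PT c) : PT fun x => !c x :=
  (hc.cond (.const false) (.const true)).of_eq fun x => by cases c x <;> rfl

@[fun_prop]
theorem and {c d : γ → Bool} (hc : PT c) (hd : PT d) : PT fun x => c x && d x :=
  (hc.cond hd (.const false)).of_eq fun x => by cases c x <;> rfl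

@[fun_prop]
theorem or {c d : γ → Bool} (hc : PT c) (hd : PT d) : PT fun x => c x || d x :=
  (hc.cond (.const true) hd).of_eq fun x => by cases c x <;> rfl

@[fun_prop]
theorem any {f : γ → α → Bool} {l : γ → List α} (hf : PT fun p : γ × α => f p.1 p.2)
    (hl : PT l) : PT fun x => (l x).any fun a => f x a := by
  have h : PT fun x => (l x).foldl (fun acc a => acc || f x a) false := by
    refine foldl (step := fun x acc a => acc || f x a) (init := fun _ => false) (γ := γ)
      ?_ (by fun_prop) hl (.const _ 5) fun x b a => ?_
    · exact or (by fun_prop) (hf.comp (by fun_prop : PT fun p : γ × Bool × α => (p.1, p.2.2)))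
    · simp only [sz_bool]; omega
  refine h.of_eq fun x => ?_
  have : ∀ k acc, List.foldl (fun acc a => acc || f x a) acc k = (acc || k.any (f x)) := by
    intro k
    induction k with
    | nil => simp
    | cons a k ih => simp [ih, Bool.or_assoc]
  simp [this]

@[fun_prop]
theorem tail {l : γ → List α} (hl : PT l) : PT fun x => (l x).tail :=
  (hl.listCases (f := fun _ => []) (g := fun _ _ t => t) (by fun_prop) (by fun_prop)).of_eq
    fun x => by cases l x <;> rfl

@[fun_prop]
theorem headD {l : γ → List α} {d : γ → α} (hl : PT l) (hd : PT d) :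
    PT fun x => (l x).headD (d x) :=
  (hl.listCases (f := d) (g := fun _ a _ => a) (by fun_prop) (by fun_prop)).of_eq
    fun x => by cases l x <;> rfl

@[fun_prop]
theorem isEmpty {l : γ → List α} (hl : PT l) : PT fun x => (l x).isEmpty :=
  (hl.listCases (f := fun _ => true) (g := fun _ _ _ => false) (by fun_prop) (by fun_prop)).of_eq
    fun x => by cases l x <;> rfl

@[fun_prop]
theorem dropLast {l : γ → List α} (hl : PT l) : PT fun x => (l x).dropLast :=
  (by fun_prop : PT fun x => (l x).reverse.tail.reverse).of_eq fun x => by simp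

/-! ## Natural numbers -/

@[fun_prop]
theorem bits {f : γ → ℕ} (hf : PT f) : PT fun x => (f x).bits := hf.of_str fun _ => rfl

@[fun_prop]
theorem bodd {f : γ → ℕ} (hf : PT f) : PT fun x => (f x).bodd :=
  (by fun_prop : PT fun x => (f x).bits.headD false).of_eq fun x => by
    rw [Nat.bodd_eq_bits_head]; cases (f x).bits <;> rfl

@[fun_prop]
theorem div2 {f : γ → ℕ} (hf : PT f) : PT fun x => (f x).div2 :=
  (by fun_prop : PT fun x => (f x).bits.tail).of_str fun x => by
    rw [str_nat, Nat.div2_bits_eq_tail]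

-- Digit lists have no leading zeros: the digit `false` must not be attached to the empty list that
-- represents `0`.
@[fun_prop]
theorem bit {b : γ → Bool} {f : γ → ℕ} (hb : PT b) (hf : PT f) : PT fun x => Nat.bit (b x) (f x) :=
  (by fun_prop : PT fun x => bif b x || !(f x).bits.isEmpty then b x :: (f x).bits else []).of_str
    fun x => by
      rw [str_nat]
      by_cases h : f x = 0
      · cases b x <;> simp [h]
      · rw [Nat.bits_append_bit _ _ (fun h' => absurd h' h)]
        have : (f x).bits ≠ [] := by
          intro h'
          have := congrArg List.length h'
          rw [Nat.size_eq_bits_len] at this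
          exact h (Nat.size_eq_zero.1 this)
        simp [List.isEmpty_eq_false_iff.2 this]

end PT

/-! ### Serial binary arithmetic -/

theorem sz_div2_le (n : ℕ) : sz n.div2 ≤ sz n := sz_nat_mono (by rw [Nat.div2_val]; omega)

/-- The number with the given binary digits, most significant digit first. -/
def ofDigits (l : List Bool) : ℕ := l.foldl (fun n b => Nat.bit b n) 0

theorem ofDigits_cons (b : Bool) (l : List Bool) :
    ofDigits (b :: l) = b.toNat * 2 ^ l.length + ofDigits l := by
  have h : ∀ (l : List Bool) (m : ℕ),
      l.foldl (fun n b => Nat.bit b n) m = m * 2 ^ l.length + ofDigits l := by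
    intro l
    induction l with
    | nil => simp [ofDigits]
    | cons b l ih =>
      intro m
      rw [ofDigits, List.foldl_cons, List.foldl_cons, ih, ih (Nat.bit b 0)]
      simp only [Nat.bit_val, List.length_cons, pow_succ]
      ring
  have := h l (Nat.bit b 0)
  rw [ofDigits, List.foldl_cons, this]
  simp [Nat.bit_val]

theorem ofDigits_lt (l : List Bool) : ofDigits l < 2 ^ l.length := by
  induction l with
  | nil => simp [ofDigits]
  | cons b l ih =>
    rw [ofDigits_cons, List.length_cons, pow_succ]
    cases b <;> simp <;> omega

theorem PT.ofDigits {l : γ → List Bool} (hl : PT l) : PT fun x => PathFitting.ofDigits (l x) := by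
  refine foldl (step := fun (_ : γ) n b => Nat.bit b n) (init := fun _ => 0)
    (by fun_prop) (by fun_prop) hl (.const _ 6) fun x n b => ?_
  rw [sz_nat, sz_nat]
  have : (Nat.bit b n).size ≤ n.size + 1 := by
    rw [Nat.size_le, pow_succ, Nat.bit_val]
    have := Nat.lt_size_self n
    cases b <;> simp <;> omega
  omega

/-- One step of serial addition: operands, carry, digits of the result. -/
def addStep (s : ℕ × ℕ × Bool × List Bool) : ℕ × ℕ × Bool × List Bool :=
  (s.1.div2, s.2.1.div2,
    (s.1.bodd && s.2.1.bodd) || (s.2.2.1 && (s.1.bodd || s.2.1.bodd)),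
    (bif s.1.bodd then (bif s.2.1.bodd then s.2.2.1 else !s.2.2.1)
      else (bif s.2.1.bodd then !s.2.2.1 else s.2.2.1)) :: s.2.2.2)

/-- One step of serial subtraction: operands, borrow, digits of the result. -/
def subStep (s : ℕ × ℕ × Bool × List Bool) : ℕ × ℕ × Bool × List Bool :=
  (s.1.div2, s.2.1.div2,
    bif s.1.bodd then s.2.1.bodd && s.2.2.1 else s.2.1.bodd || s.2.2.1,
    (bif s.1.bodd then (bif s.2.1.bodd then s.2.2.1 else !s.2.2.1)
      else (bif s.2.1.bodd then !s.2.2.1 else s.2.2.1)) :: s.2.2.2)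

/-- One step of serial comparison: operands, comparison of the digits read so far. -/
def ltStep (s : ℕ × ℕ × Bool) : ℕ × ℕ × Bool :=
  (s.1.div2, s.2.1.div2,
    bif s.1.bodd then s.2.1.bodd && s.2.2 else s.2.1.bodd || s.2.2)

/-- A list long enough for the serial operations on `a` and `b`. -/
def fuel (a b : ℕ) : List Bool := true :: (a.bits ++ b.bits)

theorem add_lt_two_pow_fuel (a b : ℕ) : a + b < 2 ^ (fuel a b).length := by
  simp only [fuel, List.length_cons, List.length_append, Nat.size_eq_bits_len]
  have h1 := Nat.lt_size_self a
  have h2 := Nat.lt_size_self b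
  have h3 : 2 ^ a.size ≤ 2 ^ (a.size + b.size) := Nat.pow_le_pow_right (by omega) (by omega)
  have h4 : 2 ^ b.size ≤ 2 ^ (a.size + b.size) := Nat.pow_le_pow_right (by omega) (by omega)
  rw [pow_succ]
  omega

theorem two_mul_div2_add (n : ℕ) : n = 2 * n.div2 + n.bodd.toNat := by
  have := Nat.bodd_add_div2 n
  omega

/-- Loop invariant: the digits written so far, plus the remaining operands and the carry at their
place value, make up `A + B`. Digits are consed, so the output has its most significant digit first,
as `ofDigits` expects. -/
theorem addStep_foldl (A B : ℕ) (f : List Bool) :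
    let s := f.foldl (fun s _ => addStep s) (A, B, false, [])
    s.2.2.2.length = f.length ∧
      ofDigits s.2.2.2 + 2 ^ f.length * (s.1 + s.2.1 + s.2.2.1.toNat) = A + B := by
  induction f using List.reverseRecOn with
  | nil => simp [ofDigits]
  | append_singleton f d ih =>
    simp only [List.foldl_append, List.foldl_cons, List.foldl_nil, List.length_append,
      List.length_singleton] at ih ⊢
    generalize f.foldl (fun s _ => addStep s) (A, B, false, []) = s at ih ⊢
    obtain ⟨a, b, c, o⟩ := s
    obtain ⟨h1, h2⟩ := ih
    simp only at h1 h2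
    refine ⟨by simp [addStep, h1], ?_⟩
    rw [← h2]
    simp only [addStep, ofDigits_cons, h1, pow_succ]
    have ha := two_mul_div2_add a
    have hb := two_mul_div2_add b
    generalize a.bodd = a0 at *
    generalize b.bodd = b0 at *
    rw [ha, hb]
    cases a0 <;> cases b0 <;> cases c <;> simp <;> ring

/-- The invariant is arranged additively, so that no truncated subtraction occurs. The two
inequalities serve to show that both operands are used up in the end. -/
theorem subStep_foldl (A B : ℕ) (f : List Bool) :
    let s := f.foldl (fun s _ => subStep s) (A, B, false, [])
    s.2.2.2.length = f.length ∧ 2 ^ f.length * s.1 ≤ A ∧ 2 ^ f.length * s.2.1 ≤ B ∧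
      ofDigits s.2.2.2 + B + 2 ^ f.length * s.1 =
        A + 2 ^ f.length * (s.2.1 + s.2.2.1.toNat) := by
  induction f using List.reverseRecOn with
  | nil => simp [ofDigits]; omega
  | append_singleton f d ih =>
    simp only [List.foldl_append, List.foldl_cons, List.foldl_nil, List.length_append,
      List.length_singleton] at ih ⊢
    generalize f.foldl (fun s _ => subStep s) (A, B, false, []) = s at ih ⊢
    obtain ⟨a, b, c, o⟩ := s
    obtain ⟨h1, h2, h3, h4⟩ := ih
    simp only at h1 h2 h3 h4
    have ha := two_mul_div2_add a
    have hb := two_mul_div2_add b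
    simp only [subStep, ofDigits_cons, h1, pow_succ]
    generalize a.bodd = a0 at *
    generalize b.bodd = b0 at *
    generalize 2 ^ f.length = P at *
    generalize a.div2 = a' at *
    generalize b.div2 = b' at *
    subst ha hb
    refine ⟨by simp [h1], by nlinarith, by nlinarith, ?_⟩
    cases a0 <;> cases b0 <;> cases c <;> simp at h4 ⊢ <;> nlinarith

/-- Digits are read from the least significant end, so the unread parts take precedence and the flag
decides only if they agree. -/
theorem ltStep_foldl (A B : ℕ) (f : List Bool) :
    let s := f.foldl (fun s _ => ltStep s) (A, B, false)
    2 ^ f.length * s.1 ≤ A ∧ 2 ^ f.length * s.2.1 ≤ B ∧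
      (A < B ↔ s.1 < s.2.1 ∨ (s.1 = s.2.1 ∧ s.2.2 = true)) := by
  induction f using List.reverseRecOn with
  | nil => simp
  | append_singleton f d ih =>
    simp only [List.foldl_append, List.foldl_cons, List.foldl_nil, List.length_append,
      List.length_singleton] at ih ⊢
    generalize f.foldl (fun s _ => ltStep s) (A, B, false) = s at ih ⊢
    obtain ⟨a, b, c⟩ := s
    obtain ⟨h2, h3, h4⟩ := ih
    simp only at h2 h3 h4
    have ha := two_mul_div2_add a
    have hb := two_mul_div2_add b
    simp only [ltStep, pow_succ]
    generalize a.bodd = a0 at *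
    generalize b.bodd = b0 at *
    generalize 2 ^ f.length = P at *
    generalize a.div2 = a' at *
    generalize b.div2 = b' at *
    subst ha hb
    refine ⟨by nlinarith, by nlinarith, ?_⟩
    rw [h4]
    cases a0 <;> cases b0 <;> cases c <;> simp <;> omega

/-- The fuel exceeds the length of `a + b`, so whatever remains of the operands or of the carry
after all rounds is zero. -/
theorem eq_zero_of_two_pow_fuel_mul_le {a b m : ℕ} (h : 2 ^ (fuel a b).length * m ≤ a + b) :
    m = 0 := by
  have := add_lt_two_pow_fuel a b
  by_contra h0
  have : 2 ^ (fuel a b).length * 1 ≤ 2 ^ (fuel a b).length * m :=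
    Nat.mul_le_mul_left _ (by omega)
  omega

namespace PT

attribute [fun_prop] PT.ofDigits

@[fun_prop]
theorem fuel {f g : γ → ℕ} (hf : PT f) (hg : PT g) : PT fun x => fuel (f x) (g x) := by
  unfold PathFitting.fuel; fun_prop

@[fun_prop]
theorem add {f g : γ → ℕ} (hf : PT f) (hg : PT g) : PT fun x => f x + g x := by
  have h : PT fun x => (PathFitting.fuel (f x) (g x)).foldl (fun s _ => addStep s)
      (f x, g x, false, []) := by
    refine foldl (γ := γ) (step := fun _ s _ => addStep s)
      (init := fun x => (f x, g x, false, [])) (by unfold addStep; fun_prop) (by fun_prop)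
      (by fun_prop) (.const _ 6) fun x s a => ?_
    obtain ⟨a, b, c, o⟩ := s
    have := sz_div2_le a
    have := sz_div2_le b
    simp only [addStep, sz_mk, sz_cons, sz_bool]
    omega
  refine (by fun_prop : PT fun x => PathFitting.ofDigits ((PathFitting.fuel (f x) (g x)).foldl
    (fun s _ => addStep s) (f x, g x, false, [])).2.2.2).of_eq fun x => ?_
  obtain ⟨h1, h2⟩ := addStep_foldl (f x) (g x) (PathFitting.fuel (f x) (g x))
  have h3 := eq_zero_of_two_pow_fuel_mul_le (Nat.le.intro ((Nat.add_comm _ _).trans h2))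
  rw [h3] at h2
  simpa using h2

@[fun_prop]
theorem blt {f g : γ → ℕ} (hf : PT f) (hg : PT g) : PT fun x => Nat.blt (f x) (g x) := by
  have h : PT fun x => (PathFitting.fuel (f x) (g x)).foldl (fun s _ => ltStep s)
      (f x, g x, false) := by
    refine foldl (γ := γ) (step := fun _ s _ => ltStep s)
      (init := fun x => (f x, g x, false)) (by unfold ltStep; fun_prop) (by fun_prop)
      (by fun_prop) (.const _ 0) fun x s a => ?_
    obtain ⟨a, b, c⟩ := s
    have := sz_div2_le a
    have := sz_div2_le b
    simp only [ltStep, sz_mk, sz_bool]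
    omega
  refine (by fun_prop : PT fun x => ((PathFitting.fuel (f x) (g x)).foldl
    (fun s _ => ltStep s) (f x, g x, false)).2.2).of_eq fun x => ?_
  obtain ⟨h1, h2, h3⟩ := ltStep_foldl (f x) (g x) (PathFitting.fuel (f x) (g x))
  have h4 := eq_zero_of_two_pow_fuel_mul_le (h1.trans (Nat.le_add_right _ _))
  have h5 := eq_zero_of_two_pow_fuel_mul_le (h2.trans (Nat.le_add_left _ _))
  rw [h4, h5] at h3
  rw [Bool.eq_iff_iff, Nat.blt_eq, h3]
  simp

@[fun_prop]
theorem sub {f g : γ → ℕ} (hf : PT f) (hg : PT g) : PT fun x => f x - g x := by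
  have h : PT fun x => (PathFitting.fuel (f x) (g x)).foldl (fun s _ => subStep s)
      (f x, g x, false, []) := by
    refine foldl (γ := γ) (step := fun _ s _ => subStep s)
      (init := fun x => (f x, g x, false, [])) (by unfold subStep; fun_prop) (by fun_prop)
      (by fun_prop) (.const _ 6) fun x s a => ?_
    obtain ⟨a, b, c, o⟩ := s
    have := sz_div2_le a
    have := sz_div2_le b
    simp only [subStep, sz_mk, sz_cons, sz_bool]
    omega
  refine (by fun_prop : PT fun x => bif Nat.blt (f x) (g x) then 0 else
    PathFitting.ofDigits ((PathFitting.fuel (f x) (g x)).foldl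
      (fun s _ => subStep s) (f x, g x, false, [])).2.2.2).of_eq fun x => ?_
  obtain ⟨h1, h2, h3, h4⟩ := subStep_foldl (f x) (g x) (PathFitting.fuel (f x) (g x))
  have h5 := eq_zero_of_two_pow_fuel_mul_le (h2.trans (Nat.le_add_right _ _))
  have h6 := eq_zero_of_two_pow_fuel_mul_le (h3.trans (Nat.le_add_left _ _))
  by_cases hlt : f x < g x
  · have hb : Nat.blt (f x) (g x) = true := by rwa [Nat.blt_eq]
    rw [hb, cond_true]; omega
  · have hb : Nat.blt (f x) (g x) = false := by rwa [Bool.eq_false_iff, ne_eq, Nat.blt_eq]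
    rw [hb, cond_false]
    rw [h5, h6] at h4
    have h7 := ofDigits_lt ((PathFitting.fuel (f x) (g x)).foldl
      (fun s _ => subStep s) (f x, g x, false, [])).2.2.2
    rw [h1] at h7
    generalize (((PathFitting.fuel (f x) (g x)).foldl
      (fun s _ => subStep s) (f x, g x, false, [])).2.2.1) = c at h4
    cases c <;> simp at h4 <;> omega

@[fun_prop]
theorem ble {f g : γ → ℕ} (hf : PT f) (hg : PT g) : PT fun x => Nat.ble (f x) (g x) :=
  (by fun_prop : PT fun x => !Nat.blt (g x) (f x)).of_eq fun x => by
    rw [Bool.eq_iff_iff, Nat.ble_eq, Bool.not_eq_true', Bool.eq_false_iff, ne_eq, Nat.blt_eq]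
    omega

@[fun_prop]
theorem beq {f g : γ → ℕ} (hf : PT f) (hg : PT g) : PT fun x => Nat.beq (f x) (g x) :=
  (by fun_prop : PT fun x => Nat.ble (f x) (g x) && Nat.ble (g x) (f x)).of_eq fun x => by
    rw [Bool.eq_iff_iff, Bool.and_eq_true, Nat.ble_eq, Nat.ble_eq, Nat.beq_eq]
    omega

end PT

/-! ### Equality, minimal elements and search in lists; further arithmetic -/

/-- Whether two lists of numbers are equal. -/
def listBeq (l l' : List ℕ) : Bool := decide (l = l')

/-- Whether a number occurs in a list. -/
def mem (a : ℕ) (l : List ℕ) : Bool := l.any fun b => Nat.beq a b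

theorem mem_iff {a : ℕ} {l : List ℕ} : mem a l = true ↔ a ∈ l := by
  simp [mem, Nat.beq_eq]

/-- A minimal element of a list with respect to `le`, and `d` for the empty list. -/
def pick {α : Type*} (le : α → α → Bool) (l : List α) (d : α) : α :=
  l.foldl (fun b a => bif le b a then b else a) (l.headD d)

theorem pick_nil {α : Type*} (le : α → α → Bool) (d : α) : pick le [] d = d := rfl

theorem foldl_pick_mem {α : Type*} (le : α → α → Bool) (l : List α) (b : α) :
    l.foldl (fun b a => bif le b a then b else a) b ∈ b :: l := by
  induction l generalizing b with
  | nil => simp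
  | cons a l ih =>
    rw [List.foldl_cons]
    have := ih (bif le b a then b else a)
    cases h : le b a
    · simp only [h, cond_false] at this ⊢
      exact List.mem_cons_of_mem _ this
    · simp only [h, cond_true] at this ⊢
      rcases List.mem_cons.1 this with h | h
      · rw [h]; simp
      · simp [h]

theorem pick_mem {α : Type*} (le : α → α → Bool) {l : List α} (hl : l ≠ []) (d : α) :
    pick le l d ∈ l := by
  obtain ⟨a, t, rfl⟩ := List.exists_cons_of_ne_nil hl
  have := foldl_pick_mem le (a :: t) a
  rcases List.mem_cons.1 this with h | h
  · have h' : pick le (a :: t) d = a := h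
    rw [h']; exact List.mem_cons_self
  · exact h

theorem pick_le {α : Type*} {le : α → α → Bool} {l : List α} (hrefl : ∀ a ∈ l, le a a = true)
    (htotal : ∀ a ∈ l, ∀ b ∈ l, le a b = true ∨ le b a = true)
    (htrans : ∀ a ∈ l, ∀ b ∈ l, ∀ c ∈ l, le a b = true → le b c = true → le a c = true)
    (d : α) : ∀ a ∈ l, le (pick le l d) a = true := by
  -- The induction needs an arbitrary current winner `b` that belongs to `l`, since the order
  -- properties are only available on `l`. At each comparison the new winner is below both
  -- competitors.
  have h : ∀ (t : List α) (b : α), b ∈ l → (∀ a ∈ t, a ∈ l) →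
      ∀ a ∈ b :: t, le (t.foldl (fun b a => bif le b a then b else a) b) a = true := by
    intro t
    induction t with
    | nil => intro b hb _ a ha; simp at ha; subst ha; exact hrefl _ hb
    | cons c t ih =>
      intro b hb ht a ha
      have hc : c ∈ l := ht c (by simp)
      have ht' : ∀ a ∈ t, a ∈ l := fun a ha => ht a (by simp [ha])
      rw [List.foldl_cons]
      have hw : (bif le b c then b else c) ∈ l := by cases le b c <;> simp [hb, hc]
      have h1 := ih _ hw ht'
      have h2 := h1 _ List.mem_cons_self
      have h3 : t.foldl (fun b a => bif le b a then b else a) (bif le b c then b else c) ∈ l := by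
        rcases List.mem_cons.1 (foldl_pick_mem le t (bif le b c then b else c)) with h | h
        · rw [h]; exact hw
        · exact ht' _ h
      rcases List.mem_cons.1 ha with rfl | ha
      · refine htrans _ h3 _ hw _ hb h2 ?_
        cases hbc : le a c
        · simp only [cond_false]
          rcases htotal _ hb _ hc with h | h
          · rw [h] at hbc; cases hbc
          · exact h
        · exact hrefl _ hb
      · rcases List.mem_cons.1 ha with rfl | ha
        · refine htrans _ h3 _ hw _ hc h2 ?_
          cases hbc : le b a
          · exact hrefl _ hc
          · exact hbc
        · exact h1 a (List.mem_cons_of_mem _ ha)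
  cases l with
  | nil => simp
  | cons a t => exact fun b hb => h (a :: t) a (by simp) (fun _ h => h) b (by simp [hb])

/-- The entry of an association list for the key `q`. -/
def lookup (q : List ℕ) (tab : List (List ℕ × List ℕ)) : List ℕ :=
  ((tab.filter fun e => listBeq e.1 q).headD ([], [])).2

theorem lookup_eq {q r : List ℕ} {tab : List (List ℕ × List ℕ)} (h : (q, r) ∈ tab)
    (hu : ∀ r', (q, r') ∈ tab → r' = r) : lookup q tab = r := by
  have h1 : (q, r) ∈ tab.filter fun e => listBeq e.1 q := by simp [h, listBeq]
  obtain ⟨e, t, he⟩ := List.exists_cons_of_ne_nil (List.ne_nil_of_mem h1)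
  have h2 : e ∈ tab.filter fun e => listBeq e.1 q := by rw [he]; simp
  rw [lookup, he]
  simp only [List.mem_filter, listBeq, decide_eq_true_eq] at h2
  obtain ⟨e1, e2⟩ := e
  obtain ⟨h2, rfl⟩ := h2
  exact hu _ h2

theorem size_le_self (n : ℕ) : n.size ≤ n := Nat.size_le.2 Nat.lt_two_pow_self

namespace PT

@[fun_prop]
theorem mul {f g : γ → ℕ} (hf : PT f) (hg : PT g) : PT fun x => f x * g x := by
  -- Horner's scheme, from the most significant digit: double, and add the second factor if the
  -- digit is set.
  have h : PT fun x => (f x).bits.reverse.foldl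
      (fun n b => bif b then n + n + g x else n + n) 0 := by
    refine foldl (γ := γ) (step := fun x n b => bif b then n + n + g x else n + n)
      (init := fun x => 0) (by fun_prop) (by fun_prop)
      (by fun_prop) (G := fun p => 12 + sz (g p.1))
      ((PolyBdd.const _ 12).add (sz_bdd (by fun_prop))) fun x s b => ?_
    simp only [sz_nat]
    have : (bif b then s + s + g x else s + s).size ≤ s.size + (g x).size + 2 := by
      rw [Nat.size_le, pow_succ, pow_succ]
      have h1 := Nat.lt_size_self s
      have h2 := Nat.lt_size_self (g x)
      have h3 : 2 ^ s.size ≤ 2 ^ (s.size + (g x).size) :=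
        Nat.pow_le_pow_right (by omega) (by omega)
      have h4 : 2 ^ (g x).size ≤ 2 ^ (s.size + (g x).size) :=
        Nat.pow_le_pow_right (by omega) (by omega)
      cases b <;> simp <;> omega
    omega
  refine h.of_eq fun x => ?_
  have h1 : ∀ k : ℕ, k.bits.reverse.foldl (fun n b => bif b then n + n + g x else n + n) 0 =
      k * g x := by
    intro k
    induction k using Nat.binaryRec' with
    | zero => simp
    | bit b n hb ih =>
      rw [Nat.bits_append_bit _ _ hb, List.reverse_cons, List.foldl_append, ih, Nat.bit_val]
      cases b <;> simp <;> ring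
  exact h1 _

@[fun_prop]
theorem listBeq {f g : γ → List ℕ} (hf : PT f) (hg : PT g) :
    PT fun x => listBeq (f x) (g x) := by
  have h : PT fun x => (f x).foldl (fun (s : List ℕ × Bool) a =>
      (s.1.tail, s.2 && (!s.1.isEmpty && Nat.beq (s.1.headD 0) a))) (g x, true) := by
    refine foldl (γ := γ) (step := fun x (s : List ℕ × Bool) a =>
      (s.1.tail, s.2 && (!s.1.isEmpty && Nat.beq (s.1.headD 0) a)))
      (init := fun x => (g x, true)) (by fun_prop) (by fun_prop)
      (by fun_prop) (.const _ 0) fun x s b => ?_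
    have : sz s.1.tail ≤ sz s.1 := by
      cases s.1 with
      | nil => simp
      | cons a l => simp only [List.tail_cons, sz_cons]; omega
    obtain ⟨s, t⟩ := s
    simp only [sz_mk, sz_bool] at this ⊢
    omega
  -- The second list is consumed in parallel. Equality means that all comparisons succeeded and that
  -- nothing of it is left.
  have h2 : ∀ (k k' : List ℕ) (ok : Bool), (fun s : List ℕ × Bool => s.2 && s.1.isEmpty)
      (k.foldl (fun (s : List ℕ × Bool) a =>
        (s.1.tail, s.2 && (!s.1.isEmpty && Nat.beq (s.1.headD 0) a))) (k', ok)) =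
      (ok && decide (k = k')) := by
    intro k
    induction k with
    | nil => intro k' ok; cases k' <;> simp
    | cons a k ih =>
      intro k' ok
      rw [List.foldl_cons, ih]
      cases k' with
      | nil => simp
      | cons b k' =>
        rw [Bool.eq_iff_iff]
        simp only [Bool.and_eq_true, decide_eq_true_eq, Nat.beq_eq, List.cons.injEq,
          List.isEmpty_cons, Bool.not_false, List.headD_cons, List.tail_cons]
        constructor
        · rintro ⟨⟨h1, -, h2⟩, h3⟩; exact ⟨h1, h2.symm, of_decide_eq_true h3⟩
        · rintro ⟨h1, h2, h3⟩; exact ⟨⟨h1, trivial, h2.symm⟩, decide_eq_true h3⟩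
  refine (by fun_prop : PT fun x => ((f x).foldl (fun (s : List ℕ × Bool) a =>
      (s.1.tail, s.2 && (!s.1.isEmpty && Nat.beq (s.1.headD 0) a))) (g x, true)).2 &&
    ((f x).foldl (fun (s : List ℕ × Bool) a =>
      (s.1.tail, s.2 && (!s.1.isEmpty && Nat.beq (s.1.headD 0) a))) (g x, true)).1.isEmpty).of_eq
      fun x => (h2 _ _ _).trans ?_
  simp [PathFitting.listBeq]

@[fun_prop]
theorem mem {f : γ → ℕ} {l : γ → List ℕ} (hf : PT f) (hl : PT l) :
    PT fun x => mem (f x) (l x) := by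
  unfold PathFitting.mem; fun_prop

@[fun_prop]
theorem pick {le : γ → α → α → Bool} {l : γ → List α} {d : γ → α}
    (hle : PT fun p : γ × α × α => le p.1 p.2.1 p.2.2) (hl : PT l) (hd : PT d) :
    PT fun x => pick (fun a b => le x a b) (l x) (d x) := by
  unfold PathFitting.pick
  have hi : PT fun x => (l x).headD (d x) := by fun_prop
  refine foldl_of_bdd (γ := γ) (step := fun x b a => bif le x b a then b else a)
    (init := fun x => (l x).headD (d x)) (hle.cond (by fun_prop) (by fun_prop)) hi hl
    (G := fun x => sz ((l x).headD (d x)) + sz (l x)) (hi.sz_bdd.add hl.sz_bdd) fun x k hk => ?_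
  -- Whatever the comparison does, the current winner is the initial value or an element of the
  -- list, so its size cannot grow.
  rcases List.mem_cons.1 (foldl_pick_mem (le x) k ((l x).headD (d x))) with h | h
  · rw [h]; omega
  · have := sz_le_of_mem (hk.subset h)
    omega

@[fun_prop]
theorem lookup {q : γ → List ℕ} {tab : γ → List (List ℕ × List ℕ)} (hq : PT q) (ht : PT tab) :
    PT fun x => lookup (q x) (tab x) := by
  unfold PathFitting.lookup; fun_prop

@[fun_prop]
theorem length {l : γ → List α} (hl : PT l) : PT fun x => (l x).length := by
  refine (foldl (γ := γ) (step := fun _ n (_ : α) => n + 1) (init := fun _ => 0) (by fun_prop)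
    (by fun_prop) hl (.const _ 6) fun x n a => ?_).of_eq fun x => ?_
  · have : (n + 1).size ≤ n.size + 1 := by
      rw [Nat.size_le, pow_succ]
      have := Nat.lt_size_self n
      omega
    simp only [sz_nat]
    omega
  · have : ∀ (k : List α) (m : ℕ), k.foldl (fun n _ => n + 1) m = m + k.length := by
      intro k
      induction k with
      | nil => simp
      | cons a k ih => intro m; rw [List.foldl_cons, ih, List.length_cons]; omega
    simp [this]

-- The length of a list replaces a number here for a reason: `List.range n` is exponentially long in
-- the binary size of `n`, so some list of at least that length must be at hand.
@[fun_prop]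
theorem range_length {l : γ → List α} (hl : PT l) : PT fun x => List.range (l x).length := by
  have h : ∀ k : List α, k.foldl (fun (r : List ℕ) _ => r ++ [r.length]) [] =
      List.range k.length := by
    intro k
    induction k using List.reverseRecOn with
    | nil => rfl
    | append_singleton k a ih => simp [List.foldl_append, ih, List.range_succ]
  refine (foldl_of_bdd (γ := γ) (step := fun _ (r : List ℕ) (_ : α) => r ++ [r.length])
    (init := fun _ => []) (by fun_prop)
    (by fun_prop) hl (G := fun x => sz (l x) * (6 * sz (l x) + 1 + 1) + 1)
    ((hl.sz_bdd.mul ((hl.sz_bdd.const_mul_add _ _).add (.const _ 1))).add (.const _ 1))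
      fun x k hk => ?_).of_eq fun x => h _
  rw [h]
  have h1 : k.length ≤ sz (l x) := hk.length_le.trans (length_lt_sz _).le
  refine (sz_le_of_forall (B := 6 * sz (l x) + 1) fun a ha => ?_).trans ?_
  · rw [List.mem_range] at ha
    rw [sz_nat]
    have := size_le_self a
    omega
  · rw [List.length_range]
    exact Nat.add_le_add_right (Nat.mul_le_mul_right _ h1) _

@[fun_prop]
theorem getD {l : γ → List α} {i : γ → ℕ} {d : γ → α} (hl : PT l) (hi : PT i) (hd : PT d) :
    PT fun x => (l x).getD (i x) (d x) := by
  have h : PT fun x => (l x).foldl (fun (s : ℕ × α) a =>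
      (s.1 + 1, bif Nat.beq s.1 (i x) then a else s.2)) (0, d x) := by
    refine foldl (γ := γ) (step := fun x (s : ℕ × α) a =>
      (s.1 + 1, bif Nat.beq s.1 (i x) then a else s.2)) (init := fun x => (0, d x)) (by fun_prop)
      (by fun_prop) hl (bdd_sz.add (.const _ 6)) fun x s a => ?_
    obtain ⟨n, s⟩ := s
    have : (n + 1).size ≤ n.size + 1 := by
      rw [Nat.size_le, pow_succ]
      have := Nat.lt_size_self n
      omega
    cases Nat.beq n (i x) <;> simp only [sz_nat, sz_mk, cond_true, cond_false] <;> omega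
  refine h.snd.of_eq fun x => ?_
  have : ∀ (k : List α) (m : ℕ) (s : α), (k.foldl (fun (s : ℕ × α) a =>
      (s.1 + 1, bif Nat.beq s.1 (i x) then a else s.2)) (m, s)).2 =
      if m ≤ i x then k.getD (i x - m) s else s := by
    intro k
    induction k with
    | nil => intro m s; simp
    | cons a k ih =>
      intro m s
      rw [List.foldl_cons, ih]
      rcases lt_trichotomy m (i x) with h | h | h
      · have hb : Nat.beq m (i x) = false := by
          rw [Bool.eq_false_iff, ne_eq, Nat.beq_eq]; omega
        obtain ⟨e, he⟩ : ∃ e, i x - m = e + 1 := ⟨i x - m - 1, by omega⟩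
        rw [hb, if_pos (by omega), if_pos (by omega), he, List.getD_cons_succ,
          show i x - (m + 1) = e by omega]
        rfl
      · subst h
        simp
      · have hb : Nat.beq m (i x) = false := by
          rw [Bool.eq_false_iff, ne_eq, Nat.beq_eq]; omega
        rw [hb, if_neg (by omega), if_neg (by omega)]
        rfl
  simpa using this (l x) 0 (d x)

end PT

end Code

/-! ## The Hungarian method

The method works on a matrix of slacks.  A phase grows an alternating tree from the row `m`; the
tree is a list of paths, each of which runs from its head to `m`.  The row `r` and the
column `σ r` are matched. -/

section Hungarian

/-- An entry of a matrix. -/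
def entry (W : List (List ℕ)) (i j : ℕ) : ℕ := (W.getD i []).getD j 0

/-- The columns matched with the rows of the tree other than the root. -/
def treeCols (σ : List ℕ) (m : ℕ) (tree : List (List ℕ)) : List ℕ :=
  ((tree.map fun p => p.headD 0).filter fun r => !Nat.beq r m).map fun r => σ.getD r 0

/-- The pairs of a path of the tree and of a row whose column does not belong to the tree. -/
def candidates (R σ : List ℕ) (m : ℕ) (tree : List (List ℕ)) : List (List ℕ × ℕ) :=
  tree.flatMap fun p =>
    (R.filter fun r => !mem (σ.getD r 0) (treeCols σ m tree)).map fun r => (p, r)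

/-- The slack of a candidate. -/
def slack (W : List (List ℕ)) (σ : List ℕ) (c : List ℕ × ℕ) : ℕ :=
  entry W (c.1.headD 0) (σ.getD c.2 0)

/-- A candidate of minimal slack. -/
def chosen (R : List ℕ) (W : List (List ℕ)) (σ : List ℕ) (m : ℕ) (tree : List (List ℕ)) :
    List ℕ × ℕ :=
  pick (fun a b => Nat.ble (slack W σ a) (slack W σ b)) (candidates R σ m tree) ([], 0)

/-- Add `δ` to the columns of `T` and subtract it from the rows of `S`. -/
def adjust (R : List ℕ) (W : List (List ℕ)) (S T : List ℕ) (δ : ℕ) : List (List ℕ) :=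
  R.map fun i => R.map fun j =>
    (entry W i j + bif mem j T then δ else 0) - bif mem i S then δ else 0

/-- Exchange the columns of the rows `a` and `b`. -/
def swapAt (R σ : List ℕ) (a b : ℕ) : List ℕ :=
  R.map fun i => σ.getD (bif Nat.beq i a then b else bif Nat.beq i b then a else i) 0

/-- Augment a matching along a path. -/
def augment (R σ p : List ℕ) : List ℕ :=
  p.tail.foldl (fun σ b => swapAt R σ (p.headD 0) b) σ

/-- The matrix with a new tight edge from the tree to a column outside of it. -/
def tighten (R : List ℕ) (W : List (List ℕ)) (σ : List ℕ) (m : ℕ) (tree : List (List ℕ)) :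
    List (List ℕ) :=
  adjust R W (tree.map fun p => p.headD 0) (treeCols σ m tree)
    (slack W σ (chosen R W σ m tree))

/-- One step of a phase: the state consists of the matrix, the tree, and the new matching, which is
empty as long as no augmenting path is found. -/
def growTree (R : List ℕ) (m : ℕ) (σ : List ℕ) (s : List (List ℕ) × List (List ℕ) × List ℕ) :
    List (List ℕ) × List (List ℕ) × List ℕ :=
  bif s.2.2.isEmpty then
    (tighten R s.1 σ m s.2.1,
      bif Nat.blt (chosen R s.1 σ m s.2.1).2 m then
        (((chosen R s.1 σ m s.2.1).2 :: (chosen R s.1 σ m s.2.1).1) :: s.2.1, [])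
      else (s.2.1, augment R σ (bif Nat.beq (chosen R s.1 σ m s.2.1).2 m
        then (chosen R s.1 σ m s.2.1).1
        else (chosen R s.1 σ m s.2.1).2 :: (chosen R s.1 σ m s.2.1).1)))
  else s

/-- The result of a phase before the tree is discarded. -/
def growTrees (R : List ℕ) (m : ℕ) (s : List (List ℕ) × List ℕ) :
    List (List ℕ) × List (List ℕ) × List ℕ :=
  R.foldl (fun st _ => growTree R m s.2 st) (s.1, [[m]], [])

/-- The phase with root `m`. -/
def phase (R : List ℕ) (s : List (List ℕ) × List ℕ) (m : ℕ) : List (List ℕ) × List ℕ :=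
  ((growTrees R m s).1, (growTrees R m s).2.2)

/-- A minimum weight perfect matching for the weights `W`. -/
def hungarian (W : List (List ℕ)) : List ℕ :=
  ((List.range W.length).foldl (phase (List.range W.length)) (W, List.range W.length)).2

end Hungarian

/-! ### Correctness of the Hungarian method -/

section Correct

variable {n m : ℕ} {W : List (List ℕ)} {σ : List ℕ}

theorem entry_map_range {f : ℕ → ℕ → ℕ} {i j : ℕ} (hi : i < n) (hj : j < n) :
    entry ((List.range n).map fun i => (List.range n).map fun j => f i j) i j = f i j := by
  simp [entry, List.getD_eq_getElem?_getD, hi, hj]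

/-- `σ` describes a permutation of the numbers below `n`. -/
def IsPermList (n : ℕ) (σ : List ℕ) : Prop :=
  (∀ i < n, σ.getD i 0 < n) ∧ ∀ i < n, ∀ j < n, σ.getD i 0 = σ.getD j 0 → i = j

theorem IsPermList.surj (h : IsPermList n σ) {j : ℕ} (hj : j < n) : ∃ i < n, σ.getD i 0 = j := by
  let f : Fin n → Fin n := fun i => ⟨σ.getD i 0, h.1 i i.2⟩
  have hf : Function.Injective f := fun a b hab =>
    Fin.ext (h.2 a a.2 b b.2 (by simpa [f] using hab))
  obtain ⟨i, hi⟩ := Finite.surjective_of_injective hf ⟨j, hj⟩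
  exact ⟨i, i.2, by simpa [f] using congrArg Fin.val hi⟩

theorem getD_swapAt {a b i : ℕ} (hi : i < n) :
    (swapAt (List.range n) σ a b).getD i 0 =
      σ.getD (if i = a then b else if i = b then a else i) 0 := by
  have h : ∀ x y : ℕ, Nat.beq x y = decide (x = y) := fun x y => by
    rw [Bool.eq_iff_iff, Nat.beq_eq, decide_eq_true_eq]
  simp only [swapAt, h, List.getD_eq_getElem?_getD, List.getElem?_map, List.getElem?_range hi,
    Option.map_some, Option.getD_some, Bool.cond_decide]

theorem IsPermList.swapAt (h : IsPermList n σ) {a b : ℕ} (ha : a < n) (hb : b < n) :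
    IsPermList n (swapAt (List.range n) σ a b) := by
  have hlt : ∀ i < n, (if i = a then b else if i = b then a else i) < n := by
    intro i hi; split_ifs <;> assumption
  refine ⟨fun i hi => ?_, fun i hi j hj hij => ?_⟩
  · rw [getD_swapAt hi]; exact h.1 _ (hlt i hi)
  · rw [getD_swapAt hi, getD_swapAt hj] at hij
    have := h.2 _ (hlt i hi) _ (hlt j hj) hij
    split_ifs at this <;> omega

/-- Consecutive elements of a path are joined by tight edges. -/
def Linked (W : List (List ℕ)) (σ : List ℕ) : List ℕ → Prop
  | a :: b :: l => entry W b (σ.getD a 0) = 0 ∧ Linked W σ (b :: l)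
  | _ => True

/-- An edge of the path joins the column of a row to the next row, so the column of the last row is
never used. That is why the last row may be exempted from the hypothesis; this matters because the
root's column is not a tree column. -/
theorem Linked.congr {W' : List (List ℕ)} {σ' : List ℕ} : ∀ {p : List ℕ}, Linked W σ p →
    p.Nodup → (∀ a ∈ p, ∀ b ∈ p, a ≠ b → p.getLast? ≠ some a → entry W b (σ.getD a 0) = 0 →
      entry W' b (σ'.getD a 0) = 0) → Linked W' σ' p
  | [], _, _, _ => trivial
  | [_], _, _, _ => trivial
  | a :: b :: l, h, hn, hc => by
    refine ⟨hc a (by simp) b (by simp) ?_ ?_ h.1, Linked.congr h.2 (List.nodup_cons.1 hn).2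
      fun x hx y hy hxy hl => hc x (List.mem_cons_of_mem _ hx) y (List.mem_cons_of_mem _ hy) hxy
        (by rwa [List.getLast?_cons_cons])⟩
    · rintro rfl; simp at hn
    · rw [List.getLast?_cons_cons]
      intro h'
      exact (List.nodup_cons.1 hn).1 (List.mem_of_getLast? h')

/-- Exchanging the columns of `a` and its successor `b` gives `b` the former column of `a`, which is
tight for it. Afterwards `a` holds the column of `b`, so the path with `b` removed is again linked
and the induction continues. In the end every row has the column of its predecessor, and the head
has that of the last row. -/
theorem augment_spec (rest : List ℕ) : ∀ {σ : List ℕ} {a : ℕ}, IsPermList n σ →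
    (a :: rest).Nodup → (∀ x ∈ a :: rest, x < n) → Linked W σ (a :: rest) →
    let σ' := rest.foldl (fun σ b => swapAt (List.range n) σ a b) σ
    IsPermList n σ' ∧ (∀ x < n, x ∉ a :: rest → σ'.getD x 0 = σ.getD x 0) ∧
      (∀ x ∈ rest, entry W x (σ'.getD x 0) = 0) ∧
      ∀ z, (a :: rest).getLast? = some z → σ'.getD a 0 = σ.getD z 0 := by
  induction rest with
  | nil =>
    intro σ a h _ _ _
    refine ⟨h, fun _ _ _ => rfl, by simp, ?_⟩
    simp
  | cons b l ih =>
    intro σ a h hn hlt hl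
    have han : a < n := hlt a (by simp)
    have hbn : b < n := hlt b (by simp)
    simp only [List.nodup_cons, List.mem_cons, not_or] at hn
    obtain ⟨⟨hab, hal⟩, hbl, hnl⟩ := hn
    have hsame : ∀ x < n, x ≠ a → x ≠ b →
        (swapAt (List.range n) σ a b).getD x 0 = σ.getD x 0 := by
      intro x hx h1 h2
      rw [getD_swapAt hx, if_neg h1, if_neg h2]
    have ha' : (swapAt (List.range n) σ a b).getD a 0 = σ.getD b 0 := by
      rw [getD_swapAt han, if_pos rfl]
    have hb' : (swapAt (List.range n) σ a b).getD b 0 = σ.getD a 0 := by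
      rw [getD_swapAt hbn, if_neg (Ne.symm hab), if_pos rfl]
    have hl' : Linked W (swapAt (List.range n) σ a b) (a :: l) := by
      cases l with
      | nil => trivial
      | cons c l =>
        refine ⟨by rw [ha']; exact hl.2.1, ?_⟩
        refine Linked.congr hl.2.2 hnl fun x hx y hy _ _ hxy => ?_
        have h1 : x ≠ a := fun h => hal (h ▸ hx)
        have h2 : x ≠ b := fun h => hbl (h ▸ hx)
        rw [hsame x (hlt x (by simp [List.mem_cons.1 hx])) h1 h2]
        exact hxy
    obtain ⟨h1, h2, h3, h4⟩ := ih (h.swapAt han hbn) (List.nodup_cons.2 ⟨hal, hnl⟩)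
      (fun x hx => hlt x (by
        rcases List.mem_cons.1 hx with rfl | hx
        · simp
        · simp [hx])) hl'
    refine ⟨h1, fun x hx hxn => ?_, fun x hx => ?_, fun z hz => ?_⟩
    · simp only [List.mem_cons, not_or] at hxn
      rw [List.foldl_cons, h2 x hx (by simp [hxn]), hsame x hx hxn.1 hxn.2.1]
    · rcases List.mem_cons.1 hx with rfl | hx
      · rw [List.foldl_cons, h2 x hbn (by simp [hbl, Ne.symm hab]), hb']
        exact hl.1
      · exact h3 x hx
    · rw [List.foldl_cons]
      cases l with
      | nil =>
        simp at hz
        subst hz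
        exact ha'
      | cons c l =>
        rw [List.getLast?_cons_cons, List.getLast?_cons_cons] at hz
        rw [h4 z (by rwa [List.getLast?_cons_cons])]
        have hz' := List.mem_of_getLast? hz
        exact hsame z (hlt z (by simp [List.mem_cons.1 hz'])) (fun h => hal (h ▸ hz'))
          (fun h => hbl (h ▸ hz'))

/-- During a phase the empty list signals that no augmenting path has been found, so a genuine
result must be nonempty. -/
theorem augment_ne_nil (hn : n ≠ 0) (hσ : σ ≠ []) (p : List ℕ) :
    augment (List.range n) σ p ≠ [] := by
  unfold augment
  generalize p.tail = l
  generalize p.headD 0 = a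
  induction l generalizing σ with
  | nil => exact hσ
  | cons b l ih =>
    refine ih ?_
    simp [swapAt, hn]

/-- The invariant of the phases: the slacks belong to potentials, and the first `m` rows are matched
by tight edges. -/
structure MatchInv (n m : ℕ) (w : ℕ → ℕ → ℕ) (W : List (List ℕ)) (σ : List ℕ) : Prop where
  potential : ∃ u v : ℕ → ℤ, ∀ i < n, ∀ j < n, (entry W i j : ℤ) = w i j - u i - v j
  perm : IsPermList n σ
  tight : ∀ i < m, entry W i (σ.getD i 0) = 0

/-- The paths of the tree. -/
structure PathInv (m : ℕ) (W : List (List ℕ)) (σ p : List ℕ) : Prop where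
  nodup : p.Nodup
  last : p.getLast? = some m
  le : ∀ a ∈ p, a ≤ m
  linked : Linked W σ p

/-- The invariant of the steps of a phase. -/
structure TreeInv (m : ℕ) (W : List (List ℕ)) (σ : List ℕ) (tree : List (List ℕ)) : Prop where
  path : ∀ p ∈ tree, PathInv m W σ p
  closed : ∀ p ∈ tree, ∀ a ∈ p, a ∈ tree.map fun p => p.headD 0
  nodup : (tree.map fun p => p.headD 0).Nodup
  ne_nil : tree ≠ []

theorem TreeInv.mem_le {tree : List (List ℕ)} (h : TreeInv m W σ tree) {a : ℕ}
    (ha : a ∈ tree.map fun p => p.headD 0) : a ≤ m := by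
  obtain ⟨p, hp, rfl⟩ := List.mem_map.1 ha
  have h1 := h.path p hp
  cases p with
  | nil => have := h1.last; simp at this
  | cons a p => exact h1.le a (by simp)

/-- The heads are distinct numbers up to `m`. This bound makes the phase terminate. -/
theorem TreeInv.length_le {tree : List (List ℕ)} (h : TreeInv m W σ tree) :
    tree.length ≤ m + 1 := by
  have h1 : (tree.map fun p => p.headD 0) ⊆ List.range (m + 1) := fun a ha =>
    List.mem_range.2 (Nat.lt_succ_of_le (h.mem_le ha))
  simpa using (h.nodup.subperm h1).length_le

theorem mem_treeCols {tree : List (List ℕ)} {j : ℕ} : j ∈ treeCols σ m tree ↔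
    ∃ r ∈ tree.map fun p => p.headD 0, r ≠ m ∧ σ.getD r 0 = j := by
  have : ∀ r, Nat.beq r m = decide (r = m) := fun r => by
    rw [Bool.eq_iff_iff, Nat.beq_eq, decide_eq_true_eq]
  simp only [treeCols, List.mem_map, List.mem_filter, this, Bool.not_eq_true', decide_eq_false_iff_not]
  constructor
  · rintro ⟨r, ⟨h1, h2⟩, h3⟩; exact ⟨r, h1, h2, h3⟩
  · rintro ⟨r, h1, h2, h3⟩; exact ⟨r, ⟨h1, h2⟩, h3⟩

theorem mem_candidates {R : List ℕ} {tree : List (List ℕ)} {c : List ℕ × ℕ} :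
    c ∈ candidates R σ m tree ↔
      c.1 ∈ tree ∧ c.2 ∈ R ∧ σ.getD c.2 0 ∉ treeCols σ m tree := by
  obtain ⟨p, r⟩ := c
  simp only [candidates, List.mem_flatMap, List.mem_map, List.mem_filter, Bool.not_eq_true',
    Bool.eq_false_iff, ne_eq, mem_iff, Prod.mk.injEq]
  constructor
  · rintro ⟨p', h1, r', ⟨h2, h3⟩, rfl, rfl⟩; exact ⟨h1, h2, h3⟩
  · rintro ⟨h1, h2, h3⟩; exact ⟨p, h1, r, ⟨h2, h3⟩, rfl, rfl⟩

section Step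

variable {w : ℕ → ℕ → ℕ} {tree : List (List ℕ)}

/-- A candidate always exists: the root's own column lies outside the tree, because `σ` is injective
and the root is left out of `treeCols`. -/
theorem chosen_mem (hm : m < n) (hW : MatchInv n m w W σ) (hT : TreeInv m W σ tree) :
    chosen (List.range n) W σ m tree ∈ candidates (List.range n) σ m tree := by
  refine pick_mem _ (List.ne_nil_of_mem (a := (tree.head hT.ne_nil, m)) ?_) _
  rw [mem_candidates]
  refine ⟨List.head_mem _, List.mem_range.2 hm, fun h => ?_⟩
  obtain ⟨r, h1, h2, h3⟩ := mem_treeCols.1 h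
  exact h2 (hW.perm.2 _ (lt_of_le_of_lt (hT.mem_le h1) hm) _ hm h3)

theorem slack_chosen_le (hW : MatchInv n m w W σ)
    {i j : ℕ} (hi : i ∈ tree.map fun p => p.headD 0) (hj : j < n) (hjT : j ∉ treeCols σ m tree) :
    slack W σ (chosen (List.range n) W σ m tree) ≤ entry W i j := by
  obtain ⟨p, hp, rfl⟩ := List.mem_map.1 hi
  obtain ⟨r, hr, rfl⟩ := hW.perm.surj hj
  have h1 : (p, r) ∈ candidates (List.range n) σ m tree :=
    mem_candidates.2 ⟨hp, List.mem_range.2 hr, hjT⟩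
  have h2 := pick_le (le := fun a b => Nat.ble (slack W σ a) (slack W σ b))
    (l := candidates (List.range n) σ m tree) (fun a _ => by simp)
    (fun a _ b _ => by simp only [Nat.ble_eq]; omega)
    (fun a _ b _ c _ => by simp only [Nat.ble_eq]; omega) ([], 0) _ h1
  exact Nat.ble_eq ▸ h2

theorem entry_tighten {i j : ℕ} (hi : i < n) (hj : j < n) :
    entry (tighten (List.range n) W σ m tree) i j =
      (entry W i j + if j ∈ treeCols σ m tree then
          slack W σ (chosen (List.range n) W σ m tree) else 0) -
        if i ∈ tree.map fun p => p.headD 0 then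
          slack W σ (chosen (List.range n) W σ m tree) else 0 := by
  rw [tighten, adjust, entry_map_range hi hj]
  congr 1
  · congr 1
    by_cases h : j ∈ treeCols σ m tree
    · rw [if_pos h, mem_iff.2 h, cond_true]
    · rw [if_neg h, Bool.eq_false_iff.2 (fun h' => h (mem_iff.1 h')), cond_false]
  · by_cases h : i ∈ tree.map fun p => p.headD 0
    · rw [if_pos h, mem_iff.2 h, cond_true]
    · rw [if_neg h, Bool.eq_false_iff.2 (fun h' => h (mem_iff.1 h')), cond_false]

/-- The shift raises `u` on the tree rows and lowers `v` on the tree columns by the minimal slack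
`δ`. Truncated subtraction is exact: an entry that loses `δ` without gaining it has slack at least
`δ`. A matched pair with row below `m` has both ends in the tree or neither, so its slack remains
zero. -/
theorem MatchInv.tighten (hm : m < n) (hW : MatchInv n m w W σ) (hT : TreeInv m W σ tree) :
    MatchInv n m w (tighten (List.range n) W σ m tree) σ := by
  refine ⟨?_, hW.perm, fun i hi => ?_⟩
  · obtain ⟨u, v, huv⟩ := hW.potential
    refine ⟨fun i => u i + if i ∈ tree.map fun p => p.headD 0 then
        (slack W σ (chosen (List.range n) W σ m tree) : ℤ) else 0,
      fun j => v j - if j ∈ treeCols σ m tree then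
        (slack W σ (chosen (List.range n) W σ m tree) : ℤ) else 0, fun i hi j hj => ?_⟩
    rw [entry_tighten hi hj, Nat.cast_sub, Nat.cast_add, huv i hi j hj]
    · push_cast; ring
    · by_cases h1 : i ∈ tree.map fun p => p.headD 0
      · by_cases h2 : j ∈ treeCols σ m tree
        · rw [if_pos h1, if_pos h2]; omega
        · rw [if_pos h1, if_neg h2]
          exact slack_chosen_le hW h1 hj h2
      · simp only [if_neg h1]; omega
  · rw [entry_tighten (hi.trans hm) (hW.perm.1 i (hi.trans hm)), hW.tight i hi, zero_add]
    by_cases h1 : i ∈ tree.map fun p => p.headD 0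
    · rw [if_pos h1, if_pos (mem_treeCols.2 ⟨i, h1, hi.ne, rfl⟩)]; omega
    · rw [if_neg h1, if_neg fun h => ?_]
      obtain ⟨r, h2, h3, h4⟩ := mem_treeCols.1 h
      have := hW.perm.2 _ (lt_of_le_of_lt (hT.mem_le h2) hm) _ (hi.trans hm) h4
      exact h1 (this ▸ h2)

/-- Along a path of the tree, the rows and the columns used all belong to the tree, so the two
changes by `δ` cancel. Closedness of the tree provides the membership. -/
theorem PathInv.tighten (hm : m < n) (hW : MatchInv n m w W σ) (hT : TreeInv m W σ tree)
    {p : List ℕ} (hp : p ∈ tree) : PathInv m (tighten (List.range n) W σ m tree) σ p := by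
  have h := hT.path p hp
  refine ⟨h.nodup, h.last, h.le, h.linked.congr h.nodup fun a ha b hb _ hal hab => ?_⟩
  have ham : a ≠ m := fun h' => hal (h' ▸ h.last)
  have ha' := hT.closed p hp a ha
  have hb' := hT.closed p hp b hb
  rw [entry_tighten (lt_of_le_of_lt (h.le b hb) hm)
    (hW.perm.1 a (lt_of_le_of_lt (h.le a ha) hm)), hab, if_pos hb',
    if_pos (mem_treeCols.2 ⟨a, ha', ham, rfl⟩)]
  omega

/-- The new tight edge runs from a tree row to the column of some row `r`. If `r < m`, the row `r`
is already matched and joins the tree. If `r ≥ m`, the column is free for augmentation: for `r = m`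
the root gives up its column to the head of the path, and for `r > m` the path is first extended by
`r`, which receives the root's column in exchange. -/
theorem growTree_spec (hm : m < n) (hW : MatchInv n m w W σ) (hT : TreeInv m W σ tree)
    (hσ : σ ≠ []) :
    let s := growTree (List.range n) m σ (W, tree, [])
    (s.2.2 = [] ∧ MatchInv n m w s.1 σ ∧ TreeInv m s.1 σ s.2.1 ∧
        s.2.1.length = tree.length + 1) ∨
      (s.2.2 ≠ [] ∧ MatchInv n (m + 1) w s.1 s.2.2) := by
  have hc := chosen_mem hm hW hT
  have hW' := hW.tighten hm hT
  have hP' := fun p hp => PathInv.tighten (p := p) hm hW hT hp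
  have hnew : entry (PathFitting.tighten (List.range n) W σ m tree)
      ((chosen (List.range n) W σ m tree).1.headD 0)
      (σ.getD (chosen (List.range n) W σ m tree).2 0) = 0 := by
    obtain ⟨h1, h2, h3⟩ := mem_candidates.1 hc
    have h4 : (chosen (List.range n) W σ m tree).1.headD 0 ∈ tree.map fun p => p.headD 0 :=
      List.mem_map.2 ⟨_, h1, rfl⟩
    rw [entry_tighten (lt_of_le_of_lt (hT.mem_le h4) hm) (hW.perm.1 _ (List.mem_range.1 h2)),
      if_pos h4, if_neg h3]
    simp [slack]
  obtain ⟨h1, h2, h3⟩ := mem_candidates.1 hc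
  rw [List.mem_range] at h2
  simp only [growTree, List.isEmpty_nil, cond_true]
  generalize PathFitting.tighten (List.range n) W σ m tree = W' at *
  generalize chosen (List.range n) W σ m tree = c at *
  obtain ⟨p, r⟩ := c
  simp only at h1 h2 h3 hnew ⊢
  have hp := hP' p h1
  have hrT : r ≠ m → r ∉ tree.map fun p => p.headD 0 := fun h h' =>
    h3 (mem_treeCols.2 ⟨r, h', h, rfl⟩)
  have hrp : r ≠ m → r ∉ p := fun h h' => hrT h (hT.closed p h1 r h')
  obtain ⟨a, l, rfl⟩ : ∃ a l, p = a :: l := by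
    cases p with
    | nil => have := hp.last; simp at this
    | cons a l => exact ⟨a, l, rfl⟩
  have hlt : ∀ x ∈ a :: l, x < n := fun x hx => lt_of_le_of_lt (hp.le x hx) hm
  have hmp : m ∈ a :: l := List.mem_of_getLast? hp.last
  -- Both augmenting cases reduce to the tightness of the rows up to `m`; potentials and
  -- nonemptiness are common to them.
  have key : ∀ {q : List ℕ}, IsPermList n (augment (List.range n) σ q) →
      (∀ i < m + 1, entry W' i ((augment (List.range n) σ q).getD i 0) = 0) →
      augment (List.range n) σ q ≠ [] ∧ MatchInv n (m + 1) w W' (augment (List.range n) σ q) :=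
    fun h h' => ⟨augment_ne_nil (by omega) hσ _, hW'.potential, h, h'⟩
  rcases lt_trichotomy r m with hr | hr | hr
  · left
    have hb : Nat.blt r m = true := by rwa [Nat.blt_eq]
    rw [hb]
    refine ⟨rfl, hW', ⟨fun q hq => ?_, fun q hq x hx => ?_, ?_, by simp⟩, by simp⟩
    · rcases List.mem_cons.1 hq with rfl | hq
      · refine ⟨List.nodup_cons.2 ⟨hrp hr.ne, hp.nodup⟩, ?_, ?_, hnew, hp.linked⟩
        · rw [List.getLast?_cons_cons]; exact hp.last
        · intro x hx
          rcases List.mem_cons.1 hx with rfl | hx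
          · exact hr.le
          · exact hp.le x hx
      · exact hP' q hq
    · rcases List.mem_cons.1 hq with rfl | hq
      · rcases List.mem_cons.1 hx with rfl | hx
        · simp
        · exact List.mem_cons_of_mem _ (hT.closed _ h1 x hx)
      · exact List.mem_cons_of_mem _ (hT.closed _ hq x hx)
    · simpa using ⟨by simpa using hrT hr.ne, by simpa using hT.nodup⟩
  · right
    subst hr
    have hb : Nat.blt r r = false := by rw [Bool.eq_false_iff, ne_eq, Nat.blt_eq]; omega
    have hb' : Nat.beq r r = true := by rw [Nat.beq_eq]
    rw [hb, hb']
    obtain ⟨k1, k2, k3, k4⟩ := augment_spec l hW.perm hp.nodup hlt hp.linked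
    refine key k1 fun i hi => ?_
    by_cases hil : i ∈ l
    · exact k3 i hil
    · by_cases hia : i = a
      · subst hia
        have := k4 r hp.last
        simp only [cond_true, augment, List.tail_cons, List.headD_cons]
        rw [this]
        exact hnew
      · have : i ∉ a :: l := by simp [hil, hia]
        have him : i ≠ r := fun h => this (h ▸ hmp)
        simp only [cond_true, augment, List.tail_cons, List.headD_cons]
        rw [k2 i (by omega) this]
        exact hW'.tight i (by omega)
  · right
    have hb : Nat.blt r m = false := by rw [Bool.eq_false_iff, ne_eq, Nat.blt_eq]; omega
    have hb' : Nat.beq r m = false := by rw [Bool.eq_false_iff, ne_eq, Nat.beq_eq]; omega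
    rw [hb, hb']
    obtain ⟨k1, k2, k3, k4⟩ := augment_spec (W := W') (a :: l) hW.perm
      (List.nodup_cons.2 ⟨hrp hr.ne', hp.nodup⟩) (by
        intro x hx
        rcases List.mem_cons.1 hx with rfl | hx
        · exact h2
        · exact hlt x hx) ⟨hnew, hp.linked⟩
    refine key k1 fun i hi => ?_
    by_cases hil : i ∈ a :: l
    · exact k3 i hil
    · have him : i ≠ m := fun h => hil (h ▸ hmp)
      simp only [cond_false, augment, List.tail_cons, List.headD_cons]
      rw [k2 i (by omega) (by
        rw [List.mem_cons, not_or]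
        exact ⟨by omega, hil⟩)]
      exact hW'.tight i (by omega)

/-- Each unsuccessful step enlarges the tree. After `n` of them it would contain `n + 1` paths, more
than the permitted `m + 1`. -/
theorem growTrees_spec (hm : m < n) (hW : MatchInv n m w W σ) (hσ : σ ≠ []) :
    let s := growTrees (List.range n) m (W, σ)
    s.2.2 ≠ [] ∧ MatchInv n (m + 1) w s.1 s.2.2 := by
  have h : ∀ l : List ℕ,
      let s := l.foldl (fun st _ => growTree (List.range n) m σ st) (W, [[m]], [])
      (s.2.2 = [] ∧ MatchInv n m w s.1 σ ∧ TreeInv m s.1 σ s.2.1 ∧ s.2.1.length = l.length + 1) ∨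
        (s.2.2 ≠ [] ∧ MatchInv n (m + 1) w s.1 s.2.2) := by
    intro l
    induction l using List.reverseRecOn with
    | nil =>
      refine .inl ⟨rfl, hW, ⟨fun p hp => ?_, fun p hp a ha => ?_, by simp, by simp⟩, rfl⟩
      · obtain rfl := List.mem_singleton.1 hp
        exact ⟨by simp, rfl, by simp, trivial⟩
      · obtain rfl := List.mem_singleton.1 hp
        simpa using ha
    | append_singleton l a ih =>
      simp only [List.foldl_append, List.foldl_cons, List.foldl_nil, List.length_append,
        List.length_singleton] at ih ⊢
      generalize l.foldl (fun st _ => growTree (List.range n) m σ st) (W, [[m]], []) = s at *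
      obtain ⟨W', tree, res⟩ := s
      rcases ih with ⟨h1, h2, h3, h4⟩ | ⟨h1, h2⟩
      · simp only at h1 h2 h3 h4
        subst h1
        rw [← h4]
        exact growTree_spec hm h2 h3 hσ
      · simp only at h1 h2
        right
        have : growTree (List.range n) m σ (W', tree, res) = (W', tree, res) := by
          simp [growTree, List.isEmpty_eq_false_iff.2 h1]
        rw [this]
        exact ⟨h1, h2⟩
  rcases h (List.range n) with ⟨-, -, h3, h4⟩ | h
  · exfalso
    have := h3.length_le
    rw [h4, List.length_range] at this
    omega
  · exact h

/-- The Hungarian method finds a permutation and dual variables that certify its optimality. -/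
theorem hungarian_spec (W : List (List ℕ)) :
    IsPermList W.length (hungarian W) ∧ ∃ u v : ℕ → ℤ,
      (∀ i < W.length, ∀ j < W.length, u i + v j ≤ entry W i j) ∧
      ∀ i < W.length, u i + v ((hungarian W).getD i 0) = entry W i ((hungarian W).getD i 0) := by
  have h0 : MatchInv W.length 0 (entry W) W (List.range W.length) := by
    refine ⟨⟨0, 0, by simp⟩, ⟨fun i hi => ?_, fun i hi j hj => ?_⟩, by simp⟩
    · simp [List.getD_eq_getElem?_getD, hi]
    · simp [List.getD_eq_getElem?_getD, hi, hj]
  have h : ∀ k ≤ W.length,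
      let s := (List.range k).foldl (phase (List.range W.length)) (W, List.range W.length)
      (W.length ≠ 0 → s.2 ≠ []) ∧ MatchInv W.length k (entry W) s.1 s.2 := by
    intro k
    induction k with
    | zero => exact fun _ => ⟨by simp, h0⟩
    | succ k ih =>
      intro hk
      obtain ⟨h1, h2⟩ := ih (by omega)
      simp only [List.range_succ, List.foldl_append, List.foldl_cons, List.foldl_nil]
      generalize (List.range k).foldl (phase (List.range W.length)) (W, List.range W.length) = s
        at *
      obtain ⟨h3, h4⟩ := growTrees_spec (by omega) h2 (h1 (by omega))
      exact ⟨fun _ => h3, h4⟩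
  obtain ⟨-, h1⟩ := h W.length le_rfl
  obtain ⟨u, v, huv⟩ := h1.potential
  refine ⟨h1.perm, u, v, fun i hi j hj => ?_, fun i hi => ?_⟩
  -- Slacks are natural numbers, so dual feasibility is built into the representation.
  · have := huv i hi j hj; omega
  · have h2 := huv i hi _ (h1.perm.1 i hi)
    have h3 := h1.tight i hi
    rw [h3] at h2
    rw [hungarian]
    push_cast at h2
    omega

end Step

end Correct

/-! ### Size bounds and polynomial running time of the Hungarian method -/

section Sizes

variable {γ : Type} [Code γ]

/-- A list with at most `N` elements, each of size at most `B`. -/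
def Small {α : Type} [Code α] (N B : ℕ) (l : List α) : Prop := l.length ≤ N ∧ ∀ a ∈ l, sz a ≤ B

/-- A list of at most `K` lists with at most `N` elements, each of size at most `B`. -/
def Small₂ (K N B : ℕ) (W : List (List ℕ)) : Prop := W.length ≤ K ∧ ∀ l ∈ W, Small N B l

theorem Small.sz_le {α : Type} [Code α] {N B : ℕ} {l : List α} (h : Small N B l) :
    sz l ≤ N * (B + 1) + 1 :=
  (sz_le_of_forall h.2).trans (Nat.add_le_add_right (Nat.mul_le_mul_right _ h.1) _)

theorem Small.of_sz_le {α : Type} [Code α] {N : ℕ} {l : List α} (h : sz l ≤ N) : Small N N l :=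
  ⟨(length_lt_sz l).le.trans h, fun _ ha => (sz_le_of_mem ha).le.trans h⟩

theorem Small.mono {α : Type} [Code α] {N N' B B' : ℕ} {l : List α} (h : Small N B l)
    (hN : N ≤ N') (hB : B ≤ B') : Small N' B' l :=
  ⟨h.1.trans hN, fun a ha => (h.2 a ha).trans hB⟩

theorem Small₂.sz_le {K N B : ℕ} {W : List (List ℕ)} (h : Small₂ K N B W) :
    sz W ≤ K * (N * (B + 1) + 1 + 1) + 1 :=
  Small.sz_le ⟨h.1, fun l hl => (h.2 l hl).sz_le⟩

theorem Small₂.of_sz_le {N : ℕ} {W : List (List ℕ)} (h : sz W ≤ N) : Small₂ N N N W :=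
  ⟨(length_lt_sz W).le.trans h, fun _ hl => Small.of_sz_le ((sz_le_of_mem hl).le.trans h)⟩

theorem Small₂.mono {K K' N N' B B' : ℕ} {W : List (List ℕ)} (h : Small₂ K N B W) (hK : K ≤ K')
    (hN : N ≤ N') (hB : B ≤ B') : Small₂ K' N' B' W :=
  ⟨h.1.trans hK, fun l hl => (h.2 l hl).mono hN hB⟩

theorem Small.map {α β : Type} [Code α] [Code β] {N B : ℕ} {l : List α} {f : α → β}
    (hl : l.length ≤ N) (hf : ∀ a ∈ l, sz (f a) ≤ B) : Small N B (l.map f) := by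
  refine ⟨by simpa using hl, fun b hb => ?_⟩
  obtain ⟨a, ha, rfl⟩ := List.mem_map.1 hb
  exact hf a ha

theorem Small.getD {N B : ℕ} {l : List ℕ} (h : Small N B l) (hB : 1 ≤ B) (i : ℕ) :
    sz (l.getD i 0) ≤ B := by
  rw [List.getD_eq_getElem?_getD]
  cases hi : l[i]? with
  | none => exact hB
  | some a => exact h.2 a (List.mem_of_getElem? hi)

theorem Small₂.entry {K N B : ℕ} {W : List (List ℕ)} (h : Small₂ K N B W) (hB : 1 ≤ B) (i j : ℕ) :
    sz (entry W i j) ≤ B := by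
  refine Small.getD (N := N) ?_ hB j
  rw [List.getD_eq_getElem?_getD]
  cases hi : W[i]? with
  | none => exact ⟨by simp, by simp⟩
  | some a => exact h.2 a (List.mem_of_getElem? hi)

theorem sz_add_le {a b B : ℕ} (ha : sz a ≤ B) (hb : sz b ≤ B) : sz (a + b) ≤ B + 6 := by
  rw [sz_nat] at *
  have h1 := Nat.lt_size_self a
  have h2 := Nat.lt_size_self b
  have h3 : 2 ^ a.size ≤ 2 ^ max a.size b.size := Nat.pow_le_pow_right (by omega) (by simp)
  have h4 : 2 ^ b.size ≤ 2 ^ max a.size b.size := Nat.pow_le_pow_right (by omega) (by simp)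
  have h5 : (a + b).size ≤ max a.size b.size + 1 := by
    rw [Nat.size_le, pow_succ]; omega
  omega

section Bounds

variable {K N B M k : ℕ} {R σ : List ℕ} {W : List (List ℕ)}

/-- Adding `δ` costs at most one more binary digit, that is six symbols, and subtraction never
lengthens a number. -/
theorem Small₂.adjust (h : Small₂ N N B W) (hB : 1 ≤ B) (hR : R.length ≤ N) (S T : List ℕ) {δ : ℕ}
    (hδ : sz δ ≤ B) : Small₂ N N (B + 6) (adjust R W S T δ) := by
  refine ⟨by simpa [PathFitting.adjust] using hR, fun l hl => ?_⟩
  obtain ⟨i, -, rfl⟩ := List.mem_map.1 hl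
  refine Small.map hR fun j _ => (sz_nat_mono (Nat.sub_le _ _)).trans (sz_add_le (h.entry hB i j) ?_)
  cases mem j T
  · exact hB
  · exact hδ

/-- Exchanges only rearrange the entries of `σ`, possibly inserting the default `0`, and create no
new numbers. -/
theorem Small.augment (h : Small N M σ) (hM : 1 ≤ M) (hR : R.length ≤ N) (p : List ℕ) :
    Small N M (augment R σ p) := by
  unfold PathFitting.augment
  generalize p.tail = l
  generalize p.headD 0 = a
  induction l generalizing σ with
  | nil => exact h
  | cons b l ih => exact ih (Small.map hR fun i _ => h.getD hM _)

theorem chosen_small (hR : Small N M R) (hM : 1 ≤ M) {tree : List (List ℕ)}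
    (hT : Small₂ K K M tree) (m : ℕ) :
    Small K M (chosen R W σ m tree).1 ∧ sz (chosen R W σ m tree).2 ≤ M := by
  by_cases h : candidates R σ m tree = []
  · rw [chosen, h, pick_nil]
    exact ⟨⟨by simp, by simp⟩, hM⟩
  · obtain ⟨h1, h2, -⟩ := mem_candidates.1 (pick_mem
      (fun a b => Nat.ble (slack W σ a) (slack W σ b)) h ([], 0))
    exact ⟨hT.2 _ h1, hR.2 _ h2⟩

/-- The size invariant of the steps of a phase. -/
structure SmallState (N B M k : ℕ) (s : List (List ℕ) × List (List ℕ) × List ℕ) : Prop where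
  matrix : Small₂ N N (B + 6 * k) s.1
  tree : Small₂ (k + 1) (k + 1) M s.2.1
  result : Small N M s.2.2

theorem SmallState.growTree {s : List (List ℕ) × List (List ℕ) × List ℕ}
    (h : SmallState N B M k s) (hB : 1 ≤ B) (hM : 1 ≤ M) (hR : Small N M R) (hσ : Small N M σ)
    (m : ℕ) : SmallState N B M (k + 1) (growTree R m σ s) := by
  have hT' := h.tree.mono (Nat.le_succ (k + 1)) (Nat.le_succ (k + 1)) le_rfl
  unfold PathFitting.growTree
  cases s.2.2.isEmpty
  · exact ⟨h.matrix.mono le_rfl le_rfl (by omega), hT', h.result⟩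
  · obtain ⟨h1, h2⟩ := chosen_small (W := s.1) (σ := σ) hR hM h.tree m
    rw [cond_true]
    have hW : Small₂ N N (B + 6 * (k + 1)) (tighten R s.1 σ m s.2.1) :=
      h.matrix.adjust (by omega) hR.1 _ _ (h.matrix.entry (by omega) _ _)
    cases Nat.blt (chosen R s.1 σ m s.2.1).2 m
    · exact ⟨hW, hT', hσ.augment hM hR.1 _⟩
    · refine ⟨hW, ⟨by simpa using h.tree.1, fun l hl => ?_⟩, ⟨by simp, by simp⟩⟩
      rcases List.mem_cons.1 hl with rfl | hl
      · refine ⟨by simpa using h1.1, fun a ha => ?_⟩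
        rcases List.mem_cons.1 ha with rfl | ha
        · exact h2
        · exact h1.2 a ha
      · exact hT'.2 l hl

theorem SmallState.foldl {W : List (List ℕ)} {m : ℕ} (hW : Small₂ N N B W) (hB : 1 ≤ B)
    (hM : 1 ≤ M) (hm : sz m ≤ M) (hR : Small N M R) (hσ : Small N M σ) (l : List ℕ) :
    SmallState N B M l.length
      (l.foldl (fun st _ => PathFitting.growTree R m σ st) (W, [[m]], [])) := by
  induction l using List.reverseRecOn with
  | nil =>
    refine ⟨hW, ⟨by simp, fun l hl => ?_⟩, ⟨by simp, by simp⟩⟩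
    obtain rfl := List.mem_singleton.1 hl
    exact ⟨by simp, by simpa using hm⟩
  | append_singleton l a ih =>
    rw [List.foldl_append, List.length_append]
    exact ih.growTree hB hM hR hσ m

theorem SmallState.sz_le {s : List (List ℕ) × List (List ℕ) × List ℕ}
    (h : SmallState N N N k s) (hk : k ≤ N) :
    sz s ≤ 3 * ((N + 1) * ((N + 1) * (7 * N + 1) + 2) + 3) := by
  obtain ⟨W, tree, res⟩ := s
  have h1 := (h.matrix.mono (show N ≤ N + 1 by omega) (show N ≤ N + 1 by omega) (show _ ≤ 7 * N by omega)).sz_le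
  have h2 := (h.tree.mono (show _ ≤ N + 1 by omega) (show _ ≤ N + 1 by omega)
    (show _ ≤ 7 * N by omega)).sz_le
  have h3 := (h.result.mono (show N ≤ N + 1 by omega) (show _ ≤ 7 * N by omega)).sz_le
  have h4 : (N + 1) * ((N + 1) * (7 * N + 1) + 1 + 1) =
    (N + 1) * ((N + 1) * (7 * N + 1) + 2) := rfl
  have h5 : (N + 1) * (7 * N + 1) + 1 ≤ (N + 1) * ((N + 1) * (7 * N + 1) + 2) + 1 := by
    nlinarith [Nat.zero_le N]
  simp only [sz_mk] at h1 h2 h3 ⊢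
  omega

/-- A phase adds a fixed number of symbols to the bound for the entries instead of multiplying it.
Over all phases the growth is therefore polynomial. -/
theorem phase_small {s : List (List ℕ) × List ℕ} {m : ℕ} (hW : Small₂ N N B s.1) (hB : 1 ≤ B)
    (hM : 1 ≤ M) (hm : sz m ≤ M) (hR : Small N M R) (hσ : Small N M s.2) :
    Small₂ N N (B + 6 * R.length) (phase R s m).1 ∧ Small N M (phase R s m).2 :=
  have h := SmallState.foldl hW hB hM hm hR hσ R
  ⟨h.matrix, h.result⟩

end Bounds

namespace PT

@[fun_prop]
theorem entry {W : γ → List (List ℕ)} {i j : γ → ℕ} (hW : PT W) (hi : PT i) (hj : PT j) :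
    PT fun x => entry (W x) (i x) (j x) := by
  unfold PathFitting.entry; fun_prop

@[fun_prop]
theorem treeCols {σ : γ → List ℕ} {m : γ → ℕ} {tree : γ → List (List ℕ)} (hσ : PT σ) (hm : PT m)
    (ht : PT tree) : PT fun x => treeCols (σ x) (m x) (tree x) := by
  unfold PathFitting.treeCols; fun_prop

@[fun_prop]
theorem candidates {R σ : γ → List ℕ} {m : γ → ℕ} {tree : γ → List (List ℕ)} (hR : PT R)
    (hσ : PT σ) (hm : PT m) (ht : PT tree) :
    PT fun x => candidates (R x) (σ x) (m x) (tree x) := by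
  unfold PathFitting.candidates; fun_prop

@[fun_prop]
theorem slack {W : γ → List (List ℕ)} {σ : γ → List ℕ} {c : γ → List ℕ × ℕ} (hW : PT W)
    (hσ : PT σ) (hc : PT c) : PT fun x => slack (W x) (σ x) (c x) := by
  unfold PathFitting.slack; fun_prop

@[fun_prop]
theorem chosen {R σ : γ → List ℕ} {m : γ → ℕ} {W tree : γ → List (List ℕ)} (hR : PT R)
    (hW : PT W) (hσ : PT σ) (hm : PT m) (ht : PT tree) :
    PT fun x => chosen (R x) (W x) (σ x) (m x) (tree x) := by
  unfold PathFitting.chosen; fun_prop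

@[fun_prop]
theorem adjust {R S T : γ → List ℕ} {δ : γ → ℕ} {W : γ → List (List ℕ)} (hR : PT R)
    (hW : PT W) (hS : PT S) (hT : PT T) (hδ : PT δ) :
    PT fun x => adjust (R x) (W x) (S x) (T x) (δ x) := by
  unfold PathFitting.adjust; fun_prop

@[fun_prop]
theorem tighten {R σ : γ → List ℕ} {m : γ → ℕ} {W tree : γ → List (List ℕ)} (hR : PT R)
    (hW : PT W) (hσ : PT σ) (hm : PT m) (ht : PT tree) :
    PT fun x => tighten (R x) (W x) (σ x) (m x) (tree x) := by
  unfold PathFitting.tighten; fun_prop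

@[fun_prop]
theorem swapAt {R σ : γ → List ℕ} {a b : γ → ℕ} (hR : PT R) (hσ : PT σ) (ha : PT a) (hb : PT b) :
    PT fun x => swapAt (R x) (σ x) (a x) (b x) := by
  unfold PathFitting.swapAt; fun_prop

@[fun_prop]
theorem augment {R σ p : γ → List ℕ} (hR : PT R) (hσ : PT σ) (hp : PT p) :
    PT fun x => augment (R x) (σ x) (p x) := by
  unfold PathFitting.augment
  refine foldl_of_bdd (γ := γ)
    (step := fun x σ b => PathFitting.swapAt (R x) σ ((p x).headD 0) b) (init := σ)
    (by fun_prop) hσ (by fun_prop)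
    (G := fun x => (sz (R x) + sz (σ x)) * (sz (R x) + sz (σ x) + 1) + 1)
    (((hR.sz_bdd.add hσ.sz_bdd).mul ((hR.sz_bdd.add hσ.sz_bdd).add (.const _ 1))).add (.const _ 1))
    fun x l _ => ?_
  refine Small.sz_le ?_
  have h1 : Small (sz (R x) + sz (σ x)) (sz (R x) + sz (σ x)) (σ x) :=
    Small.of_sz_le (Nat.le_add_left _ _)
  have h2 : (R x).length ≤ sz (R x) + sz (σ x) :=
    (length_lt_sz _).le.trans (Nat.le_add_right _ _)
  have h3 : 1 ≤ sz (R x) + sz (σ x) := (sz_pos (R x)).trans (Nat.le_add_right _ _)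
  exact h1.augment h3 h2 ((p x).headD 0 :: l)

@[fun_prop]
theorem growTree {R σ : γ → List ℕ} {m : γ → ℕ}
    {s : γ → List (List ℕ) × List (List ℕ) × List ℕ} (hR : PT R)
    (hm : PT m) (hσ : PT σ) (hs : PT s) :
    PT fun x => growTree (R x) (m x) (σ x) (s x) := by
  unfold PathFitting.growTree; fun_prop

@[fun_prop]
theorem growTrees {R : γ → List ℕ} {m : γ → ℕ} {s : γ → List (List ℕ) × List ℕ} (hR : PT R)
    (hm : PT m) (hs : PT s) : PT fun x => growTrees (R x) (m x) (s x) := by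
  unfold PathFitting.growTrees
  have hN : PolyBdd sz fun x => sz (R x) + sz (m x) + sz (s x) :=
    (hR.sz_bdd.add hm.sz_bdd).add hs.sz_bdd
  refine foldl_of_bdd (γ := γ) (step := fun x st _ => PathFitting.growTree (R x) (m x) (s x).2 st)
    (init := fun x => ((s x).1, [[m x]], [])) (by fun_prop) (by fun_prop) hR
    (G := fun x => 3 * ((sz (R x) + sz (m x) + sz (s x) + 1) *
      ((sz (R x) + sz (m x) + sz (s x) + 1) * (7 * (sz (R x) + sz (m x) + sz (s x)) + 1) + 2) + 3))
    ((PolyBdd.const _ 3).mul (((hN.add (.const _ 1)).mul (((hN.add (.const _ 1)).mul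
      (hN.const_mul_add _ _)).add (.const _ 2))).add (.const _ 3))) fun x l hl => ?_
  have h1 := sz_mk (s x).1 (s x).2
  rw [Prod.mk.eta] at h1
  have h2 := sz_pos (R x)
  have h3 := length_lt_sz (R x)
  have h4 := hl.length_le
  exact (SmallState.foldl (Small₂.of_sz_le (by omega)) (by omega) (by omega) (by omega)
    (Small.of_sz_le (by omega)) (Small.of_sz_le (by omega)) l).sz_le (by omega)

@[fun_prop]
theorem phase {R : γ → List ℕ} {m : γ → ℕ} {s : γ → List (List ℕ) × List ℕ} (hR : PT R)
    (hs : PT s) (hm : PT m) : PT fun x => phase (R x) (s x) (m x) := by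
  unfold PathFitting.phase; fun_prop

@[fun_prop]
theorem hungarian {W : γ → List (List ℕ)} (hW : PT W) : PT fun x => hungarian (W x) := by
  have hR : PT fun x => List.range (W x).length := by fun_prop
  have hN : PolyBdd sz fun x => sz (List.range (W x).length) + sz (W x) :=
    hR.sz_bdd.add hW.sz_bdd
  refine snd (foldl_of_bdd (γ := γ)
    (step := fun x st m => PathFitting.phase (List.range (W x).length) st m)
    (init := fun x => (W x, List.range (W x).length)) (by fun_prop) (by fun_prop) hR
    (G := fun x => 2 * ((sz (List.range (W x).length) + sz (W x)) *
      ((sz (List.range (W x).length) + sz (W x)) * ((sz (List.range (W x).length) + sz (W x)) + 6 *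
        ((sz (List.range (W x).length) + sz (W x)) * (sz (List.range (W x).length) + sz (W x))) + 1)
          + 2) + 3))
    ((PolyBdd.const _ 2).mul ((hN.mul ((hN.mul ((hN.add ((PolyBdd.const _ 6).mul
      (hN.mul hN))).add (.const _ 1))).add (.const _ 2))).add (.const _ 3))) fun x l hl => ?_)
  have h0 : ∀ m ∈ List.range (W x).length, sz m ≤ sz (List.range (W x).length) := fun m hm =>
    (sz_le_of_mem hm).le
  have h2 := sz_pos (W x)
  have h3 := length_lt_sz (List.range (W x).length)
  generalize List.range (W x).length = R at *
  generalize hNN : sz R + sz (W x) = N at *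
  -- With `N` bounding the input, the entries grow by at most `6 * N` per phase, hence by at most `6
  -- * (N * N)` altogether.
  have h : ∀ l : List ℕ, (∀ m ∈ l, m ∈ R) →
      Small₂ N N (N + 6 * (l.length * N))
        (l.foldl (fun st m => PathFitting.phase R st m) (W x, R)).1 ∧
      Small N N (l.foldl (fun st m => PathFitting.phase R st m) (W x, R)).2 := by
    intro l
    induction l using List.reverseRecOn with
    | nil => exact fun _ => ⟨(Small₂.of_sz_le (N := N)
        (by simp only [List.foldl_nil]; omega)).mono le_rfl le_rfl (by omega),
        Small.of_sz_le (by simp only [List.foldl_nil]; omega)⟩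
    | append_singleton l m ih =>
      intro hl
      obtain ⟨ih1, ih2⟩ := ih fun a ha => hl a (by simp [ha])
      have hm := h0 m (hl m (by simp))
      obtain ⟨h5, h6⟩ := phase_small (R := R) (m := m) ih1 (by omega) (by omega)
        (hm.trans (by omega)) (Small.of_sz_le (by omega)) ih2
      rw [List.foldl_append, List.length_append, List.length_singleton, add_mul, one_mul]
      exact ⟨h5.mono le_rfl le_rfl (by omega), h6⟩
  obtain ⟨h5, h6⟩ := h l fun m hm => hl.subset hm
  have h7 : l.length * N ≤ N * N := Nat.mul_le_mul_right _ (hl.length_le.trans (by omega))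
  have h8 := (h5.mono le_rfl le_rfl (show _ ≤ N + 6 * (N * N) by omega)).sz_le
  have h9 := (h6.mono le_rfl (show _ ≤ N + 6 * (N * N) by omega)).sz_le
  generalize List.foldl (fun st m => PathFitting.phase R st m) (W x, R) l = s at *
  have h10 := sz_mk s.1 s.2
  rw [Prod.mk.eta] at h10
  have h11 : N * (N + 6 * (N * N) + 1) + 1 ≤ N * (N * (N + 6 * (N * N) + 1) + 2) + 1 := by
    have : 1 ≤ N := by omega
    generalize N + 6 * (N * N) + 1 = z
    nlinarith [Nat.mul_le_mul this (le_refl (N * z))]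
  have h12 : N * (N * (N + 6 * (N * N) + 1) + 1 + 1) + 1 =
    N * (N * (N + 6 * (N * N) + 1) + 2) + 1 := rfl
  omega

end PT

end Sizes

/-! ## Input and output -/

section Conversion

variable {ι : Type} [DecidableEq ι] {env : ι → List Sym → List Sym → ℕ → Prop}

/-- The part of the tree code of a list that corresponds to a symbol of its binary code. -/
def symCode : Sym → List Sym
  | .zero => .one :: str false
  | .one => .one :: str true
  | .sep => [.zero, .one]

/-- The loop of `readIn`. -/
def readLoop : Prog ι :=
  .loop 2 none (.seq (.ite 2 (some .zero) (pushWord (symCode .zero))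
    (.ite 2 (some .one) (pushWord (symCode .one)) (pushWord (symCode .sep)))) (.pop 2))

/-- Turn the reversed binary code of a list on stack `2` into a tree code on stack `0`. -/
def readIn : Prog ι :=
  .seq (.push 0 .zero) (.seq (.push 0 .zero) (.seq readLoop (.push 0 .one)))

theorem steps_readLoop (u : List Sym) : ∀ a : List Sym,
    Steps env readLoop (quad a [] u []) (quad (u.reverse.flatMap symCode ++ a) [] [] [])
      (11 * u.length + 1) 0 := by
  induction u with
  | nil => exact fun a => Steps.loop_done rfl
  | cons x u ih =>
    intro a
    have h1 : Steps env (.ite 2 (some .zero) (pushWord (symCode .zero))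
        (.ite 2 (some .one) (pushWord (symCode .one)) (pushWord (symCode .sep))))
        (quad a [] (x :: u) []) (quad (symCode x ++ a) [] (x :: u) []) 9 0 := by
      cases x
      · exact Steps.mono (Steps.ite_pos (by simp) (steps_pushWord _ _ _ _ _)) (by decide)
      · exact Steps.mono (Steps.ite_neg (by simp) (Steps.ite_pos (by simp)
          (steps_pushWord _ _ _ _ _))) (by decide)
      · exact Steps.mono (Steps.ite_neg (by simp) (Steps.ite_neg (by simp)
          (steps_pushWord _ _ _ _ _))) (by decide)
    have h2 := Steps.loop_step₀ (by simp) (h1.seq₀ (steps_pop_two _ _ _ _ _))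
      (ih (symCode x ++ a))
    simpa [readLoop] using h2.mono (show _ ≤ 11 * (x :: u).length + 1 by simp; omega)

theorem str_nat_eq (m : ℕ) : str m ++ [.one] = (encodeNat m).flatMap symCode := by
  have h : ∀ l : List Bool, str l ++ [.one] =
      (l.map (fun b => if b then Sym.one else Sym.zero) ++ [Sym.sep]).flatMap symCode := by
    intro l
    induction l with
    | nil => rfl
    | cons b l ih =>
      rw [str_cons, List.cons_append, List.append_assoc, ih]
      cases b <;> simp [symCode]
  exact h m.bits

/-- A separator closes one number and at the same time opens the next cell of the list. After the
last separator an extra cell is thus open, which `readIn` closes as the number `0`. This is the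
origin of the trailing `[0]` on everything that is read, including all subroutine answers. -/
theorem str_append_zero (l : List ℕ) :
    str (l ++ [0]) = .one :: ((encode l).flatMap symCode ++ [.zero, .zero]) := by
  induction l with
  | nil => rfl
  | cons m l ih =>
    have : encode (m :: l) = encodeNat m ++ encode l := by simp [encode]
    rw [List.cons_append, str_cons, ih, this, List.flatMap_append, ← str_nat_eq]
    simp

theorem sz_le_length_encode (l : List ℕ) : sz (l ++ [0]) ≤ 6 * (encode l).length + 3 := by
  have h : ∀ u : List Sym, (u.flatMap symCode).length ≤ 6 * u.length := by
    intro u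
    induction u with
    | nil => simp
    | cons x u ih =>
      rw [List.flatMap_cons, List.length_append, List.length_cons]
      have : (symCode x).length ≤ 6 := by cases x <;> decide
      omega
  rw [sz, str_append_zero, List.length_cons, List.length_append]
  have := h (encode l)
  simp only [List.length_cons, List.length_nil]
  omega

theorem length_encode_le_sz (l : List ℕ) : (encode l).length ≤ sz l := by
  induction l with
  | nil => simp [encode]
  | cons m l ih =>
    have : encode (m :: l) = encodeNat m ++ encode l := by simp [encode]
    rw [this, List.length_append, sz_cons, sz_nat]
    have : (encodeNat m).length = m.size + 1 := by simp [encodeNat, Nat.size_eq_bits_len]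
    omega

theorem steps_readIn (l : List ℕ) (rest : List Sym) :
    Steps env readIn (quad rest [] (encode l).reverse []) (quad (str (l ++ [0]) ++ rest) [] [] [])
      (11 * (encode l).length + 4) 0 := by
  have h := (steps_push_zero (env := env) rest [] (encode l).reverse [] .zero).seq₀
    ((steps_push_zero _ _ _ _ .zero).seq₀ ((steps_readLoop _ _).seq₀
      (steps_push_zero _ _ _ _ .one)))
  rw [str_append_zero]
  simp only [List.reverse_reverse, List.length_reverse] at h
  simpa [readIn] using h.mono (show _ ≤ 11 * (encode l).length + 4 by omega)

/-- Write the digits of the number on top of stack `0` onto stack `2`. -/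
def writeBits : Prog ι :=
  .loop 0 (some .zero) (.seq (.pop 0) (.seq (.pop 0)
    (.seq (.ite 0 (some .zero) (.push 2 .zero) (.push 2 .one))
      (.seq (.pop 0) (.seq (.pop 0) (.seq (.pop 0) (.pop 0)))))))

/-- Write the binary code of the list on top of stack `0`, reversed, onto stack `2`. -/
def writeOut : Prog ι :=
  .seq (.loop 0 (some .zero) (.seq (.pop 0) (.seq writeBits (.seq (.pop 0) (.push 2 .sep)))))
    (.pop 0)

theorem steps_writeBits (l : List Bool) (rest : List Sym) : ∀ c : List Sym,
    Steps env writeBits (quad (str l ++ rest) [] c [])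
      (quad (.zero :: rest) [] ((l.map fun b => if b then Sym.one else Sym.zero).reverse ++ c) [])
      (10 * l.length + 1) 0 := by
  induction l with
  | nil => exact fun c => Steps.loop_done rfl
  | cons b l ih =>
    intro c
    have h := ih ((if b then Sym.one else Sym.zero) :: c)
    have h1 : Steps env (.seq (.pop 0) (.seq (.pop 0)
        (.seq (.ite 0 (some .zero) (.push 2 .zero) (.push 2 .one))
          (.seq (.pop 0) (.seq (.pop 0) (.seq (.pop 0) (.pop 0)))))))
        (quad (str (b :: l) ++ rest) [] c [])
        (quad (str l ++ rest) [] ((if b then Sym.one else Sym.zero) :: c) []) 9 0 := by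
      cases b <;> simp only [str_cons, str_true, str_false, List.cons_append, List.nil_append]
      · exact Steps.mono ((steps_pop_zero _ _ _ _ _).seq₀ ((steps_pop_zero _ _ _ _ _).seq₀
          ((Steps.ite_pos (by simp) (steps_push_two _ _ _ _ _)).seq₀
            ((steps_pop_zero _ _ _ _ _).seq₀ ((steps_pop_zero _ _ _ _ _).seq₀
              ((steps_pop_zero _ _ _ _ _).seq₀ (steps_pop_zero _ _ _ _ _))))))) (by decide)
      · exact Steps.mono ((steps_pop_zero _ _ _ _ _).seq₀ ((steps_pop_zero _ _ _ _ _).seq₀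
          ((Steps.ite_neg (by simp) (steps_push_two _ _ _ _ _)).seq₀
            ((steps_pop_zero _ _ _ _ _).seq₀ ((steps_pop_zero _ _ _ _ _).seq₀
              ((steps_pop_zero _ _ _ _ _).seq₀ (steps_pop_zero _ _ _ _ _))))))) (by decide)
    have h2 := Steps.loop_step₀ (by simp [str_cons]) h1 h
    simpa [writeBits] using h2.mono (show _ ≤ 10 * (b :: l).length + 1 by simp; omega)

theorem steps_writeOut (l : List ℕ) (rest c : List Sym) :
    Steps env writeOut (quad (str l ++ rest) [] c [])
      (quad rest [] ((encode l).reverse ++ c) []) (10 * (encode l).length + 2) 0 := by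
  have h : ∀ (l : List ℕ) (c : List Sym), Steps env (.loop 0 (some .zero)
      (.seq (.pop 0) (.seq writeBits (.seq (.pop 0) (.push 2 .sep)))))
      (quad (str l ++ rest) [] c []) (quad (.zero :: rest) [] ((encode l).reverse ++ c) [])
      (10 * (encode l).length + 1) 0 := by
    intro l
    induction l with
    | nil => exact fun c => Steps.loop_done rfl
    | cons m l ih =>
      intro c
      have he : encode (m :: l) = encodeNat m ++ encode l := by simp [encode]
      have hm : str (m :: l) ++ rest = .one :: (str m.bits ++ (str l ++ rest)) := by
        simp [str_cons, str_nat]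
      have h1 := (steps_pop_zero (env := env) (str m.bits ++ (str l ++ rest)) [] c [] .one).seq₀
        ((steps_writeBits m.bits _ c).seq₀ ((steps_pop_zero _ _ _ _ _).seq₀
          (steps_push_two _ _ _ _ .sep)))
      have h2 := Steps.loop_step₀ (by simp) h1 (ih _)
      rw [hm, he]
      have h3 : (encodeNat m).length = m.bits.length + 1 := by simp [encodeNat]
      have h4 := h2.mono (show _ ≤ 10 * (encodeNat m ++ encode l).length + 1 by
        rw [List.length_append, h3]; omega)
      simpa [encodeNat] using h4
  exact ((h l c).seq₀ (steps_pop_zero _ _ _ _ _)).mono (by omega)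

/-- A polynomial time function of lists of numbers is computed by a program that reads and writes
binary codes. -/
theorem PT.exists_exec {F : List ℕ → List ℕ} (hF : PT F) :
    ∃ (p : Prog Empty) (T : List ℕ → ℕ), PolyBdd (fun l => (encode l).length) T ∧
      ∀ l, ∃ T' ≤ T l, Exec p (encode l) (encode (F l)) T' := by
  -- The trailing `0` produced by reading is removed before `F` is applied.
  have hF' : PT fun l : List ℕ => F l.dropLast := by fun_prop
  have hsz := hF'.sz_bdd
  obtain ⟨p, T, hT, hp⟩ := hF'
  have hs : PolyBdd (fun l : List ℕ => (encode l).length) fun l => sz (l ++ [0]) :=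
    ((PolyBdd.self _).const_mul_add 6 3).mono sz_le_length_encode
  have hT' : PolyBdd (fun l : List ℕ => (encode l).length) fun l => T (l ++ [0]) :=
    (hT.comp fun l : List ℕ => l ++ [0]).trans hs
  have hsz' : PolyBdd (fun l : List ℕ => (encode l).length) fun l => sz (F l) :=
    ((hsz.comp fun l : List ℕ => l ++ [0]).trans hs).mono fun l => by simp
  refine ⟨.seq (moveAll 0 2) (.seq readIn (.seq (p Empty) (.seq writeOut (moveAll 2 0)))),
    fun l => (5 * (encode l).length + 1) + ((11 * (encode l).length + 4) + (T (l ++ [0]) +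
      ((10 * sz (F l) + 2) + (5 * sz (F l) + 1)))),
    ((PolyBdd.self _).const_mul_add _ _).add (((PolyBdd.self _).const_mul_add _ _).add (hT'.add
      ((hsz'.const_mul_add _ _).add (hsz'.const_mul_add _ _)))), fun l => ?_⟩
  have h1 := steps_readIn (env := fun j : Empty => j.elim) l []
  have h2 := hp Empty (fun j => j.elim) (l ++ [0]) []
  have h3 := steps_writeOut (env := fun j : Empty => j.elim) (F l) [] []
  have h4 := steps_move_zero_two (env := fun j : Empty => j.elim) (encode l) [] [] []
  have h5 := steps_move_two_zero (env := fun j : Empty => j.elim) [] [] (encode (F l)).reverse []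
  simp only [List.append_nil, List.dropLast_concat, List.reverse_reverse, List.length_reverse]
    at h1 h2 h3 h4 h5
  obtain ⟨T', hT', h⟩ := h4.seq₀ (h1.seq₀ (h2.seq₀ (h3.seq₀ h5)))
  refine ⟨T', hT'.trans ?_, _, _, (initStore_eq _).symm ▸ h, rfl⟩
  have := length_encode_le_sz (F l)
  dsimp only
  omega

end Conversion

/-! ## The matching program -/

theorem length_seqCode {m c : ℕ} {f : Fin m → List ℕ} (hf : ∀ i, (f i).length = c) :
    (seqCode f).length = m * c := by
  simp [seqCode, List.length_flatten, List.map_ofFn, Function.comp_def, hf]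

/-- Blocks of constant length allow random access. Every rational takes exactly three numbers, so
the positions in nested codes are computable. -/
theorem getD_seqCode {m c : ℕ} {f : Fin m → List ℕ} (hf : ∀ i, (f i).length = c) {i r : ℕ}
    (hi : i < m) (hr : r < c) : (seqCode f).getD (c * i + r) 0 = (f ⟨i, hi⟩).getD r 0 := by
  induction m generalizing i with
  | zero => omega
  | succ m ih =>
    have h : seqCode f = f 0 ++ seqCode fun i => f i.succ := by simp [seqCode, List.ofFn_succ]
    rw [h]
    cases i with
    | zero =>
      rw [List.getD_append _ _ _ _ (by rw [hf]; omega)]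
      simp
    | succ i =>
      rw [List.getD_append_right _ _ _ _ (by rw [hf]; nlinarith), hf,
        show c * (i + 1) + r - c = c * i + r by rw [mul_add, mul_one]; omega,
        ih (fun i => hf i.succ) (by omega)]
      rfl

/-! ### Reduction of rational to natural weights -/

section MatchingFunction

variable {γ : Type} [Code γ]

theorem sz_mul_le (a b : ℕ) : sz (a * b) ≤ sz a + sz b := by
  simp only [sz_nat]
  have h : (a * b).size ≤ a.size + b.size := by
    rw [Nat.size_le, pow_add]
    exact Nat.mul_lt_mul'' (Nat.lt_size_self a) (Nat.lt_size_self b)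
  omega

@[fun_prop]
theorem PT.sum {l : γ → List ℕ} (hl : PT l) : PT fun x => (l x).sum := by
  refine (foldl (γ := γ) (step := fun _ n b => n + b) (init := fun _ => 0) (by fun_prop)
    (by fun_prop) hl (bdd_sz.add (.const _ 6)) fun x a b => ?_).of_eq fun x =>
      List.sum_eq_foldl.symm
  have := sz_add_le (show sz a ≤ sz a + sz b by omega) (show sz b ≤ sz a + sz b by omega)
  rw [sz_mk]; omega

@[fun_prop]
theorem PT.prod {l : γ → List ℕ} (hl : PT l) : PT fun x => (l x).prod := by
  refine (foldl (γ := γ) (step := fun _ n b => n * b) (init := fun _ => 1) (by fun_prop)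
    (by fun_prop) hl bdd_sz fun x a b => ?_).of_eq fun x =>
      List.prod_eq_foldl.symm
  have := sz_mul_le a b
  rw [sz_mk]; omega

/-- The numbers below `n`, provided that `n` is at most the length of `L`. -/
def below (L : List ℕ) (n : ℕ) : List ℕ := (List.range L.length).filter fun i => Nat.blt i n

/-- In a coded matrix or instance the relevant dimension does not exceed the length of the whole
code, which makes its range available in polynomial time. -/
theorem below_eq {L : List ℕ} {n : ℕ} (h : n ≤ L.length) : below L n = List.range n := by
  obtain ⟨k, hk⟩ := Nat.exists_eq_add_of_le h
  have h1 : ∀ i ∈ List.range n, Nat.blt i n = true := fun i hi => by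
    rw [Nat.blt_eq]; exact List.mem_range.1 hi
  have h2 : ∀ i ∈ List.map (fun x => n + x) (List.range k), ¬Nat.blt i n = true := fun i hi => by
    obtain ⟨a, -, rfl⟩ := List.mem_map.1 hi
    rw [Nat.blt_eq]; omega
  rw [below, hk, List.range_add, List.filter_append, List.filter_eq_self.2 h1,
    List.filter_eq_nil_iff.2 h2, List.append_nil]

@[fun_prop]
theorem PT.below {L : γ → List ℕ} {n : γ → ℕ} (hL : PT L) (hn : PT n) :
    PT fun x => below (L x) (n x) := by
  unfold PathFitting.below; fun_prop

/-- The rows and columns of a coded matrix. -/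
def rows (L : List ℕ) : List ℕ := below L (L.getD 0 0)

/-- The component `e` of the entry `(i, j)` of a coded matrix. -/
def weightAt (L : List ℕ) (e i j : ℕ) : ℕ := L.getD ((L.getD 0 0 * 3) * i + (3 * j + e) + 1) 0

/-- The positions of the entries of a coded matrix. -/
def positions (L : List ℕ) : List (ℕ × ℕ) := (rows L).flatMap fun i => (rows L).map fun j => (i, j)

/-- The numerator over the common denominator of all entries. -/
def scaled (L : List ℕ) (i j : ℕ) : ℕ :=
  weightAt L 1 i j * (((positions L).filter fun a => !(Nat.beq a.1 i && Nat.beq a.2 j)).map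
    fun a => weightAt L 2 a.1 a.2).prod

/-- A shift that makes all entries nonnegative. -/
def shift (L : List ℕ) : ℕ := ((positions L).map fun a => scaled L a.1 a.2).sum

/-- The scaled and shifted matrix. -/
def natWeights (L : List ℕ) : List (List ℕ) :=
  (rows L).map fun i => (rows L).map fun j =>
    bif Nat.beq (weightAt L 0 i j) 0 then shift L + scaled L i j else shift L - scaled L i j

/-- A minimum weight perfect matching for a coded matrix. -/
def solveMatching (L : List ℕ) : List ℕ :=
  (rows L).map fun i => (hungarian (natWeights L)).getD i 0

@[fun_prop]
theorem PT.rows {L : γ → List ℕ} (hL : PT L) : PT fun x => rows (L x) := by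
  unfold PathFitting.rows; fun_prop

@[fun_prop]
theorem PT.weightAt {L : γ → List ℕ} {e i j : γ → ℕ} (hL : PT L) (he : PT e) (hi : PT i)
    (hj : PT j) : PT fun x => weightAt (L x) (e x) (i x) (j x) := by
  unfold PathFitting.weightAt; fun_prop

@[fun_prop]
theorem PT.positions {L : γ → List ℕ} (hL : PT L) : PT fun x => positions (L x) := by
  unfold PathFitting.positions; fun_prop

@[fun_prop]
theorem PT.scaled {L : γ → List ℕ} {i j : γ → ℕ} (hL : PT L) (hi : PT i)
    (hj : PT j) : PT fun x => scaled (L x) (i x) (j x) := by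
  unfold PathFitting.scaled; fun_prop

@[fun_prop]
theorem PT.shift {L : γ → List ℕ} (hL : PT L) : PT fun x => shift (L x) := by
  unfold PathFitting.shift; fun_prop

theorem PT.solveMatching : PT solveMatching := by
  unfold PathFitting.solveMatching natWeights; fun_prop

end MatchingFunction

/-! ### Optimality of the computed matching -/

section MatchingCorrect

variable {n : ℕ} (w : Fin n → Fin n → ℚ)

theorem length_weightCode : (weightCode w).length = n * (n * 3) + 1 := by
  rw [weightCode, List.length_cons, length_seqCode (c := n * 3)]
  intro i
  rw [length_seqCode (c := 3)]
  intro j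
  rfl

theorem rows_weightCode : rows (weightCode w) = List.range n := by
  rw [rows]
  have h : (weightCode w).getD 0 0 = n := rfl
  rw [h, below_eq]
  rw [length_weightCode]
  rcases Nat.eq_zero_or_pos n with h | h
  · omega
  · exact (Nat.le_mul_of_pos_right n (by omega)).trans (Nat.le_succ _)

theorem weightAt_weightCode {e : ℕ} (he : e < 3) (i j : Fin n) :
    weightAt (weightCode w) e i j = (ratCode (w i j)).getD e 0 := by
  have h : (weightCode w).getD 0 0 = n := rfl
  rw [weightAt, h, weightCode, List.getD_cons_succ, getD_seqCode (c := n * 3) (i := i) ?_ i.2,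
    getD_seqCode (c := 3) (i := j) ?_ j.2 he]
  · intro j; rfl
  · have := j.2; omega
  · intro i
    rw [length_seqCode (c := 3)]
    intro j; rfl

theorem mem_positions {a : ℕ × ℕ} : a ∈ positions (weightCode w) ↔ a.1 < n ∧ a.2 < n := by
  obtain ⟨i, j⟩ := a
  simp [positions, rows_weightCode]

theorem nodup_positions : (positions (weightCode w)).Nodup := by
  rw [positions, rows_weightCode, ← List.product]
  exact List.nodup_range.product List.nodup_range

/-- The common denominator. -/
def commonDen : ℕ := ((positions (weightCode w)).map fun a => weightAt (weightCode w) 2 a.1 a.2).prod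

theorem commonDen_pos : 0 < commonDen w := by
  refine Nat.pos_of_ne_zero fun h => ?_
  rw [commonDen, List.prod_eq_zero_iff, List.mem_map] at h
  obtain ⟨⟨i, j⟩, h1, h2⟩ := h
  rw [mem_positions] at h1
  have := weightAt_weightCode w (e := 2) (by omega) ⟨i, h1.1⟩ ⟨j, h1.2⟩
  rw [h2] at this
  exact (w ⟨i, h1.1⟩ ⟨j, h1.2⟩).den_nz this.symm

/-- The product of all other denominators replaces division of the common denominator by the one at
hand, so only multiplication is needed. -/
theorem scaled_weightCode (i j : Fin n) :
    (scaled (weightCode w) i j : ℚ) = commonDen w * |w i j| := by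
  have h1 : (i.1, j.1) ∈ positions (weightCode w) := (mem_positions w).2 ⟨i.2, j.2⟩
  have h2 := List.prod_map_erase (fun a : ℕ × ℕ => weightAt (weightCode w) 2 a.1 a.2) h1
  have h3 : ((positions (weightCode w)).filter fun a => !(Nat.beq a.1 i && Nat.beq a.2 j)) =
      (positions (weightCode w)).erase (i.1, j.1) := by
    rw [(nodup_positions w).erase_eq_filter]
    congr 1
    funext a
    have hb : ∀ x y : ℕ, Nat.beq x y = decide (x = y) := fun x y => by
      rw [Bool.eq_iff_iff, Nat.beq_eq, decide_eq_true_eq]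
    rw [Bool.eq_iff_iff, hb, hb]
    simp only [Bool.not_eq_true', Bool.and_eq_false_iff, decide_eq_false_iff_not, bne_iff_ne, ne_eq,
      Prod.ext_iff]
    tauto
  rw [scaled, h3, commonDen, ← h2, weightAt_weightCode w (by omega), weightAt_weightCode w (by omega)]
  have h4 : (ratCode (w i j)).getD 1 0 = (w i j).num.natAbs := rfl
  have h5 : (ratCode (w i j)).getD 2 0 = (w i j).den := rfl
  rw [h4, h5]
  have h6 : |w i j| = ((w i j).num.natAbs : ℚ) / (w i j).den := by
    conv_lhs => rw [← Rat.num_div_den (w i j)]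
    rw [abs_div, Nat.abs_cast, Nat.cast_natAbs, Int.cast_abs]
  have h7 : ((w i j).den : ℚ) ≠ 0 := by exact_mod_cast (w i j).den_nz
  rw [h6, Nat.cast_mul, Nat.cast_mul]
  field_simp
  congr!

theorem scaled_le_shift (i j : Fin n) :
    scaled (weightCode w) i j ≤ shift (weightCode w) :=
  List.single_le_sum (by simp) _ (List.mem_map.2 ⟨(i.1, j.1), (mem_positions w).2 ⟨i.2, j.2⟩, rfl⟩)

/-- The natural weights are a positive multiple of the given ones plus a constant. The shift is the
sum of all scaled absolute values, so the subtraction for negative weights is exact. -/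
theorem entry_natWeights (i j : Fin n) :
    (entry (natWeights (weightCode w)) i j : ℚ) = shift (weightCode w) + commonDen w * w i j := by
  rw [natWeights, rows_weightCode, entry_map_range i.2 j.2, weightAt_weightCode w (by omega)]
  have h : (ratCode (w i j)).getD 0 0 = if w i j < 0 then 1 else 0 := rfl
  rw [h]
  have h1 := scaled_weightCode w i j
  split_ifs with h0
  · show ((shift (weightCode w) - scaled (weightCode w) i j : ℕ) : ℚ) = _
    rw [Nat.cast_sub (scaled_le_shift w i j), h1, abs_of_neg h0]
    ring
  · show ((shift (weightCode w) + scaled (weightCode w) i j : ℕ) : ℚ) = _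
    rw [Nat.cast_add, h1, abs_of_nonneg (not_lt.1 h0)]

theorem solveMatching_spec : ∃ σ : Equiv.Perm (Fin n),
    IsMinMatching (fun i j => (w i j : ℝ)) σ ∧ solveMatching (weightCode w) = matchingCode σ := by
  have hlen : (natWeights (weightCode w)).length = n := by
    rw [natWeights, List.length_map, rows_weightCode, List.length_range]
  obtain ⟨hσ, u, v, h1, h2⟩ := hungarian_spec (natWeights (weightCode w))
  rw [hlen] at hσ h1 h2
  let f : Fin n → Fin n := fun i =>
    ⟨(hungarian (natWeights (weightCode w))).getD i 0, hσ.1 i i.2⟩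
  have hf : Function.Injective f := fun a b hab =>
    Fin.ext (hσ.2 a a.2 b b.2 (by simpa [f] using hab))
  let σ : Equiv.Perm (Fin n) := Equiv.ofBijective f (Finite.injective_iff_bijective.1 hf)
  have hσf : ∀ i, ((σ i : Fin n) : ℕ) = (hungarian (natWeights (weightCode w))).getD i 0 :=
    fun i => rfl
  refine ⟨σ, fun σ' => ?_, ?_⟩
  · have hD : (0 : ℚ) < commonDen w := by exact_mod_cast commonDen_pos w
    -- The dual sum does not depend on the permutation: it equals the weight of `σ` and bounds that
    -- of `σ'` from below.
    have h3 : ∀ τ : Equiv.Perm (Fin n),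
        ∑ i : Fin n, ((u i + v (τ i) : ℤ) : ℚ) = ∑ i : Fin n, (u i : ℚ) + ∑ j : Fin n, (v j : ℚ) := by
      intro τ
      push_cast
      rw [Finset.sum_add_distrib, Equiv.sum_comp τ fun j => (v j : ℚ)]
    have h4 : ∀ τ : Equiv.Perm (Fin n),
        ∑ i : Fin n, (entry (natWeights (weightCode w)) i (τ i) : ℚ) =
          n * shift (weightCode w) + commonDen w * ∑ i, w i (τ i) := by
      intro τ
      simp only [entry_natWeights, Finset.sum_add_distrib, Finset.mul_sum]
      simp
    have h5 : ∑ i : Fin n, (entry (natWeights (weightCode w)) i (σ i) : ℚ) ≤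
        ∑ i : Fin n, (entry (natWeights (weightCode w)) i (σ' i) : ℚ) := by
      calc _ = ∑ i : Fin n, ((u i + v (σ i) : ℤ) : ℚ) :=
            Finset.sum_congr rfl fun i _ => by rw [hσf, h2 i i.2]; push_cast; rfl
        _ = ∑ i : Fin n, ((u i + v (σ' i) : ℤ) : ℚ) := by rw [h3, h3]
        _ ≤ _ := Finset.sum_le_sum fun i _ => by exact_mod_cast h1 i i.2 _ (σ' i).2
    rw [h4, h4] at h5
    have h6 : ∑ i, w i (σ i) ≤ ∑ i, w i (σ' i) := by nlinarith
    show ∑ i, (w i (σ i) : ℝ) ≤ ∑ i, (w i (σ' i) : ℝ)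
    exact_mod_cast h6
  · rw [solveMatching, rows_weightCode, matchingCode]
    apply List.ext_getElem
    · simp
    · intro i h3 h4
      simp [hσf]

end MatchingCorrect

theorem exists_solvesMatching : ∃ M : Prog Empty, SolvesMatching M := by
  obtain ⟨p, T, ⟨e, he⟩, hp⟩ := PT.solveMatching.exists_exec
  refine ⟨p, (Polynomial.X + 2) ^ e, fun n w => ?_⟩
  obtain ⟨σ, h1, h2⟩ := solveMatching_spec w
  obtain ⟨T', h3, h4⟩ := hp (weightCode w)
  rw [h2] at h4
  exact ⟨σ, T', h1, h4, (h3.trans (he _)).trans (by simp)⟩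

/-! ## Programs with calls -/

section Calls

variable {ι : Type} [DecidableEq ι] {env : ι → List Sym → List Sym → ℕ → Prop}

/-- Replace the list on top of stack `0` by the answer of the subroutine `j`. -/
def ask (j : ι) : Prog ι :=
  .seq writeOut (.seq (moveAll 2 1) (.seq (.call j 1) (.seq (moveAll 1 2) readIn)))

theorem steps_ask {j : ι} {q y : List ℕ} {T : ℕ} (h : env j (encode q) (encode y) T)
    (rest : List Sym) :
    Steps env (ask j) (quad (str q ++ rest) [] [] []) (quad (str (y ++ [0]) ++ rest) [] [] [])
      (16 * (encode q).length + T + 17 * (encode y).length + 9) (Pi.single j 1) := by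
  have h1 := steps_writeOut (env := env) q rest []
  have h2 := steps_move_two_one (env := env) rest [] (encode q).reverse []
  have h3 : Steps env (.call j 1) (quad rest (encode q) [] []) (quad rest (encode y) [] [])
      (T + (encode q).length + (encode y).length + 1) (Pi.single j 1) := by
    have : Run env (.call j 1) (quad rest (encode q) [] [])
        (Function.update (quad rest (encode q) [] []) 1 (encode y)) _ _ := .call h
    rw [update_quad_one] at this
    exact ⟨_, le_rfl, this⟩
  have h4 := steps_move_one_two (env := env) rest (encode y) [] []
  have h5 := steps_readIn (env := env) y rest
  simp only [List.append_nil, List.reverse_reverse, List.length_reverse] at h1 h2 h4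
  have h6 := h1.seq (h2.seq (h3.seq (h4.seq h5)))
  simp only [zero_add, add_zero] at h6
  exact h6.mono (by omega)

theorem str_mk_append {α β : Type} [Code α] [Code β] (a : α) (b : β) (rest : List Sym) :
    str (a, b) ++ rest = .one :: (str a ++ (str b ++ rest)) := by
  rw [str_mk, List.cons_append, List.append_assoc]

/-- The table of the answers to a list of queries. -/
def answerTable (ans : List ℕ → List ℕ) (qs : List (List ℕ)) : List (List ℕ × List ℕ) :=
  (qs.map fun q => (q, ans q ++ [0])).reverse

theorem sz_answerTable_le {ans : List ℕ → List ℕ} {qs : List (List ℕ)} {Z : ℕ} (hq : sz qs ≤ Z)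
    (ha : ∀ q ∈ qs, (encode (ans q)).length ≤ Z) :
    sz (answerTable ans qs) ≤ Z * (7 * Z + 5) + 1 := by
  refine (sz_le_of_forall (B := 7 * Z + 4) fun e he => ?_).trans ?_
  · rw [answerTable, List.mem_reverse, List.mem_map] at he
    obtain ⟨q, hqs, rfl⟩ := he
    have h1 := sz_le_of_mem hqs
    have h2 := sz_le_length_encode (ans q)
    have h3 := ha q hqs
    rw [sz_mk]
    omega
  · rw [answerTable, List.length_reverse, List.length_map]
    exact Nat.add_le_add_right (Nat.mul_le_mul_right _ ((length_lt_sz qs).le.trans hq)) _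

/-- There is a program that asks a list of queries and collects the answers. -/
theorem exists_askAll {γ : Type} [Code γ] : ∃ (p : ∀ ι : Type, ι → Prog ι) (G : ℕ → ℕ),
    PolyBdd id G ∧ ∀ (ι : Type) [DecidableEq ι] (env : ι → List Sym → List Sym → ℕ → Prop) (j : ι)
      (qs : List (List ℕ)) (ans : List ℕ → List ℕ) (x : γ) (Z : ℕ) (rest : List Sym),
      sz qs ≤ Z → sz x ≤ Z → (∀ q ∈ qs, (encode (ans q)).length ≤ Z ∧
        ∃ T ≤ Z, env j (encode q) (encode (ans q)) T) →
      Steps env (p ι j) (quad (str (qs, x) ++ rest) [] [] [])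
        (quad (str (answerTable ans qs, x) ++ rest) [] [] []) (G Z) (Pi.single j qs.length) := by
  have h0 : PT fun s : List (List ℕ) × γ =>
      (s.1, (([] : List (List ℕ × List ℕ)), s.2)) := by fun_prop
  have h1 : PT fun s : List (List ℕ) × (List (List ℕ × List ℕ) × γ) => (s.1.headD [], s) := by
    fun_prop
  have h2 : PT fun s : List ℕ × (List (List ℕ) × (List (List ℕ × List ℕ) × γ)) =>
      (s.2.1.tail, ((s.2.1.headD [], s.1) :: s.2.2.1, s.2.2.2)) := by fun_prop
  obtain ⟨p0, T0, ⟨e0, he0⟩, hp0⟩ := h0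
  obtain ⟨p1, T1, ⟨e1, he1⟩, hp1⟩ := h1
  obtain ⟨p2, T2, ⟨e2, he2⟩, hp2⟩ := h2
  -- `S Z` bounds every state: the table contributes the quadratic term, while the pending queries,
  -- the parameter and the current query or answer contribute linear ones. It depends on `Z` only,
  -- not on the subroutine.
  let S : ℕ → ℕ := fun Z => Z * (7 * Z + 5) + 10 * Z + 10
  have hid : PolyBdd (X := ℕ) id fun Z => Z := .self id
  have hS : PolyBdd id S :=
    ((hid.mul (hid.const_mul_add _ _)).add ((PolyBdd.const _ 10).mul hid)).add (.const _ 10)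
  let K : ℕ → ℕ := fun Z => (S Z + 2) ^ e1 + (S Z + 2) ^ e2 + (34 * Z + 14)
  have hK : PolyBdd id K :=
    (((hS.add (.const _ 2)).pow e1).add ((hS.add (.const _ 2)).pow e2)).add
      (hid.const_mul_add _ _)
  let body : ∀ ι : Type, ι → Prog ι := fun ι j => .seq (.push 0 .one) (.seq (p1 ι) (.seq (.pop 0)
    (.seq (ask j) (.seq (.push 0 .one) (.seq (p2 ι) (.pop 0))))))
  refine ⟨fun ι j => .seq (p0 ι) (.seq (.pop 0) (.seq (.loop 0 (some .zero) (body ι j)) (.pop 0))),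
    fun Z => (S Z + 2) ^ e0 + (1 + ((Z * (K Z + 1) + 1) + 1)),
    ((hS.add (.const _ 2)).pow e0).add ((PolyBdd.const _ 1).add (((hid.mul (hK.add
      (.const _ 1))).add (.const _ 1)).add (.const _ 1))), ?_⟩
  intro ι _ env j qs ans x Z rest hqs hx hans
  have hloop : ∀ l₂ l₁ : List (List ℕ), l₁ ++ l₂ = qs →
      Steps env (.loop 0 (some .zero) (body ι j))
        (quad (str l₂ ++ (str (answerTable ans l₁, x) ++ rest)) [] [] [])
        (quad (.zero :: (str (answerTable ans qs, x) ++ rest)) [] [] [])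
        (l₂.length * (K Z + 1) + 1) (Pi.single j l₂.length) := by
    intro l₂
    induction l₂ with
    | nil =>
      intro l₁ h
      rw [List.append_nil] at h
      rw [h]
      have := Steps.loop_done (env := env) (r := 0) (s := some .zero) (p := body ι j)
        (σ := quad (.zero :: (str (answerTable ans qs, x) ++ rest)) [] [] []) rfl
      simpa [str_nil] using this
    | cons q t ih =>
      intro l₁ h
      obtain ⟨ha, T, hT, hq⟩ := hans q (by rw [← h]; simp)
      have h1 := hp1 ι env (q :: t, (answerTable ans l₁, x)) rest
      have h2 := hp2 ι env (ans q ++ [0], (q :: t, (answerTable ans l₁, x))) rest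
      have hs1 : sz (q :: t, (answerTable ans l₁, x)) ≤ Z * (7 * Z + 5) + 2 * Z + 3 := by
        have k1 := sz_append l₁ (q :: t)
        rw [h] at k1
        have k2 := sz_pos l₁
        have k3 := sz_pos (q :: t)
        have k4 := sz_answerTable_le (ans := ans) (show sz l₁ ≤ Z by omega)
          fun q hq => (hans q (by rw [← h]; simp [hq])).1
        rw [sz_mk, sz_mk]
        omega
      have hs2 : sz (ans q ++ [0], (q :: t, (answerTable ans l₁, x))) ≤
          Z * (7 * Z + 5) + 8 * Z + 7 := by
        have := sz_le_length_encode (ans q)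
        rw [sz_mk]
        omega
      have ht1 : T1 (q :: t, (answerTable ans l₁, x)) ≤ (S Z + 2) ^ e1 :=
        (he1 _).trans (Nat.pow_le_pow_left (by simp only [S]; omega) _)
      have ht2 : T2 (ans q ++ [0], (q :: t, (answerTable ans l₁, x))) ≤ (S Z + 2) ^ e2 :=
        (he2 _).trans (Nat.pow_le_pow_left (by simp only [S]; omega) _)
      have hq' : (encode q).length ≤ Z := by
        have := length_encode_le_sz q
        have := sz_le_of_mem (show q ∈ qs by rw [← h]; simp)
        omega
      -- New answers are put in front, which is why the table lists the queries in reverse order.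
      have hacc : (q, ans q ++ [0]) :: answerTable ans l₁ = answerTable ans (l₁ ++ [q]) := by
        simp [answerTable]
      dsimp only [List.headD_cons, List.tail_cons] at h1 h2
      rw [hacc, str_mk_append (_ : List ℕ), str_mk_append (_ : List (List ℕ)) (_ : _ × _)] at h2
      rw [str_mk_append (_ : List ℕ), str_mk_append (_ : List (List ℕ)) (_ : _ × _)] at h1
      rw [str_mk_append (_ : List (List ℕ)) (_ : _ × _)] at h2
      have h3 : Steps env (body ι j) _ _ _ _ :=
        (steps_push_zero (str (q :: t) ++ (str (answerTable ans l₁, x) ++ rest)) [] [] [] .one).seq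
        (h1.seq ((steps_pop_zero _ _ _ _ _).seq ((steps_ask hq _).seq
        ((steps_push_zero _ _ _ _ .one).seq (h2.seq (steps_pop_zero _ _ _ _ _))))))
      have h4 := Steps.loop_step (s := some .zero) (r := 0) (by simp [str_cons]) h3
        (ih (l₁ ++ [q]) (by simpa using h))
      simp only [zero_add, add_zero, ← Pi.single_add] at h4
      rw [List.length_cons, Nat.add_comm t.length 1]
      refine h4.mono ?_
      rw [add_mul]
      simp only [K, body] at *
      omega
  have h1 := hp0 ι env (qs, x) rest
  have h2 := hloop qs [] rfl
  have h3 : T0 (qs, x) ≤ (S Z + 2) ^ e0 :=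
    (he0 _).trans (Nat.pow_le_pow_left (by rw [sz_mk]; simp only [S]; omega) _)
  dsimp only at h1
  rw [str_mk_append _ (_ : _ × _)] at h1
  have h4 := h1.seq ((steps_pop_zero _ _ _ _ _).seq (h2.seq (steps_pop_zero _ _ _ _ _)))
  simp only [zero_add, add_zero] at h4
  refine h4.mono ?_
  have h5 : qs.length * (K Z + 1) ≤ Z * (K Z + 1) :=
    Nat.mul_le_mul_right _ ((length_lt_sz qs).le.trans hqs)
  dsimp only
  omega

/-- Programs that first ask a list of queries, then ask one more query that depends on the answers,
and compute their output from all answers. -/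
theorem exists_callProgram {pre : List ℕ → List (List ℕ)}
    {mid : List (List ℕ × List ℕ) → List ℕ → List ℕ}
    {fin : List ℕ → List (List ℕ × List ℕ) → List ℕ → List ℕ} (hpre : PT pre)
    (hmid : PT fun s : List (List ℕ × List ℕ) × List ℕ => mid s.1 s.2)
    (hfin : PT fun s : List ℕ × (List (List ℕ × List ℕ) × List ℕ) => fin s.1 s.2.1 s.2.2) :
    ∃ (P : Prog Sub) (G : ℕ → ℕ), PolyBdd id G ∧
      ∀ (env : Sub → List Sym → List Sym → ℕ → Prop) (L : List ℕ) (ans : List ℕ → List ℕ)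
        (y : List ℕ) (Z : ℕ), (encode L).length ≤ Z →
        (∀ q ∈ pre L, (encode (ans q)).length ≤ Z ∧
          ∃ T ≤ Z, env .evaluation (encode q) (encode (ans q)) T) →
        (encode y).length ≤ Z →
        (∃ T ≤ Z, env .matching (encode (mid (answerTable ans (pre L)) L)) (encode y) T) →
        Steps env P (initStore (encode L))
          (quad (encode (fin (y ++ [0]) (answerTable ans (pre L)) L)) [] [] []) (G Z)
          (Pi.single .evaluation (pre L).length + Pi.single .matching 1) := by
  obtain ⟨a, H, hH, ha⟩ := exists_askAll (γ := List ℕ)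
  have h0 : PT fun L : List ℕ => (pre L.dropLast, L.dropLast) :=
    (hpre.comp (by fun_prop)).mk (by fun_prop)
  have h1 : PT fun s : List (List ℕ × List ℕ) × List ℕ => (mid s.1 s.2, s) := hmid.mk (by fun_prop)
  obtain ⟨e3, he3⟩ := h0.sz_bdd
  obtain ⟨e4, he4⟩ := h1.sz_bdd
  obtain ⟨e5, he5⟩ := hfin.sz_bdd
  obtain ⟨p0, T0, ⟨e0, he0⟩, hp0⟩ := h0
  obtain ⟨p1, T1, ⟨e1, he1⟩, hp1⟩ := h1
  obtain ⟨p2, T2, ⟨e2, he2⟩, hp2⟩ := hfin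
  have hid : PolyBdd (X := ℕ) id fun Z => Z := .self id
  -- sizes of the input, of the queries, of the table, of the input of the last step
  let A : ℕ → ℕ := fun Z => 6 * Z + 3 + 2
  let B : ℕ → ℕ := fun Z => A Z ^ e3 + Z
  let C : ℕ → ℕ := fun Z => B Z * (7 * B Z + 5) + 1 + B Z + 1 + 2
  let D : ℕ → ℕ := fun Z => (6 * Z + 3) + C Z + 1 + 2
  have hA : PolyBdd id A := (hid.const_mul_add _ _).add (.const _ 2)
  have hB : PolyBdd id B := (hA.pow e3).add hid
  have hC : PolyBdd id C := ((((hB.mul (hB.const_mul_add _ _)).add (.const _ 1)).add hB).add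
    (.const _ 1)).add (.const _ 2)
  have hD : PolyBdd id D := (((hid.const_mul_add _ _).add hC).add (.const _ 1)).add (.const _ 2)
  have hHB : PolyBdd id fun Z => H (B Z) := (hH.comp B).trans hB
  refine ⟨.seq (moveAll 0 2) (.seq readIn (.seq (p0 Sub) (.seq (a Sub .evaluation) (.seq (p1 Sub)
      (.seq (.pop 0) (.seq (ask .matching) (.seq (.push 0 .one) (.seq (p2 Sub)
        (.seq writeOut (moveAll 2 0)))))))))),
    fun Z => 16 * Z + 20 + A Z ^ e0 + H (B Z) + C Z ^ e1 + (16 * C Z ^ e4 + 18 * Z) + D Z ^ e2 +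
      15 * D Z ^ e5, (((((((hid.const_mul_add _ _).add (hA.pow _)).add hHB).add (hC.pow _)).add
        (((PolyBdd.const _ 16).mul (hC.pow _)).add ((PolyBdd.const _ 18).mul hid))).add
          (hD.pow _)).add ((PolyBdd.const _ 15).mul (hD.pow _))), ?_⟩
  intro env L ans y Z hL hans hy ⟨T, hT, hM⟩
  have hsL := sz_le_length_encode L
  have h3 := he3 (L ++ [0])
  have h0 := he0 (L ++ [0])
  have hp0 := hp0 Sub env (L ++ [0]) []
  simp only [List.dropLast_concat] at h3 hp0
  rw [sz_mk] at h3
  have hA' : ∀ e, (sz (L ++ [0]) + 2) ^ e ≤ A Z ^ e := fun e =>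
    Nat.pow_le_pow_left (by simp only [A]; omega) _
  have hBq : sz (pre L) ≤ B Z := by have := hA' e3; simp only [B]; omega
  have hBL : sz L ≤ B Z := by have := hA' e3; simp only [B]; omega
  have hBZ : Z ≤ B Z := by simp only [B]; omega
  have hask := ha Sub env .evaluation (pre L) ans L (B Z) [] hBq hBL fun q hq =>
    ⟨(hans q hq).1.trans hBZ, by
      obtain ⟨T, hT, h⟩ := (hans q hq).2
      exact ⟨T, hT.trans hBZ, h⟩⟩
  have htab := sz_answerTable_le (ans := ans) hBq fun q hq => (hans q hq).1.trans hBZ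
  generalize answerTable ans (pre L) = tab at *
  have hC' : ∀ e, (sz (tab, L) + 2) ^ e ≤ C Z ^ e := fun e =>
    Nat.pow_le_pow_left (by rw [sz_mk]; simp only [C]; omega) _
  have h4 := he4 (tab, L)
  have h1 := he1 (tab, L)
  have hp1 := hp1 Sub env (tab, L) []
  simp only at h4 hp1
  rw [sz_mk] at h4
  have hD' : ∀ e, (sz (y ++ [0], (tab, L)) + 2) ^ e ≤ D Z ^ e := fun e =>
    Nat.pow_le_pow_left (by
      have := sz_le_length_encode y
      have h6 := sz_mk tab L
      rw [sz_mk, h6]; simp only [D, C]; omega) _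
  have h5 := he5 (y ++ [0], (tab, L))
  have h2 := he2 (y ++ [0], (tab, L))
  have hp2 := hp2 Sub env (y ++ [0], (tab, L)) []
  have hw := steps_writeOut (env := env) (fin (y ++ [0]) tab L) [] []
  have hmv := steps_move_two_zero (env := env) [] [] (encode (fin (y ++ [0]) tab L)).reverse []
  have hst := steps_move_zero_two (env := env) (encode L) [] [] []
  have hrd := steps_readIn (env := env) L []
  simp only [List.append_nil, List.reverse_reverse, List.length_reverse] at hw hmv hst hrd
  rw [List.append_nil, List.append_nil] at hp0 hask hp1 hp2
  have hm := steps_ask hM (str (tab, L))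
  have hp1' : Steps env (p1 Sub) (quad (str (tab, L)) [] [] [])
    (quad (.one :: (str (mid tab L) ++ str (tab, L))) [] [] []) _ 0 := hp1
  have hp2' : Steps env (p2 Sub) (quad (.one :: (str (y ++ [0]) ++ str (tab, L))) [] [] [])
    (quad (str (fin (y ++ [0]) tab L)) [] [] []) _ 0 := hp2
  have h6 := hst.seq (hrd.seq (hp0.seq (hask.seq (hp1'.seq ((steps_pop_zero _ _ _ _ _).seq
    (hm.seq ((steps_push_zero _ _ _ _ _).seq (hp2'.seq (hw.seq hmv)))))))))
  simp only [zero_add, add_zero] at h6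
  rw [initStore_eq]
  refine h6.mono ?_
  have := length_encode_le_sz (mid tab L)
  have := length_encode_le_sz (fin (y ++ [0]) tab L)
  have := hA' e0
  have := hC' e1
  have := hC' e4
  have := hD' e2
  have := hD' e5
  beta_reduce at h3 h4 ⊢
  dsimp only at h5
  generalize A Z ^ e0 = a0 at *
  generalize H (B Z) = a0' at *
  have := hC' e1
  have := hC' e4
  have := hD' e2
  have := hD' e5
  generalize C Z ^ e1 = a1 at *
  generalize C Z ^ e4 = a2 at *
  generalize D Z ^ e2 = a3 at *
  generalize D Z ^ e5 = a4 at *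
  omega

end Calls

/-- A time bound for a subroutine also bounds its answer; no separate assumption on the length of
answers is necessary. -/
theorem Exec.length_le {p : Prog Empty} {x y : List Sym} {T : ℕ} (h : Exec p x y T) :
    y.length ≤ x.length + T := by
  obtain ⟨σ', c, h, rfl⟩ := h
  have := h.length_le 0
  rwa [initStore_eq, quad_zero] at this

/-! ## The algorithm on lists of numbers -/

/-- Comparison of rational numbers, given by lists that start with their codes. -/
def ratLt (a b : List ℕ) : Bool :=
  Nat.blt ((1 - a.getD 0 0) * a.getD 1 0 * b.getD 2 0 + b.getD 0 0 * b.getD 1 0 * a.getD 2 0)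
    ((1 - b.getD 0 0) * b.getD 1 0 * a.getD 2 0 + a.getD 0 0 * a.getD 1 0 * b.getD 2 0)

/-- The numbers of the points at a moment. -/
def pointNumbers (L : List ℕ) : List ℕ := below L (L.getD 1 0)

/-- The numbers of the moments. -/
def momentNumbers (L : List ℕ) : List ℕ := below L (L.getD 0 0)

/-- The moments of the samples. -/
def sampleMoments (k : ℕ) (L : List ℕ) : List ℕ := (List.range k).map fun l => L.getD (l + 2) 0

/-- The moments outside the samples. -/
def otherMoments (k : ℕ) (L : List ℕ) : List ℕ :=
  (momentNumbers L).filter fun τ => !mem τ (sampleMoments k L)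

/-- All lists of point numbers of the given length. -/
def sampleList (L : List ℕ) : ℕ → List (List ℕ)
  | 0 => [[]]
  | l + 1 => (pointNumbers L).flatMap fun a => (sampleList L l).map fun c => a :: c

/-- The queries to the evaluation. -/
def queries (k : ℕ) (L : List ℕ) : List (List ℕ) :=
  (sampleList L k).flatMap fun c => (otherMoments k L).flatMap fun τ =>
    (pointNumbers L).map fun j => L ++ c ++ [τ, j]

/-- The answer to a query. -/
def reply (tab : List (List ℕ × List ℕ)) (L c : List ℕ) (τ j : ℕ) : List ℕ :=
  lookup (L ++ c ++ [τ, j]) tab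

/-- The smallest of the deviations of the points at a moment. -/
def lowReply (tab : List (List ℕ × List ℕ)) (L c : List ℕ) (τ : ℕ) : List ℕ :=
  pick (fun a b => !ratLt b a) ((pointNumbers L).map fun j => reply tab L c τ j) []

/-- The largest of the smallest deviations. -/
def scoreReply (k : ℕ) (tab : List (List ℕ × List ℕ)) (L c : List ℕ) : List ℕ :=
  pick (fun a b => !ratLt a b) ((otherMoments k L).map fun τ => lowReply tab L c τ) [0, 0, 1, 0]

/-- A best sample from one point to another. -/
def bestSample (k : ℕ) (tab : List (List ℕ × List ℕ)) (L : List ℕ) (i j : ℕ) : List ℕ :=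
  pick (fun c c' => !ratLt (scoreReply k tab L c') (scoreReply k tab L c))
    ((sampleList L k).filter fun c => Nat.beq (c.getD 0 0) i && Nat.beq (c.getD (k - 1) 0) j) []

/-- The code of the weight of an edge. -/
def weightReply (k : ℕ) (tab : List (List ℕ × List ℕ)) (L : List ℕ) (i j : ℕ) : List ℕ :=
  (List.range 3).map fun e => (scoreReply k tab L (bestSample k tab L i j)).getD e 0

/-- The input of the matching subroutine. -/
def matchingQuery (k : ℕ) (tab : List (List ℕ × List ℕ)) (L : List ℕ) : List ℕ :=
  L.getD 1 0 :: (pointNumbers L).flatMap fun i => (pointNumbers L).flatMap fun j =>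
    weightReply k tab L i j

/-- The code of a coordinate of a point. -/
def coordinate (d k : ℕ) (L : List ℕ) (τ i a : ℕ) : List ℕ :=
  (List.range 3).map fun e =>
    L.getD (k + (L.getD 1 0 * (d * 3) * τ + (d * 3 * i + (3 * a + e))) + 2) 0

/-- The strict lexicographical order of points. -/
def lexLt (d k : ℕ) (L : List ℕ) (τ i j : ℕ) : Bool :=
  (List.range d).any fun a => ratLt (coordinate d k L τ i a) (coordinate d k L τ j a) &&
    !((List.range d).any fun b => Nat.blt b a &&
      (ratLt (coordinate d k L τ i b) (coordinate d k L τ j b) ||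
        ratLt (coordinate d k L τ j b) (coordinate d k L τ i b)))

/-- A point is at most as far from the fit of the sample `c` as another one, and comes first in case
of a tie. -/
def nearer (d k : ℕ) (tab : List (List ℕ × List ℕ)) (L c : List ℕ) (τ i j : ℕ) : Bool :=
  ratLt (reply tab L c τ i) (reply tab L c τ j) ||
    (!ratLt (reply tab L c τ j) (reply tab L c τ i) && !lexLt d k L τ j i)

/-- The rule leaves the point to the next path, when the paths `acc` have been served. -/
def leaves (rule : Rule) (acc : List (List ℕ)) (τ j : ℕ) : Bool :=
  match rule with
  | .free => true
  | .oneToOne => !acc.any fun p => Nat.beq (p.getD τ 0) j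

/-- The point of the next path at a moment. -/
def nextPoint (d k : ℕ) (rule : Rule) (tab : List (List ℕ × List ℕ)) (L c : List ℕ)
    (acc : List (List ℕ)) (τ : ℕ) : ℕ :=
  bif mem τ (sampleMoments k L) then
    c.getD (((List.range k).filter fun l => Nat.beq (L.getD (l + 2) 0) τ).headD 0) 0
  else pick (nearer d k tab L c τ) ((pointNumbers L).filter fun j => leaves rule acc τ j) 0

/-- The next path. -/
def nextPath (d k : ℕ) (rule : Rule) (tab : List (List ℕ × List ℕ)) (L c : List ℕ)
    (acc : List (List ℕ)) : List ℕ :=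
  (momentNumbers L).map fun τ => nextPoint d k rule tab L c acc τ

/-- The first paths, for the matching `μ`. -/
def paths (d k : ℕ) (rule : Rule) (μ : List ℕ) (tab : List (List ℕ × List ℕ)) (L is : List ℕ) :
    List (List ℕ) :=
  is.foldl (fun acc i =>
    acc ++ [nextPath d k rule tab L (bestSample k tab L i (μ.getD i 0)) acc]) []

/-- The output. -/
def pathOutput (d k : ℕ) (rule : Rule) (μ : List ℕ) (tab : List (List ℕ × List ℕ)) (L : List ℕ) :
    List ℕ :=
  (paths d k rule μ tab L (pointNumbers L)).flatMap fun p => p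

/-! ### Polynomial time -/

section PolynomialTime

variable {γ : Type} [Code γ]

@[fun_prop]
theorem PT.ratLt {a b : γ → List ℕ} (ha : PT a) (hb : PT b) : PT fun x => ratLt (a x) (b x) := by
  unfold PathFitting.ratLt; fun_prop

variable {d k : ℕ} {rule : Rule} {tab : γ → List (List ℕ × List ℕ)} {L c μ : γ → List ℕ}
  {acc : γ → List (List ℕ)} {τ i j a : γ → ℕ}

@[fun_prop]
theorem PT.pointNumbers (hL : PT L) : PT fun x => pointNumbers (L x) := by
  unfold PathFitting.pointNumbers; fun_prop

@[fun_prop]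
theorem PT.momentNumbers (hL : PT L) : PT fun x => momentNumbers (L x) := by
  unfold PathFitting.momentNumbers; fun_prop

@[fun_prop]
theorem PT.sampleMoments (hL : PT L) : PT fun x => sampleMoments k (L x) := by
  unfold PathFitting.sampleMoments; fun_prop

@[fun_prop]
theorem PT.otherMoments (hL : PT L) : PT fun x => otherMoments k (L x) := by
  unfold PathFitting.otherMoments; fun_prop

@[fun_prop]
theorem PT.sampleList (hL : PT L) (l : ℕ) : PT fun x => sampleList (L x) l := by
  -- The sample length is fixed, not part of the input. The induction composes boundedly many
  -- polynomial time constructions.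
  induction l with
  | zero => exact .const _
  | succ l ih =>
    unfold PathFitting.sampleList
    have h : PT fun p : γ × ℕ => PathFitting.sampleList (L p.1) l := ih.comp (.fst .id')
    exact flatMap (f := fun x a => (PathFitting.sampleList (L x) l).map fun c => a :: c)
      (map (γ := γ × ℕ) (f := fun p c => p.2 :: c) (by fun_prop) h) (.pointNumbers hL)

@[fun_prop]
theorem PT.queries (hL : PT L) : PT fun x => queries k (L x) := by
  unfold PathFitting.queries; fun_prop

@[fun_prop]
theorem PT.reply (ht : PT tab) (hL : PT L) (hc : PT c) (hτ : PT τ) (hj : PT j) :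
    PT fun x => reply (tab x) (L x) (c x) (τ x) (j x) := by
  unfold PathFitting.reply; fun_prop

@[fun_prop]
theorem PT.lowReply (ht : PT tab) (hL : PT L) (hc : PT c) (hτ : PT τ) :
    PT fun x => lowReply (tab x) (L x) (c x) (τ x) := by
  unfold PathFitting.lowReply; fun_prop

@[fun_prop]
theorem PT.scoreReply (ht : PT tab) (hL : PT L) (hc : PT c) :
    PT fun x => scoreReply k (tab x) (L x) (c x) := by
  unfold PathFitting.scoreReply; fun_prop

@[fun_prop]
theorem PT.bestSample (ht : PT tab) (hL : PT L) (hi : PT i) (hj : PT j) :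
    PT fun x => bestSample k (tab x) (L x) (i x) (j x) := by
  unfold PathFitting.bestSample; fun_prop

@[fun_prop]
theorem PT.weightReply (ht : PT tab) (hL : PT L) (hi : PT i) (hj : PT j) :
    PT fun x => weightReply k (tab x) (L x) (i x) (j x) := by
  unfold PathFitting.weightReply; fun_prop

@[fun_prop]
theorem PT.matchingQuery (ht : PT tab) (hL : PT L) :
    PT fun x => matchingQuery k (tab x) (L x) := by
  unfold PathFitting.matchingQuery; fun_prop

@[fun_prop]
theorem PT.coordinate (hL : PT L) (hτ : PT τ) (hi : PT i) (ha : PT a) :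
    PT fun x => coordinate d k (L x) (τ x) (i x) (a x) := by
  unfold PathFitting.coordinate; fun_prop

@[fun_prop]
theorem PT.lexLt (hL : PT L) (hτ : PT τ) (hi : PT i) (hj : PT j) :
    PT fun x => lexLt d k (L x) (τ x) (i x) (j x) := by
  unfold PathFitting.lexLt; fun_prop

@[fun_prop]
theorem PT.nearer (ht : PT tab) (hL : PT L) (hc : PT c) (hτ : PT τ) (hi : PT i) (hj : PT j) :
    PT fun x => nearer d k (tab x) (L x) (c x) (τ x) (i x) (j x) := by
  unfold PathFitting.nearer; fun_prop

@[fun_prop]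
theorem PT.leaves (ha : PT acc) (hτ : PT τ) (hj : PT j) :
    PT fun x => leaves rule (acc x) (τ x) (j x) := by
  unfold PathFitting.leaves
  cases rule <;> dsimp only <;> fun_prop

@[fun_prop]
theorem PT.nextPoint (ht : PT tab) (hL : PT L) (hc : PT c) (ha : PT acc) (hτ : PT τ) :
    PT fun x => nextPoint d k rule (tab x) (L x) (c x) (acc x) (τ x) := by
  unfold PathFitting.nextPoint; fun_prop

@[fun_prop]
theorem PT.nextPath (ht : PT tab) (hL : PT L) (hc : PT c) (ha : PT acc) :
    PT fun x => nextPath d k rule (tab x) (L x) (c x) (acc x) := by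
  unfold PathFitting.nextPath; fun_prop

theorem sz_getD_le (l : List ℕ) (i : ℕ) : sz (l.getD i 0) ≤ sz l := by
  rw [List.getD_eq_getElem?_getD]
  rcases h : l[i]? with _ | b
  · exact sz_pos l
  · exact (sz_le_of_mem (List.mem_of_getElem? h)).le

/-- Each point of the path comes from the sample or from the list of point numbers, or is `0`. The
bound does not involve the earlier paths, so appending paths one by one grows additively. -/
theorem sz_nextPath_le (tab : List (List ℕ × List ℕ)) (L c : List ℕ) (acc : List (List ℕ)) :
    sz (nextPath d k rule tab L c acc) ≤
      sz (momentNumbers L) * (sz c + sz (pointNumbers L) + 1) + 1 := by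
  refine (sz_le_of_forall (B := sz c + sz (pointNumbers L)) fun b hb => ?_).trans ?_
  · obtain ⟨τ, -, rfl⟩ := List.mem_map.1 hb
    rw [nextPoint]
    cases mem τ (sampleMoments k L)
    · rw [cond_false]
      by_cases h : (pointNumbers L).filter (fun j => leaves rule acc τ j) = []
      · rw [h, pick_nil]
        exact (sz_pos c).trans (Nat.le_add_right _ _)
      · have := sz_le_of_mem (List.mem_filter.1
          (pick_mem (nearer d k tab L c τ) h 0)).1
        omega
    · rw [cond_true]
      exact (sz_getD_le _ _).trans (Nat.le_add_right _ _)
  · rw [nextPath, List.length_map]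
    exact Nat.add_le_add_right (Nat.mul_le_mul_right _ (length_lt_sz _).le) _

theorem PT.paths {is : γ → List ℕ} (hμ : PT μ) (ht : PT tab) (hL : PT L) (hi : PT is) :
    PT fun x => paths d k rule (μ x) (tab x) (L x) (is x) := by
  unfold PathFitting.paths
  have h1 : PT fun p : γ × ℕ => PathFitting.bestSample k (tab p.1) (L p.1) p.2 ((μ p.1).getD p.2 0) := by
    fun_prop
  have h2 : PT fun p : γ × ℕ => PathFitting.momentNumbers (L p.1) := by fun_prop
  have h3 : PT fun p : γ × ℕ => PathFitting.pointNumbers (L p.1) := by fun_prop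
  refine foldl (γ := γ) (step := fun x acc i => acc ++ [PathFitting.nextPath d k rule (tab x) (L x)
    (PathFitting.bestSample k (tab x) (L x) i ((μ x).getD i 0)) acc]) (init := fun _ => []) (by fun_prop)
    (by fun_prop) hi (((h2.sz_bdd.mul ((h1.sz_bdd.add h3.sz_bdd).add (.const _ 1))).add
      (.const _ 1)).add (.const _ 1)) fun x b i => ?_
  have h4 := sz_append b [PathFitting.nextPath d k rule (tab x) (L x)
    (PathFitting.bestSample k (tab x) (L x) i ((μ x).getD i 0)) b]
  have h5 := sz_nextPath_le (d := d) (k := k) (rule := rule) (tab x) (L x)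
    (PathFitting.bestSample k (tab x) (L x) i ((μ x).getD i 0)) b
  rw [sz_cons, sz_nil] at h4
  dsimp only
  omega

theorem PT.pathOutput (hμ : PT μ) (ht : PT tab) (hL : PT L) :
    PT fun x => pathOutput d k rule (μ x) (tab x) (L x) := by
  unfold PathFitting.pathOutput
  have h : PT fun x => PathFitting.paths d k rule (μ x) (tab x) (L x) (PathFitting.pointNumbers (L x)) :=
    PT.paths hμ ht hL (by fun_prop)
  fun_prop

end PolynomialTime

/-! ## Correctness -/

/-! ### Comparison of coded rational numbers -/

section Codes

/-- The rational number with the given code. -/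
def ratVal (a : List ℕ) : ℚ :=
  (if a.getD 0 0 = 0 then (a.getD 1 0 : ℚ) else -(a.getD 1 0 : ℚ)) / a.getD 2 0

theorem ratVal_ratCode (q : ℚ) (r : List ℕ) : ratVal (ratCode q ++ r) = q := by
  have h1 : (ratCode q ++ r).getD 0 0 = if q < 0 then 1 else 0 := rfl
  have h2 : (ratCode q ++ r).getD 1 0 = q.num.natAbs := rfl
  have h3 : (ratCode q ++ r).getD 2 0 = q.den := rfl
  rw [ratVal, h1, h2, h3]
  conv_rhs => rw [← Rat.num_div_den q]
  congr 1
  rw [Nat.cast_natAbs]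
  by_cases h : q < 0
  · simp [h, abs_of_neg (Rat.num_neg.2 h)]
  · simp [h, abs_of_nonneg (Rat.num_nonneg.2 (not_lt.1 h))]

/-- Cross-multiplication with each numerator split into positive and negative part, the negative
parts being moved to the other side so that natural numbers suffice. The tails `r` and `s`
accommodate the trailing `0` of answers. -/
theorem ratLt_iff (p q : ℚ) (r s : List ℕ) :
    ratLt (ratCode p ++ r) (ratCode q ++ s) = true ↔ p < q := by
  have h1 : ∀ (q : ℚ) (r : List ℕ), (ratCode q ++ r).getD 0 0 = if q < 0 then 1 else 0 :=
    fun _ _ => rfl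
  have h2 : ∀ (q : ℚ) (r : List ℕ), (ratCode q ++ r).getD 1 0 = q.num.natAbs := fun _ _ => rfl
  have h3 : ∀ (q : ℚ) (r : List ℕ), (ratCode q ++ r).getD 2 0 = q.den := fun _ _ => rfl
  have h4 : ∀ q : ℚ, (((1 - if q < 0 then 1 else 0 : ℕ) * q.num.natAbs : ℕ) : ℤ) -
      (((if q < 0 then 1 else 0 : ℕ) * q.num.natAbs : ℕ) : ℤ) = q.num := by
    intro q
    by_cases h : q < 0
    · have := Rat.num_neg.2 h
      rw [if_pos h]
      omega
    · have := Rat.num_nonneg.2 (not_lt.1 h)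
      rw [if_neg h]
      omega
  rw [ratLt, h1, h1, h2, h2, h3, h3, Nat.blt_eq, Rat.lt_iff p q]
  have hp := h4 p
  have hq := h4 q
  generalize (1 - if p < 0 then 1 else 0) * p.num.natAbs = p₁ at *
  generalize (if p < 0 then 1 else 0) * p.num.natAbs = p₂ at *
  generalize (1 - if q < 0 then 1 else 0) * q.num.natAbs = q₁ at *
  generalize (if q < 0 then 1 else 0) * q.num.natAbs = q₂ at *
  rw [← hp, ← hq]
  zify
  constructor <;> intro h <;> linarith

theorem ratLt_ratCode (p q : ℚ) : ratLt (ratCode p) (ratCode q) = true ↔ p < q := by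
  simpa using ratLt_iff p q [] []

theorem pick_le_of_key {α κ : Type*} [LinearOrder κ] {le : α → α → Bool} {l : List α} (key : α → κ)
    (h : ∀ a ∈ l, ∀ b ∈ l, (le a b = true ↔ key a ≤ key b)) (d : α) :
    ∀ a ∈ l, key (pick le l d) ≤ key a := by
  intro a ha
  rw [← h _ (pick_mem le (List.ne_nil_of_mem ha) d) _ ha]
  refine pick_le (fun a ha => (h a ha a ha).2 le_rfl) (fun a ha b hb => ?_)
    (fun a ha b hb c hc h1 h2 => ?_) d a ha
  · rw [h a ha b hb, h b hb a ha]; exact le_total _ _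
  · rw [h a ha c hc]
    rw [h a ha b hb] at h1
    rw [h b hb c hc] at h2
    exact h1.trans h2

theorem exists_pick_min {α : Type*} {l : List α} (hl : l ≠ []) {f : α → List ℕ} {v : α → ℚ}
    (hf : ∀ a ∈ l, f a = ratCode (v a) ++ [0]) (D : List ℕ) :
    ∃ a ∈ l, pick (fun a b => !ratLt b a) (l.map f) D = ratCode (v a) ++ [0] ∧
      ∀ b ∈ l, v a ≤ v b := by
  obtain ⟨a, ha, h⟩ := List.mem_map.1 (pick_mem (fun a b => !ratLt b a)
    (l := l.map f) (by simpa using hl) D)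
  have h1 := pick_le_of_key (le := fun a b => !ratLt b a) (l := l.map f) ratVal (by
    intro x hx y hy
    obtain ⟨x, hx', rfl⟩ := List.mem_map.1 hx
    obtain ⟨y, hy', rfl⟩ := List.mem_map.1 hy
    rw [hf x hx', hf y hy', Bool.not_eq_true', Bool.eq_false_iff, ne_eq, ratLt_iff, not_lt,
      ratVal_ratCode, ratVal_ratCode]) D
  rw [← h] at h1 ⊢
  refine ⟨a, ha, hf a ha, fun b hb => ?_⟩
  have := h1 _ (List.mem_map_of_mem hb)
  rwa [hf a ha, hf b hb, ratVal_ratCode, ratVal_ratCode] at this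

theorem exists_pick_max {α : Type*} {l : List α} (hl : l ≠ []) {f : α → List ℕ} {v : α → ℚ}
    (hf : ∀ a ∈ l, f a = ratCode (v a) ++ [0]) (D : List ℕ) :
    ∃ a ∈ l, pick (fun a b => !ratLt a b) (l.map f) D = ratCode (v a) ++ [0] ∧
      ∀ b ∈ l, v b ≤ v a := by
  obtain ⟨a, ha, h⟩ := List.mem_map.1 (pick_mem (fun a b => !ratLt a b)
    (l := l.map f) (by simpa using hl) D)
  have h1 := pick_le_of_key (le := fun a b => !ratLt a b) (l := l.map f)
    (fun x => OrderDual.toDual (ratVal x)) (by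
    intro x hx y hy
    obtain ⟨x, hx', rfl⟩ := List.mem_map.1 hx
    obtain ⟨y, hy', rfl⟩ := List.mem_map.1 hy
    rw [hf x hx', hf y hy', Bool.not_eq_true', Bool.eq_false_iff, ne_eq, ratLt_iff, not_lt,
      ratVal_ratCode, ratVal_ratCode, OrderDual.toDual_le_toDual]) D
  rw [← h] at h1 ⊢
  refine ⟨a, ha, hf a ha, fun b hb => ?_⟩
  have := h1 _ (List.mem_map_of_mem hb)
  rwa [hf a ha, hf b hb, OrderDual.toDual_le_toDual, ratVal_ratCode, ratVal_ratCode] at this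

theorem map_range_eq_ofFn {α : Type*} (n : ℕ) (g : ℕ → α) :
    (List.range n).map g = List.ofFn fun i : Fin n => g i := by
  apply List.ext_getElem <;> simp

theorem flatMap_range_eq_seqCode (n : ℕ) (g : ℕ → List ℕ) :
    (List.range n).flatMap g = seqCode fun i : Fin n => g i := by
  rw [seqCode, List.flatMap, map_range_eq_ofFn]

theorem getD_ofFn {n : ℕ} (f : Fin n → ℕ) {i : ℕ} (hi : i < n) :
    (List.ofFn f).getD i 0 = f ⟨i, hi⟩ := by
  rw [List.getD_eq_getElem _ _ (by simpa using hi), List.getElem_ofFn]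

end Codes

/-! ### Decoding the input; the samples and the queries -/

section Input

variable {d k : ℕ} (I : Instance d) (τs : I.Moments k)

theorem length_inputCode : (inputCode I τs).length = I.t * (I.n * (d * 3)) + k + 2 := by
  simp only [inputCode, List.length_cons, List.length_append, List.length_ofFn]
  rw [length_seqCode (c := I.n * (d * 3))]
  · omega
  intro τ
  rw [length_seqCode (c := d * 3)]
  intro i
  rw [length_seqCode (c := 3)]
  intro a
  rfl

theorem getD_inputCode_zero : (inputCode I τs).getD 0 0 = I.t := rfl

theorem getD_inputCode_one : (inputCode I τs).getD 1 0 = I.n := rfl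

theorem sampleMoments_inputCode :
    sampleMoments k (inputCode I τs) = List.ofFn fun l => (τs l : ℕ) := by
  rw [sampleMoments, map_range_eq_ofFn]
  congr 1
  funext l
  rw [inputCode, List.getD_cons_succ, List.getD_cons_succ, List.getD_append _ _ _ _ (by simp),
    getD_ofFn _ l.2]

theorem getD_inputCode_moment (l : Fin k) : (inputCode I τs).getD (l + 2) 0 = τs l := by
  rw [inputCode, List.getD_cons_succ, List.getD_cons_succ, List.getD_append _ _ _ _ (by simp),
    getD_ofFn _ l.2]

variable {I τs}

theorem t_pos [NeZero k] (τs : I.Moments k) : 0 < I.t := (Nat.zero_le _).trans_lt (τs 0).2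

/-- There is at least one moment, and each point contributes at least three numbers to the code, so
`n` does not exceed its length. -/
theorem pointNumbers_inputCode [NeZero k] (hd : 1 ≤ d) :
    pointNumbers (inputCode I τs) = List.range I.n := by
  rw [pointNumbers, getD_inputCode_one, below_eq]
  rw [length_inputCode]
  have h1 := Nat.le_mul_of_pos_left (I.n * (d * 3)) (t_pos τs)
  have h2 := Nat.le_mul_of_pos_right I.n (show 0 < d * 3 by omega)
  omega

/-- If `n = 0`, the binary number `t` may be far larger than the input, and the list would be cut
off. Positivity of `n` excludes this; without points there are no paths and no queries anyway. -/
theorem momentNumbers_inputCode (hd : 1 ≤ d) (hn : 0 < I.n) :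
    momentNumbers (inputCode I τs) = List.range I.t := by
  rw [momentNumbers, getD_inputCode_zero, below_eq]
  rw [length_inputCode]
  have h2 := Nat.le_mul_of_pos_right I.t (show 0 < I.n * (d * 3) by positivity)
  omega

theorem mem_sampleMoments {τ : Fin I.t} :
    (τ : ℕ) ∈ sampleMoments k (inputCode I τs) ↔ τ ∈ Set.range τs := by
  rw [sampleMoments_inputCode, List.mem_ofFn]
  constructor
  · rintro ⟨l, hl⟩; exact ⟨l, Fin.ext hl⟩
  · rintro ⟨l, hl⟩; exact ⟨l, by rw [← hl]⟩

theorem mem_otherMoments (hd : 1 ≤ d) (hn : 0 < I.n) {x : ℕ} :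
    x ∈ otherMoments k (inputCode I τs) ↔ ∃ τ : Fin I.t, x = τ ∧ τ ∉ Set.range τs := by
  rw [otherMoments, momentNumbers_inputCode hd hn, List.mem_filter, List.mem_range,
    Bool.not_eq_true', Bool.eq_false_iff, ne_eq, mem_iff]
  constructor
  · rintro ⟨h1, h2⟩
    exact ⟨⟨x, h1⟩, rfl, fun h => h2 (mem_sampleMoments.2 h)⟩
  · rintro ⟨τ, rfl, h⟩
    exact ⟨τ.2, fun h' => h (mem_sampleMoments.1 h')⟩

theorem mem_sampleList [NeZero k] (hd : 1 ≤ d) {m : ℕ} {c : List ℕ} :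
    c ∈ sampleList (inputCode I τs) m ↔
      ∃ f : Fin m → Fin I.n, c = List.ofFn fun l => (f l : ℕ) := by
  induction m generalizing c with
  | zero => simp [sampleList]
  | succ m ih =>
    rw [sampleList, pointNumbers_inputCode hd]
    simp only [List.mem_flatMap, List.mem_range, List.mem_map, ih]
    constructor
    · rintro ⟨a, ha, _, ⟨f, rfl⟩, rfl⟩
      exact ⟨Fin.cons ⟨a, ha⟩ f, by simp [List.ofFn_succ]⟩
    · rintro ⟨f, rfl⟩
      exact ⟨f 0, (f 0).2, _, ⟨fun l => f l.succ, rfl⟩, by simp [List.ofFn_succ]⟩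

theorem length_sampleList [NeZero k] (hd : 1 ≤ d) (m : ℕ) :
    (sampleList (inputCode I τs) m).length = I.n ^ m := by
  induction m with
  | zero => rfl
  | succ m ih =>
    rw [sampleList, pointNumbers_inputCode hd, List.length_flatMap]
    simp [ih, pow_succ, mul_comm]

theorem length_queries_le [NeZero k] (hd : 1 ≤ d) :
    (queries k (inputCode I τs)).length ≤ I.n ^ (k + 1) * I.t := by
  rcases Nat.eq_zero_or_pos I.n with h0 | hn
  · have : queries k (inputCode I τs) = [] := by
      rw [queries, pointNumbers_inputCode hd, h0]
      simp
    simp [this]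
  · have h1 : (otherMoments k (inputCode I τs)).length ≤ I.t := by
      rw [otherMoments, momentNumbers_inputCode hd hn]
      exact (List.length_filter_le _ _).trans (by simp)
    rw [queries, List.length_flatMap]
    simp only [List.length_flatMap, List.length_map, pointNumbers_inputCode hd, List.length_range,
      List.map_const', List.sum_replicate, smul_eq_mul, length_sampleList hd]
    calc I.n ^ k * ((otherMoments k (inputCode I τs)).length * I.n)
        ≤ I.n ^ k * (I.t * I.n) := by gcongr
      _ = I.n ^ (k + 1) * I.t := by ring

theorem mem_queries [NeZero k] (hd : 1 ≤ d) {q : List ℕ} :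
    q ∈ queries k (inputCode I τs) ↔ ∃ (c : I.Points k) (τ : Fin I.t) (j : Fin I.n),
      τ ∉ Set.range τs ∧ q = queryCode I τs c τ j := by
  simp only [queries, List.mem_flatMap, List.mem_map, pointNumbers_inputCode hd, List.mem_range,
    mem_sampleList hd]
  constructor
  · rintro ⟨_, ⟨c, rfl⟩, x, hx, j, hj, rfl⟩
    obtain ⟨τ, rfl, hτ⟩ := (mem_otherMoments hd (by omega)).1 hx
    exact ⟨c, τ, ⟨j, hj⟩, hτ, rfl⟩
  · rintro ⟨c, τ, j, hτ, rfl⟩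
    exact ⟨_, ⟨c, rfl⟩, τ, (mem_otherMoments hd (by have := j.2; omega)).2 ⟨τ, rfl, hτ⟩, j, j.2, rfl⟩

theorem coordinate_inputCode (τ : Fin I.t) (i : Fin I.n) (a : Fin d) :
    coordinate d k (inputCode I τs) τ i a = ratCode (I.pt τ i a) := by
  have h : ∀ e < 3, (inputCode I τs).getD
      (k + ((inputCode I τs).getD 1 0 * (d * 3) * τ + (d * 3 * i + (3 * a + e))) + 2) 0 =
        (ratCode (I.pt τ i a)).getD e 0 := by
    intro e he
    have h1 : 3 * (a : ℕ) + e < d * 3 := by have := a.2; omega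
    have h2 : d * 3 * (i : ℕ) + (3 * a + e) < I.n * (d * 3) := by
      have : (i + 1) * (d * 3) ≤ I.n * (d * 3) := Nat.mul_le_mul_right _ i.2
      rw [add_mul, one_mul, mul_comm (i : ℕ)] at this
      omega
    rw [getD_inputCode_one, inputCode, List.getD_cons_succ, List.getD_cons_succ,
      List.getD_append_right _ _ _ _ (by simp), List.length_ofFn, Nat.add_sub_cancel_left,
      getD_seqCode (c := I.n * (d * 3)) (i := τ) ?_ τ.2 h2,
      getD_seqCode (c := d * 3) (i := i) ?_ i.2 h1, getD_seqCode (c := 3) (i := a) ?_ a.2 he]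
    · intro a; rfl
    · intro i
      rw [length_seqCode (c := 3)]
      intro a; rfl
    · intro τ
      rw [length_seqCode (c := d * 3)]
      intro i
      rw [length_seqCode (c := 3)]
      intro a; rfl
  rw [coordinate, map_range_eq_ofFn]
  have h' : (fun e : Fin 3 => (inputCode I τs).getD (k + ((inputCode I τs).getD 1 0 * (d * 3) * τ +
      (d * 3 * i + (3 * a + e))) + 2) 0) = fun e : Fin 3 => (ratCode (I.pt τ i a)).getD e 0 :=
    funext fun e => h e e.2
  rw [h']
  rfl

theorem lexLt_inputCode (τ : Fin I.t) (i j : Fin I.n) :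
    lexLt d k (inputCode I τs) τ i j = true ↔ toLex (I.pt τ i) < toLex (I.pt τ j) := by
  -- The lexicographic order unfolds to a first coordinate of difference, which is what `lexLt`
  -- searches for.
  have h : toLex (I.pt τ i) < toLex (I.pt τ j) ↔
      ∃ a, (∀ b < a, I.pt τ i b = I.pt τ j b) ∧ I.pt τ i a < I.pt τ j a := Iff.rfl
  rw [h, lexLt, List.any_eq_true]
  have hc : ∀ (i : Fin I.n) (b : ℕ) (hb : b < d), coordinate d k (inputCode I τs) τ i b =
      ratCode (I.pt τ i ⟨b, hb⟩) := fun i b hb => coordinate_inputCode τ i ⟨b, hb⟩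
  constructor
  · rintro ⟨a, ha, h1⟩
    rw [List.mem_range] at ha
    rw [Bool.and_eq_true, hc i a ha, hc j a ha, ratLt_ratCode, Bool.not_eq_true',
      List.any_eq_false] at h1
    refine ⟨⟨a, ha⟩, fun b hb => ?_, h1.1⟩
    have h2 := h1.2 b (List.mem_range.2 b.2)
    rw [coordinate_inputCode, coordinate_inputCode, Bool.and_eq_true, Bool.or_eq_true,
      ratLt_ratCode, ratLt_ratCode, Nat.blt_eq] at h2
    exact le_antisymm (not_lt.1 fun h => h2 ⟨hb, Or.inr h⟩)
      (not_lt.1 fun h => h2 ⟨hb, Or.inl h⟩)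
  · rintro ⟨a, h1, h2⟩
    refine ⟨a, List.mem_range.2 a.2, ?_⟩
    rw [Bool.and_eq_true, coordinate_inputCode, coordinate_inputCode, ratLt_ratCode,
      Bool.not_eq_true', List.any_eq_false]
    refine ⟨h2, fun b hb => ?_⟩
    rw [List.mem_range] at hb
    rw [hc i b hb, hc j b hb, Bool.and_eq_true, Bool.or_eq_true, ratLt_ratCode, ratLt_ratCode,
      Nat.blt_eq]
    rintro ⟨h3, h4⟩
    rw [h1 ⟨b, hb⟩ h3] at h4
    exact h4.elim (lt_irrefl _) (lt_irrefl _)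

end Input

/-! ### Scores and weights from the table -/

section Scores

variable {d k : ℕ} {N : Gauge d} {R : SampleFits d k} {I : Instance d} {τs : I.Moments k}
  {tab : List (List ℕ × List ℕ)}

/-- The list of the point numbers of a sample. -/
def pointList (c : I.Points k) : List ℕ := List.ofFn fun l => (c l : ℕ)

/-- The table contains the answers to all queries. -/
def IsTable (N : Gauge d) (R : SampleFits d k) (I : Instance d) (τs : I.Moments k)
    (tab : List (List ℕ × List ℕ)) : Prop :=
  ∀ (c : I.Points k) (τ : Fin I.t) (j : Fin I.n), τ ∉ Set.range τs →
    reply tab (inputCode I τs) (pointList c) τ j = ratCode (deviation N R I τs c τ j) ++ [0]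

theorem deviation_cast (c : I.Points k) (τ : Fin I.t) (j : Fin I.n) :
    (deviation N R I τs c τ j : ℝ) =
      N.h (N.length (R.fit I τs c (I.moment τ) - I.pt τ j)) :=
  (N.h_rational _).choose_spec

theorem deviation_lt_iff (c : I.Points k) (τ : Fin I.t) (i j : Fin I.n) :
    deviation N R I τs c τ i < deviation N R I τs c τ j ↔
      N.length (R.fit I τs c (I.moment τ) - I.pt τ i) <
        N.length (R.fit I τs c (I.moment τ) - I.pt τ j) := by
  rw [← Rat.cast_lt (K := ℝ), deviation_cast, deviation_cast, NNReal.coe_lt_coe,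
    N.h_strictMono.lt_iff_lt]

theorem h_zero_le_deviation (c : I.Points k) (τ : Fin I.t) (j : Fin I.n) :
    (N.h 0 : ℝ) ≤ deviation N R I τs c τ j := by
  rw [deviation_cast, NNReal.coe_le_coe]
  exact N.h_strictMono.monotone zero_le

/-- The fit passes through the points of its sample. With `h_zero_le_deviation`, a sample moment
contributes the least possible value to the maximum. -/
theorem deviation_sample (c : I.Points k) (l : Fin k) :
    (deviation N R I τs c (τs l) (c l) : ℝ) = N.h 0 := by
  have h1 : R.fit I τs c (I.moment (τs l)) = I.pt (τs l) (c l) :=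
    (R.existsUnique_fit I τs c).choose_spec.1.2 l
  rw [deviation_cast, h1, sub_self]
  congr 2
  apply NNReal.eq
  show N.norm (fun a => (((0 : Fin d → ℚ) a : ℚ) : ℝ)) = 0
  simp only [Pi.zero_apply, Rat.cast_zero]
  exact map_zero N.norm

theorem exists_lowReply [NeZero k] (hd : 1 ≤ d) (ht : IsTable N R I τs tab) (c : I.Points k)
    {τ : Fin I.t} (hτ : τ ∉ Set.range τs) :
    ∃ q : ℚ, lowReply tab (inputCode I τs) (pointList c) τ = ratCode q ++ [0] ∧
      (q : ℝ) = ⨅ j : Fin I.n, (deviation N R I τs c τ j : ℝ) := by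
  have : NeZero I.n := ⟨(Fin.pos (c 0)).ne'⟩
  obtain ⟨j, hj, h1, h2⟩ := exists_pick_min (l := List.finRange I.n) (by
    rw [ne_eq, List.finRange_eq_nil_iff]; exact NeZero.ne _)
    (f := fun j => reply tab (inputCode I τs) (pointList c) τ j)
    (v := fun j => deviation N R I τs c τ j) (fun j _ => ht c τ j hτ) []
  refine ⟨_, ?_, le_antisymm (le_ciInf fun j' => ?_) (ciInf_le (Set.finite_range _).bddBelow j)⟩
  · rw [lowReply, pointNumbers_inputCode hd, ← h1, map_range_eq_ofFn, List.ofFn_eq_map]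
  · exact_mod_cast h2 j' (List.mem_finRange j')

/-- The replies for the scores represent the scores up to a shift. -/
theorem exists_scoreReply [NeZero k] (hd : 1 ≤ d) (ht : IsTable N R I τs tab) :
    ∃ s : ℝ, ∀ c : I.Points k, ∃ q : ℚ,
      scoreReply k tab (inputCode I τs) (pointList c) = ratCode q ++ [0] ∧
        score N R I τs c = q + s := by
  have hpos := t_pos τs
  have : NeZero I.t := ⟨hpos.ne'⟩
  have hle : ∀ (c : I.Points k) (τ : Fin I.t),
      (N.h 0 : ℝ) ≤ ⨅ j : Fin I.n, (deviation N R I τs c τ j : ℝ) := fun c τ => by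
    have : NeZero I.n := ⟨(Fin.pos (c 0)).ne'⟩
    exact le_ciInf fun j => h_zero_le_deviation c τ j
  have hsample : ∀ (c : I.Points k) (l : Fin k),
      ⨅ j : Fin I.n, (deviation N R I τs c (τs l) j : ℝ) ≤ N.h 0 := fun c l =>
    (ciInf_le (Set.finite_range _).bddBelow (c l)).trans (deviation_sample c l).le
  -- If every moment is a sample moment, no query is made and all scores equal `N.h 0`, about which
  -- the program has no information. It uses the default `[0, 0, 1, 0]`, the code of `0` with the
  -- trailing `0` of an answer, and the shift makes up for the difference.
  by_cases hall : ∀ τ, τ ∈ Set.range τs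
  · refine ⟨N.h 0, fun c => ⟨0, ?_, ?_⟩⟩
    · have : otherMoments k (inputCode I τs) = [] := by
        rw [List.eq_nil_iff_forall_not_mem]
        intro x hx
        obtain ⟨τ, -, h⟩ := (mem_otherMoments hd (Fin.pos (c 0))).1 hx
        exact h (hall τ)
      rw [scoreReply, this]
      simp [pick, ratCode]
    · rw [Rat.cast_zero, zero_add]
      refine le_antisymm (ciSup_le fun τ => ?_)
        ((hle c ⟨0, hpos⟩).trans (le_ciSup (f := fun τ =>
          ⨅ j : Fin I.n, (deviation N R I τs c τ j : ℝ)) (Set.finite_range _).bddAbove ⟨0, hpos⟩))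
      obtain ⟨l, rfl⟩ := hall τ
      exact hsample c l
  · push Not at hall
    -- Otherwise some moment outside the sample contributes at least `N.h 0`, so omitting the sample
    -- moments does not change the maximum and no shift is needed.
    obtain ⟨τ₀, hτ₀⟩ := hall
    refine ⟨0, fun c => ?_⟩
    have hn : 0 < I.n := Fin.pos (c 0)
    choose! v hv using fun (τ : Fin I.t) (h : τ ∉ Set.range τs) => exists_lowReply hd ht c h
    let w : ℕ → ℚ := fun x => if h : x < I.t then v ⟨x, h⟩ else 0
    have hw : ∀ τ : Fin I.t, w τ = v τ := fun τ => dif_pos τ.2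
    obtain ⟨x, hx, h1, h2⟩ := exists_pick_max (l := otherMoments k (inputCode I τs))
      (List.ne_nil_of_mem ((mem_otherMoments hd hn).2 ⟨τ₀, rfl, hτ₀⟩))
      (f := fun τ => lowReply tab (inputCode I τs) (pointList c) τ) (v := w) (by
        intro x hx
        obtain ⟨τ, rfl, h⟩ := (mem_otherMoments hd hn).1 hx
        rw [hw]
        exact (hv τ h).1) [0, 0, 1, 0]
    refine ⟨w x, h1, ?_⟩
    obtain ⟨τ, rfl, h⟩ := (mem_otherMoments hd hn).1 hx
    rw [add_zero, hw, (hv τ h).2]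
    refine le_antisymm (ciSup_le fun τ' => ?_) (le_ciSup (f := fun τ =>
      ⨅ j : Fin I.n, (deviation N R I τs c τ j : ℝ)) (Set.finite_range _).bddAbove τ)
    by_cases h' : τ' ∈ Set.range τs
    · obtain ⟨l, rfl⟩ := h'
      exact (hsample c l).trans (hle c τ)
    · rw [← (hv τ h).2, ← (hv τ' h').2, ← hw, ← hw]
      exact_mod_cast h2 _ ((mem_otherMoments hd hn).2 ⟨τ', rfl, h'⟩)

/-- For `k ≥ 2` the first and the last position differ and can be prescribed independently. Thus
every edge has a sample, and its weight is a minimum over a nonempty set. -/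
theorem exists_joins [NeZero k] (hk : 2 ≤ k) (i j : Fin I.n) : ∃ c : I.Points k, Joins I c i j := by
  refine ⟨fun l => if l = 0 then i else j, by simp, ?_⟩
  have : Fin.rev (0 : Fin k) ≠ 0 := by
    rw [ne_eq, Fin.ext_iff, Fin.val_rev]
    simp
    omega
  simp [this]

theorem joins_iff [NeZero k] {c : I.Points k} {i j : Fin I.n} :
    (Nat.beq ((pointList c).getD 0 0) i && Nat.beq ((pointList c).getD (k - 1) 0) j) = true ↔
      Joins I c i j := by
  have hk : 0 < k := Nat.pos_of_ne_zero (NeZero.ne k)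
  have h1 : (⟨0, hk⟩ : Fin k) = 0 := Fin.ext (by simp)
  have h2 : (⟨k - 1, by omega⟩ : Fin k) = Fin.rev 0 := Fin.ext (by simp [Fin.val_rev])
  rw [pointList, getD_ofFn _ hk, getD_ofFn _ (show k - 1 < k by omega), Bool.and_eq_true,
    Nat.beq_eq, Nat.beq_eq, Joins, Fin.ext_iff, Fin.ext_iff, h1, h2]

/-- The replies for the weights represent the weights up to a shift, and they are attained. -/
theorem exists_weightReply [NeZero k] (hd : 1 ≤ d) (hk : 2 ≤ k) (ht : IsTable N R I τs tab) :
    ∃ (s : ℝ) (w : Fin I.n → Fin I.n → ℚ), ∀ i j : Fin I.n,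
      weightReply k tab (inputCode I τs) i j = ratCode (w i j) ∧
        weight N R I τs i j = w i j + s ∧
        ∃ c : I.Points k, Joins I c i j ∧ score N R I τs c = weight N R I τs i j ∧
          bestSample k tab (inputCode I τs) i j = pointList c := by
  obtain ⟨s, hs⟩ := exists_scoreReply hd ht
  choose v hv hv' using hs
  have h : ∀ i j : Fin I.n, ∃ c : I.Points k, Joins I c i j ∧
      bestSample k tab (inputCode I τs) i j = pointList c ∧
      weight N R I τs i j = v c + s := by
    intro i j
    have hmem : ∀ c : List ℕ, c ∈ (sampleList (inputCode I τs) k).filter (fun c =>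
        Nat.beq (c.getD 0 0) i && Nat.beq (c.getD (k - 1) 0) j) ↔
          ∃ c' : I.Points k, Joins I c' i j ∧ c = pointList c' := by
      intro c
      rw [List.mem_filter, mem_sampleList hd]
      constructor
      · rintro ⟨⟨c', rfl⟩, h⟩
        exact ⟨c', joins_iff.1 h, rfl⟩
      · rintro ⟨c', h, rfl⟩
        exact ⟨⟨c', rfl⟩, joins_iff.2 h⟩
    obtain ⟨c₀, hc₀⟩ := exists_joins (k := k) hk i j
    obtain ⟨c, hc, hbest⟩ := (hmem _).1 (pick_mem (fun c c' =>
      !ratLt (scoreReply k tab (inputCode I τs) c') (scoreReply k tab (inputCode I τs) c))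
      (List.ne_nil_of_mem ((hmem _).2 ⟨c₀, hc₀, rfl⟩)) [])
    have hmin := pick_le_of_key (le := fun c c' =>
      !ratLt (scoreReply k tab (inputCode I τs) c') (scoreReply k tab (inputCode I τs) c))
      (l := (sampleList (inputCode I τs) k).filter (fun c =>
        Nat.beq (c.getD 0 0) i && Nat.beq (c.getD (k - 1) 0) j))
      (fun c => ratVal (scoreReply k tab (inputCode I τs) c)) (by
        intro a ha b hb
        obtain ⟨a, -, rfl⟩ := (hmem a).1 ha
        obtain ⟨b, -, rfl⟩ := (hmem b).1 hb
        rw [hv, hv, ratVal_ratCode, ratVal_ratCode, Bool.not_eq_true', Bool.eq_false_iff, ne_eq,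
          ratLt_iff, not_lt]) []
    refine ⟨c, hc, hbest, ?_⟩
    rw [← hv', weight]
    refine le_antisymm (ciInf_le (f := fun c : {c : I.Points k // Joins I c i j} =>
      score N R I τs c.1) (Set.finite_range _).bddBelow ⟨c, hc⟩) ?_
    have : Nonempty {c : I.Points k // Joins I c i j} := ⟨⟨c₀, hc₀⟩⟩
    refine le_ciInf fun ⟨c', hc'⟩ => ?_
    have := hmin _ ((hmem _).2 ⟨c', hc', rfl⟩)
    rw [hbest, hv, hv, ratVal_ratCode, ratVal_ratCode] at this
    rw [hv', hv']
    have : (v c : ℝ) ≤ v c' := by exact_mod_cast this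
    linarith
  choose c h1 h2 h3 using h
  refine ⟨s, fun i j => v (c i j), fun i j => ⟨?_, h3 i j, c i j, h1 i j, ?_, h2 i j⟩⟩
  · rw [weightReply, h2, hv]
    rfl
  · rw [hv', h3]

theorem matchingQuery_inputCode [NeZero k] (hd : 1 ≤ d) {w : Fin I.n → Fin I.n → ℚ}
    (hw : ∀ i j : Fin I.n, weightReply k tab (inputCode I τs) i j = ratCode (w i j)) :
    matchingQuery k tab (inputCode I τs) = weightCode w := by
  rw [matchingQuery, pointNumbers_inputCode hd, flatMap_range_eq_seqCode, weightCode]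
  congr 2
  funext i
  rw [flatMap_range_eq_seqCode]
  congr 1
  funext j
  exact hw i j

/-- A constant added to all weights adds `n` times that constant to every perfect matching. This
neutralizes the shift in the replies. -/
theorem isMinMatching_of_add {n : ℕ} {w w' : Fin n → Fin n → ℝ} {s : ℝ}
    (h : ∀ i j, w' i j = w i j + s) {σ : Equiv.Perm (Fin n)} (hσ : IsMinMatching w σ) :
    IsMinMatching w' σ := by
  intro σ'
  simp only [h, Finset.sum_add_distrib]
  exact add_le_add_left (hσ σ') _

end Scores

/-! ### The paths and the output -/

section Paths

variable {d k : ℕ} {N : Gauge d} {R : SampleFits d k} {I : Instance d} {τs : I.Moments k}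
  {tab : List (List ℕ × List ℕ)} {rule : Rule} {μ : List ℕ}

/-- Unrolls the fold: path number `i` is built from exactly the paths before it, as the one-to-one
rule demands. -/
theorem paths_range (L : List ℕ) (m : ℕ) : paths d k rule μ tab L (List.range m) =
    (List.range m).map fun i => nextPath d k rule tab L (bestSample k tab L i (μ.getD i 0))
      (paths d k rule μ tab L (List.range i)) := by
  induction m with
  | zero => rfl
  | succ m ih =>
    rw [List.range_succ, List.map_append, ← ih, paths, List.foldl_append]
    rfl

theorem nextPoint_sample (c : I.Points k) (acc : List (List ℕ)) (l : Fin k) :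
    nextPoint d k rule tab (inputCode I τs) (pointList c) acc (τs l) = c l := by
  have h1 : mem (τs l) (sampleMoments k (inputCode I τs)) = true :=
    mem_iff.2 (mem_sampleMoments.2 ⟨l, rfl⟩)
  have h2 : (List.range k).filter (fun m => Nat.beq ((inputCode I τs).getD (m + 2) 0) (τs l)) =
      [(l : ℕ)] := by
    have h3 : ∀ m ∈ List.range k, Nat.beq ((inputCode I τs).getD (m + 2) 0) (τs l) =
        decide (m = l) := by
      intro m hm
      rw [List.mem_range] at hm
      rw [getD_inputCode_moment I τs ⟨m, hm⟩, Bool.eq_iff_iff, Nat.beq_eq, decide_eq_true_eq,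
        ← Fin.ext_iff, τs.injective.eq_iff, Fin.ext_iff]
    rw [List.filter_congr h3]
    have := (List.nodup_range (n := k)).filter fun m => decide (m = (l : ℕ))
    refine List.perm_singleton.1 ((List.perm_ext_iff_of_nodup this (List.nodup_singleton _)).2 ?_)
    intro m
    simp only [List.mem_filter, List.mem_range, decide_eq_true_eq, List.mem_singleton]
    exact ⟨fun h => h.2, fun h => ⟨h ▸ l.2, h⟩⟩
  rw [nextPoint, h1, cond_true, h2]
  exact getD_ofFn _ l.2

/-- Because `h` is strictly increasing, comparing the tabulated deviations amounts to comparing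
distances, ties included. -/
theorem nearer_iff (ht : IsTable N R I τs tab) (c : I.Points k) {τ : Fin I.t}
    (hτ : τ ∉ Set.range τs) (i j : Fin I.n) :
    nearer d k tab (inputCode I τs) (pointList c) τ i j = true ↔
      N.length (R.fit I τs c (I.moment τ) - I.pt τ i) <
        N.length (R.fit I τs c (I.moment τ) - I.pt τ j) ∨
      (N.length (R.fit I τs c (I.moment τ) - I.pt τ i) =
        N.length (R.fit I τs c (I.moment τ) - I.pt τ j) ∧
          toLex (I.pt τ i) ≤ toLex (I.pt τ j)) := by
  have hl : ¬ toLex (I.pt τ j) < toLex (I.pt τ i) ↔ toLex (I.pt τ i) ≤ toLex (I.pt τ j) := not_lt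
  rw [nearer, ht c τ i hτ, ht c τ j hτ, Bool.or_eq_true, Bool.and_eq_true, ratLt_iff,
    Bool.not_eq_true', Bool.not_eq_true', Bool.eq_false_iff, Bool.eq_false_iff, ne_eq, ne_eq,
    ratLt_iff, lexLt_inputCode, deviation_lt_iff, deviation_lt_iff, not_lt, hl]
  constructor
  · rintro (h | ⟨h1, h2⟩)
    · exact Or.inl h
    · exact h1.lt_or_eq.imp_right fun h => ⟨h, h2⟩
  · rintro (h | ⟨h1, h2⟩)
    · exact Or.inl h
    · exact Or.inr ⟨h1.le, h2⟩

/-- Outside the sample, the next point is a nearest one among those that the rule leaves. -/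
theorem nextPoint_nearest [NeZero k] (hd : 1 ≤ d) (ht : IsTable N R I τs tab) (c : I.Points k)
    {acc : List (List ℕ)} (hacc : acc.length < I.n) {τ : Fin I.t} (hτ : τ ∉ Set.range τs) :
    ∃ j : Fin I.n, nextPoint d k rule tab (inputCode I τs) (pointList c) acc τ = j ∧
      IsNearest N I τ (R.fit I τs c (I.moment τ)) {j | leaves rule acc τ j = true} j := by
  have h1 : mem τ (sampleMoments k (inputCode I τs)) = false := by
    rw [Bool.eq_false_iff, ne_eq, mem_iff, mem_sampleMoments]; exact hτ
  have hne : (List.range I.n).filter (fun j => leaves rule acc τ j) ≠ [] := by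
    cases rule
    · have : 0 < I.n := by omega
      simp [leaves]
      omega
    -- Fewer than `n` paths have been served, and each occupies one point of the moment, so some
    -- point is left.
    · intro h
      have h2 : List.range I.n ⊆ acc.map fun p => p.getD τ 0 := by
        intro j hj
        have h3 := List.filter_eq_nil_iff.1 h j hj
        simp only [leaves, Bool.not_eq_true', Bool.not_eq_false, List.any_eq_true,
          Nat.beq_eq] at h3
        obtain ⟨p, hp, h3⟩ := h3
        exact List.mem_map.2 ⟨p, hp, h3⟩
      have h3 := (List.nodup_range.subperm h2).length_le
      rw [List.length_range, List.length_map] at h3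
      omega
  have h2 := pick_mem (nearer d k tab (inputCode I τs) (pointList c) τ) hne 0
  have h3 := pick_le_of_key (le := nearer d k tab (inputCode I τs) (pointList c) τ)
    (l := (List.range I.n).filter (fun j => leaves rule acc τ j))
    (fun x => if h : x < I.n then toLex (N.length (R.fit I τs c (I.moment τ) - I.pt τ ⟨x, h⟩),
      toLex (I.pt τ ⟨x, h⟩)) else toLex (0, toLex 0)) (by
      intro x hx y hy
      have hx := List.mem_range.1 (List.mem_filter.1 hx).1
      have hy := List.mem_range.1 (List.mem_filter.1 hy).1
      rw [dif_pos hx, dif_pos hy, Prod.Lex.toLex_le_toLex]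
      exact nearer_iff ht c hτ ⟨x, hx⟩ ⟨y, hy⟩) 0
  rw [nextPoint, h1, cond_false, pointNumbers_inputCode hd]
  generalize pick (nearer d k tab (inputCode I τs) (pointList c) τ)
    ((List.range I.n).filter (fun j => leaves rule acc τ j)) 0 = x at *
  rw [List.mem_filter, List.mem_range] at h2
  refine ⟨⟨x, h2.1⟩, rfl, h2.2, fun j hj => ?_⟩
  have h4 := h3 j (List.mem_filter.2 ⟨List.mem_range.2 j.2, hj⟩)
  rwa [dif_pos h2.1, dif_pos j.2, Prod.Lex.toLex_le_toLex] at h4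

theorem pathOutput_spec [NeZero k] (hd : 1 ≤ d) (hk : 2 ≤ k) (ht : IsTable N R I τs tab)
    {σ : Equiv.Perm (Fin I.n)} (hσ : IsMinMatching (weight N R I τs) σ) :
    ∃ track : Fin I.n → Fin I.t → Fin I.n, IsResult N R rule I τs track ∧
      pathOutput d k rule (matchingCode σ ++ [0]) tab (inputCode I τs) = outputCode I track := by
  obtain ⟨s, w, hw⟩ := exists_weightReply hd hk ht
  choose _ _ c hc using hw
  -- The trailing `0` of the answer lies beyond the positions that are read.
  have hμ : ∀ i : Fin I.n, (matchingCode σ ++ [0]).getD i 0 = (σ i : ℕ) := fun i => by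
    rw [List.getD_append _ _ _ _ (by simp [matchingCode]), matchingCode, getD_ofFn _ i.2]
  generalize hμ' : matchingCode σ ++ [0] = μ at *
  let A : ℕ → List (List ℕ) := fun i => paths d k rule μ tab (inputCode I τs) (List.range i)
  let P : ℕ → List ℕ := fun i => nextPath d k rule tab (inputCode I τs)
    (bestSample k tab (inputCode I τs) i (μ.getD i 0)) (A i)
  have hA : ∀ i, A i = (List.range i).map P := fun i => paths_range _ i
  have hAlen : ∀ i, (A i).length = i := fun i => by rw [hA]; simp
  have hP : ∀ i : Fin I.n, P i = List.ofFn fun τ : Fin I.t =>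
      nextPoint d k rule tab (inputCode I τs) (pointList (c i (σ i))) (A i) τ := fun i => by
    simp only [P]
    rw [nextPath, momentNumbers_inputCode hd (Fin.pos i), map_range_eq_ofFn, hμ, (hc i (σ i)).2.2]
  have hex : ∀ (i : Fin I.n) (τ : Fin I.t), ∃ j : Fin I.n,
      nextPoint d k rule tab (inputCode I τs) (pointList (c i (σ i))) (A i) τ = j ∧
        (τ ∉ Set.range τs → IsNearest N I τ (R.fit I τs (c i (σ i)) (I.moment τ))
          {j | leaves rule (A i) τ j = true} j) := by
    intro i τ
    by_cases hτ : τ ∈ Set.range τs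
    · obtain ⟨l, rfl⟩ := hτ
      exact ⟨_, nextPoint_sample _ _ l, fun h => (h ⟨l, rfl⟩).elim⟩
    · obtain ⟨j, h1, h2⟩ := nextPoint_nearest (rule := rule) hd ht (c i (σ i)) (acc := A i)
        (by rw [hAlen]; exact i.2) hτ
      exact ⟨j, h1, fun _ => h2⟩
  choose track h1 h2 using hex
  -- The paths accumulated by the program are the tracks of smaller index, so both descriptions of
  -- the free points agree.
  have havail : ∀ (i : Fin I.n) (τ : Fin I.t),
      {j : Fin I.n | leaves rule (A i) τ j = true} = available rule I track i τ := by
    intro i τ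
    clear_value A P
    cases rule
    · exact Set.eq_univ_of_forall fun _ => rfl
    · ext j
      have hval : ∀ i' : Fin I.n, (P i').getD τ 0 = track i' τ := fun i' => by
        rw [hP, getD_ofFn _ τ.2, ← h1 i' τ]
      simp only [leaves, available, Set.mem_ofPred_eq, Bool.not_eq_true', List.any_eq_false, hA,
        List.mem_map, List.mem_range, Nat.beq_eq]
      constructor
      · intro h i' hi' h'
        exact h _ ⟨i', hi', rfl⟩ ((hval i').trans (congrArg _ h'))
      · rintro h _ ⟨i', hi', rfl⟩ h'
        rw [hval ⟨i', hi'.trans i.2⟩] at h'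
        exact h ⟨i', hi'.trans i.2⟩ hi' (Fin.ext h')
  refine ⟨track, ⟨σ, fun i => c i (σ i), hσ, fun i => ⟨(hc i (σ i)).1, (hc i (σ i)).2.1⟩,
    fun i l => ?_, fun i τ hτ => ?_⟩, ?_⟩
  · exact Fin.ext ((h1 i (τs l)).symm.trans (nextPoint_sample _ _ l))
  · rw [← havail]; exact h2 i τ hτ
  · rw [pathOutput, pointNumbers_inputCode hd]
    show (A I.n).flatMap (fun p => p) = _
    rw [hA, List.flatMap_map, flatMap_range_eq_seqCode, outputCode]
    congr 1
    funext i
    rw [hP]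
    congr 1
    funext τ
    exact h1 i τ

end Paths

/-! ## The main result -/

section Main

variable {d k : ℕ} {I : Instance d} {τs : I.Moments k}

theorem lookup_answerTable {ans : List ℕ → List ℕ} {qs : List (List ℕ)} {q : List ℕ} (hq : q ∈ qs) :
    lookup q (answerTable ans qs) = ans q ++ [0] := by
  refine lookup_eq ?_ fun r' h => ?_
  · rw [answerTable, List.mem_reverse, List.mem_map]
    exact ⟨q, hq, rfl⟩
  · rw [answerTable, List.mem_reverse, List.mem_map] at h
    obtain ⟨q', -, h⟩ := h
    rw [Prod.mk.injEq] at h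
    rw [← h.2, h.1]

/-- For a fixed instance and fixed moments a query determines its sample, moment and point, so the
answers form a well-defined function of the query. -/
theorem queryCode_injective {c c' : I.Points k} {τ τ' : Fin I.t} {j j' : Fin I.n}
    (h : queryCode I τs c τ j = queryCode I τs c' τ' j') : c = c' ∧ τ = τ' ∧ j = j' := by
  obtain ⟨h1, h2⟩ := List.append_inj' h rfl
  have h3 := List.ofFn_injective (List.append_cancel_left h1)
  simp only [List.cons.injEq, and_true] at h2
  exact ⟨funext fun l => Fin.ext (congrFun h3 l), Fin.ext h2.1, Fin.ext h2.2⟩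

theorem eval_mono_nat (p : Polynomial ℕ) {a b : ℕ} (h : a ≤ b) : p.eval a ≤ p.eval b := by
  rw [Polynomial.eval_eq_sum_range, Polynomial.eval_eq_sum_range]
  gcongr

theorem exists_answers (N : Gauge d) (R : SampleFits d k) (I : Instance d) (τs : I.Moments k) :
    ∃ ans : List ℕ → List ℕ, ∀ (c : I.Points k) (τ : Fin I.t) (j : Fin I.n),
      ans (queryCode I τs c τ j) = ratCode (deviation N R I τs c τ j) := by
  classical
  refine ⟨fun q => if h : ∃ x : I.Points k × Fin I.t × Fin I.n, q = queryCode I τs x.1 x.2.1 x.2.2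
    then ratCode (deviation N R I τs h.choose.1 h.choose.2.1 h.choose.2.2) else [],
      fun c τ j => ?_⟩
  have h : ∃ x : I.Points k × Fin I.t × Fin I.n,
      queryCode I τs c τ j = queryCode I τs x.1 x.2.1 x.2.2 := ⟨(c, τ, j), rfl⟩
  refine (dif_pos h).trans ?_
  obtain ⟨h1, h2, h3⟩ := queryCode_injective h.choose_spec
  rw [← h1, ← h2, ← h3]

/-- The general call program is applied with the queries, the matching input and the path output. It
is fixed before the norm, the fits and the subroutines are introduced; these enter only through the
bounds for answers and times. -/
theorem exists_pathFitting [NeZero k] (hd : 1 ≤ d) (hk : 2 ≤ k) (rule : Rule) :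
    ∃ P : Prog Sub, ∀ (N : Gauge d) (R : SampleFits d k) (E M : Prog Empty),
      Evaluates N R E → SolvesMatching M →
      ∃ p : Polynomial ℕ, ∀ (I : Instance d) (τs : I.Moments k),
        ∃ (track : Fin I.n → Fin I.t → Fin I.n) (T : ℕ) (calls : Sub → ℕ),
          IsResult N R rule I τs track ∧
          ExecWith (subroutines E M) P (encode (inputCode I τs))
            (encode (outputCode I track)) T calls ∧
          T ≤ p.eval (encode (inputCode I τs)).length ∧
          calls Sub.evaluation ≤ I.n ^ (k + 1) * I.t ∧
          calls Sub.matching = 1 := by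
  have hpre : PT (queries k) := .queries .id'
  have hmid : PT fun s : List (List ℕ × List ℕ) × List ℕ => matchingQuery k s.1 s.2 := by fun_prop
  obtain ⟨P, G, hG, hP⟩ := exists_callProgram hpre hmid
    (PT.pathOutput (d := d) (k := k) (rule := rule) (.fst .id') (.fst (.snd .id'))
      (.snd (.snd .id')))
  obtain ⟨e₁, he₁⟩ := hpre.sz_bdd
  obtain ⟨e₂, he₂⟩ := hmid.sz_bdd
  refine ⟨P, fun N R E M ⟨pE, hE⟩ ⟨pM, hM⟩ => ?_⟩
  have hid : PolyBdd (X := ℕ) id fun x => x := .self id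
  -- bounds for the queries, the answers, the table, the input and the output of the matching
  let B₁ : ℕ → ℕ := fun x => (6 * x + 3 + 2) ^ e₁
  let B₂ : ℕ → ℕ := fun x => B₁ x + pE.eval (B₁ x)
  let B₃ : ℕ → ℕ := fun x => B₂ x * (7 * B₂ x + 5) + 1
  let B₄ : ℕ → ℕ := fun x => (B₃ x + (6 * x + 3) + 1 + 2) ^ e₂
  let B₅ : ℕ → ℕ := fun x => x + B₂ x + (B₄ x + pM.eval (B₄ x))
  have h₁ : PolyBdd id B₁ := ((hid.const_mul_add _ _).add (.const _ 2)).pow _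
  have h₂ : PolyBdd id B₂ := h₁.add (h₁.eval pE)
  have h₃ : PolyBdd id B₃ := (h₂.mul (h₂.const_mul_add _ _)).add (.const _ 1)
  have h₄ : PolyBdd id B₄ :=
    (((h₃.add (hid.const_mul_add _ _)).add (.const _ 1)).add (.const _ 2)).pow _
  have h₅ : PolyBdd id B₅ := (hid.add h₂).add (h₄.add (h₄.eval pM))
  obtain ⟨e, he⟩ := (show PolyBdd id fun x => G (B₅ x) from (hG.comp B₅).trans h₅)
  refine ⟨(Polynomial.X + 2) ^ e, fun I τs => ?_⟩
  obtain ⟨ans, hans⟩ := exists_answers N R I τs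
  have hL : sz (inputCode I τs) ≤ 6 * (encode (inputCode I τs)).length + 3 := by
    have h1 := sz_le_length_encode (inputCode I τs)
    have h2 := sz_append (inputCode I τs) [0]
    have h3 := sz_cons 0 ([] : List ℕ)
    omega
  have hq : sz (queries k (inputCode I τs)) ≤ B₁ (encode (inputCode I τs)).length :=
    (he₁ _).trans (Nat.pow_le_pow_left (by omega) _)
  have hB : ∀ x, B₁ x ≤ B₂ x ∧ B₂ x ≤ B₅ x ∧ x ≤ B₅ x := fun x => by
    simp only [B₂, B₅]; omega
  obtain ⟨hB1, hB2, hB3⟩ := hB (encode (inputCode I τs)).length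
  have hqueries : ∀ q ∈ queries k (inputCode I τs),
      (encode (ans q)).length ≤ B₂ (encode (inputCode I τs)).length ∧
        ∃ T ≤ B₂ (encode (inputCode I τs)).length, Exec E (encode q) (encode (ans q)) T := by
    intro q hqs
    obtain ⟨c, τ, j, hτ, rfl⟩ := (mem_queries hd).1 hqs
    obtain ⟨T, h1, h2⟩ := hE I τs c τ j hτ
    rw [← hans] at h1
    have h3 : (encode (queryCode I τs c τ j)).length ≤ B₁ (encode (inputCode I τs)).length :=
      ((length_encode_le_sz _).trans (sz_le_of_mem hqs).le).trans hq
    have h4 := h2.trans (eval_mono_nat pE h3)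
    have h5 := h1.length_le
    exact ⟨by simp only [B₂]; omega, T, by simp only [B₂]; omega, h1⟩
  have htable : IsTable N R I τs (answerTable ans (queries k (inputCode I τs))) := by
    intro c τ j hτ
    rw [← hans]
    exact lookup_answerTable ((mem_queries hd).2 ⟨c, τ, j, hτ, rfl⟩)
  obtain ⟨s, w, hw⟩ := exists_weightReply hd hk htable
  have hmq := matchingQuery_inputCode hd fun i j => (hw i j).1
  -- The subroutine receives the weights up to the shift, and its matching is also minimal for the
  -- true weights.
  obtain ⟨σ, T, hσ, hT, hTp⟩ := hM I.n w
  obtain ⟨track, h1, h2⟩ := pathOutput_spec (rule := rule) hd hk htable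
    (isMinMatching_of_add (fun i j => (hw i j).2.1) hσ)
  have hw4 : (encode (weightCode w)).length ≤ B₄ (encode (inputCode I τs)).length := by
    rw [← hmq]
    refine ((length_encode_le_sz _).trans (he₂ (answerTable ans (queries k (inputCode I τs)),
      inputCode I τs))).trans (Nat.pow_le_pow_left ?_ _)
    have := sz_answerTable_le (hq.trans hB1) fun q hq => (hqueries q hq).1
    rw [sz_mk]
    simp only [B₃]
    omega
  have hTM := hTp.trans (eval_mono_nat pM hw4)
  have hy := hT.length_le
  obtain ⟨T', hT', hrun⟩ := hP (fun j => Exec (subroutines E M j)) (inputCode I τs) ans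
    (matchingCode σ) (B₅ (encode (inputCode I τs)).length) hB3
    (fun q hq => ⟨(hqueries q hq).1.trans hB2, by
      obtain ⟨T, hT, h⟩ := (hqueries q hq).2
      exact ⟨T, hT.trans hB2, h⟩⟩)
    (by simp only [B₅]; omega)
    ⟨T, by simp only [B₅]; omega, by rw [hmq]; exact hT⟩
  refine ⟨track, T', _, h1, ⟨_, hrun, ?_⟩, (hT'.trans (he _)).trans (by simp), ?_, ?_⟩
  · rw [quad_zero, h2]
  · simpa using length_queries_le hd
  · simp

end Main

end PathFitting

theorem theorem3p11 (d k : ℕ) [NeZero k] (hd : 1 ≤ d) (hk : 2 ≤ k) (rule : Rule) :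
    -- there is a polynomial time program for minimum weight perfect bipartite matching
    (∃ M : Prog Empty, SolvesMatching M) ∧
    -- and one program `P` that performs Path Fitting with whatever polynomial time subroutines
    ∃ (P : Prog Sub) (C : ℕ),
      ∀ (N : Gauge d) (R : SampleFits d k) (E M : Prog Empty),
        Evaluates N R E → SolvesMatching M →
        ∃ p : Polynomial ℕ, ∀ (I : Instance d) (τs : I.Moments k),
          ∃ (track : Fin I.n → Fin I.t → Fin I.n) (T : ℕ) (calls : Sub → ℕ),
            IsResult N R rule I τs track ∧
            ExecWith (subroutines E M) P (encode (inputCode I τs))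
              (encode (outputCode I track)) T calls ∧
            T ≤ p.eval (encode (inputCode I τs)).length ∧
            calls Sub.evaluation ≤ C * I.n ^ (k + 1) * I.t ∧
            calls Sub.matching = 1 := by
  obtain ⟨P, hP⟩ := exists_pathFitting hd hk rule
  -- Each deviation is asked for at most once: `n ^ k` samples, at most `t` moments and `n` points
  -- give the constant `1`.
  refine ⟨exists_solvesMatching, P, 1, ?_⟩
  simpa only [one_mul] using hP
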